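/- Let $m\ge 1$ be an integer, $n=2m+2$, $\rho>1$, and let $\mathcal W^{\ge0}_{\mathbb R}$ be the Banach space of power series $f(\lambda)=\sum_{k\ge0}f_k\lambda^k$ with real coefficients and $\|f\|_\rho=\sum_k|f_k|\rho^k<\infty$; write $f^0=f_0$. For parameters $\mathbf x=(r,a,b,c)\in\mathbb R\times(\mathcal W^{\ge0}_{\mathbb R})^3$ and $t\in\mathbb R$ put $p_j=e^{2\pi i j/n}$, $D=\mathrm{diag}(e^{i\pi m/n},e^{-i\pi m/n})$, $$A_0(\lambda)=\begin{pmatrix}a(\lambda)&\lambda^{-1}b(\lambda)\\ \lambda c(\lambda)&-a(\lambda)\end{pmatrix},\qquad A_{j+1}(\lambda)=D^{-1}A_j(-\lambda)D\quad(0\le j\le n-2),$$ $$\eta_t^{\mathbf x}=\begin{pmatrix}0&0\\ mr z^{m-1}dz&0\end{pmatrix}+t\sum_{j=0}^{n-1}A_j(\lambda)\frac{dz}{z-p_j}.$$ Let $\Phi_t$ be the solution of $d\Phi_t=\Phi_t\,\eta_t^{\mathbf x}$, $\Phi_t(0)=\mathrm{Id}$, and let $M(t)=M(t,\mathbf x)(\lambda)$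 be its monodromy along the loop $\gamma_0$ based at $0$ that runs once counterclockwise along the circle through $0$ centred at $\frac{1}{2\cos(\pi/n)}$ (which encloses $p_0=1$ and no other $p_j$). Let $\widetilde M(t)=\frac1t\log M(t)$ for small $t\ne0$ and $\widetilde M(0)=M'(0)$ (for fixed $\mathbf x$), and let $f^*(\lambda)=\overline{f(1/\overline\lambda)}$. Consider the equations $$\widetilde M_{11}+\widetilde M_{11}^*=0,\quad \widetilde M_{21}+\widetilde M_{12}^*=0\ \text{ on } S^1,\qquad \widetilde M_{12}|_{\lambda=1}=\widetilde M_{12}|_{\lambda=-1}=0,\qquad (a^0)^2+b^0c^0=1, \tag{1}$$ and let $\mathbf x_0$ be given by $r=1$, $a=\lambda$, $b=\frac{\lambda^2-1}{2}$, $c=-2$. Then there are $\varepsilon,\delta>0$ such that for every real $t$ with $|t|<\varepsilon$ the equations (1) have exactly one solution $\mathbf x(t)=(r(t),a(t),b(t),c(t))$ in the $\delta$-ball around $\mathbf x_0$. One has $\mathbf x(0)=\mathbf x_0$, the map $t\mapsto\mathbf x(t)$ is differentiable at $t=0$ with respect to $\|\cdot\|_\rho$, and $$a'(0)=(1-\lambda^2)\kappa_m,\qquad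 b'(0)=(\lambda-\lambda^3)\kappa_m,\qquad c'(0)=0,\qquad r'(0)=0,$$ where $\displaystyle \kappa_m=\frac n2\int_0^1\frac{(1-x^m)^2}{1-x^n}\,dx$. -/

import Mathlib

open Polynomial

noncomputable section

namespace LawsonDPW

/-! ### Loop spaces -/

/-- Coefficient sequences of the power series `∑ fₖ λᵏ` with real coefficients and
`∑ |fₖ| ρᵏ < ∞`. -/
def wienerSubmodule (ρ : ℝ) : Submodule ℝ (ℕ → ℝ) where
  carrier := {f | Summable fun k => |f k| * |ρ| ^ k}
  zero_mem' := by simp [summable_zero]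
  add_mem' := by
    intro f g hf hg
    refine Summable.of_nonneg_of_le (fun k => by positivity) (fun k => ?_) (hf.add hg)
    rw [← add_mul]
    exact mul_le_mul_of_nonneg_right (abs_add_le _ _) (by positivity)
  smul_mem' := by
    intro c f hf
    refine (hf.mul_left |c|).congr fun k => ?_
    simp [abs_mul, mul_assoc]

/-- The space `𝒲^{≥0}_ℝ` of loops `f(λ) = ∑_{k ≥ 0} fₖ λᵏ` with real Fourier coefficients and
finite norm `‖f‖_ρ = ∑ |fₖ| ρᵏ`. -/
def W (ρ : ℝ) : Type := wienerSubmodule ρ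

namespace W

variable {ρ : ℝ}

instance : AddCommGroup (W ρ) := inferInstanceAs (AddCommGroup (wienerSubmodule ρ))

instance : Module ℝ (W ρ) := inferInstanceAs (Module ℝ (wienerSubmodule ρ))

/-- The `k`-th Fourier coefficient. -/
def coeff (f : W ρ) (k : ℕ) : ℝ := f.1 k

theorem summable (f : W ρ) : Summable fun k => |f.coeff k| * |ρ| ^ k := f.2

@[ext]
theorem ext {f g : W ρ} (h : ∀ k, f.coeff k = g.coeff k) : f = g := Subtype.ext (funext h)

@[simp] theorem coeff_zero (k : ℕ) : (0 : W ρ).coeff k = 0 := rfl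

@[simp] theorem coeff_add (f g : W ρ) (k : ℕ) : (f + g).coeff k = f.coeff k + g.coeff k := rfl

@[simp] theorem coeff_smul (c : ℝ) (f : W ρ) (k : ℕ) : (c • f).coeff k = c * f.coeff k := rfl

/-- The norm `‖f‖_ρ = ∑ |fₖ| ρᵏ` (here `ρ > 1`, so `|ρ| = ρ`). -/
instance : Norm (W ρ) := ⟨fun f => ∑' k, |f.coeff k| * |ρ| ^ k⟩

theorem norm_def (f : W ρ) : ‖f‖ = ∑' k, |f.coeff k| * |ρ| ^ k := rfl

theorem core [hρ : Fact (1 < ρ)] : NormedSpace.Core ℝ (W ρ) where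
  norm_nonneg f := tsum_nonneg fun k => by positivity
  norm_smul c f := by
    simp only [norm_def, coeff_smul, abs_mul, mul_assoc, tsum_mul_left, Real.norm_eq_abs]
  norm_triangle f g := by
    simp only [norm_def]
    rw [← f.summable.tsum_add g.summable]
    refine (f + g).summable.tsum_le_tsum (fun k => ?_) (f.summable.add g.summable)
    rw [← add_mul, coeff_add]
    exact mul_le_mul_of_nonneg_right (abs_add_le _ _) (by positivity)
  norm_eq_zero_iff f := by
    constructor
    · intro h
      rw [norm_def] at h
      have h0 := (hasSum_zero_iff_of_nonneg (fun k => by positivity)).1 (h ▸ f.summable.hasSum)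
      ext k
      have hk := congrFun h0 k
      have hpos : 0 < |ρ| ^ k := pow_pos (abs_pos.2 (by linarith [hρ.out])) k
      simpa [hpos.ne'] using hk
    · rintro rfl
      simp [norm_def]

instance [Fact (1 < ρ)] : NormedAddCommGroup (W ρ) := NormedAddCommGroup.ofCore core

instance [Fact (1 < ρ)] : NormedSpace ℝ (W ρ) := NormedSpace.ofCore core

/-- A real polynomial in `λ`, as an element of `𝒲^{≥0}_ℝ`. -/
def ofPoly (p : ℝ[X]) : W ρ :=
  ⟨p.coeff, by
    refine summable_of_ne_finset_zero (s := p.support) fun k hk => ?_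
    simp [Polynomial.notMem_support_iff.1 hk]⟩

/-- The value `f(λ) = ∑ fₖ λᵏ`. -/
def eval (f : W ρ) (l : ℂ) : ℂ := ∑' k, (f.coeff k : ℂ) * l ^ k

end W

/-! ### The potential -/

/-- Complex `2 × 2` matrices. -/
abbrev Mat := Matrix (Fin 2) (Fin 2) ℂ

/-- The parameter vector `(r, a, b, c)`. -/
abbrev Params (ρ : ℝ) := ℝ × W ρ × W ρ × W ρ

/-- The punctures `p_j = exp (2πi j / n)`, `n = 2m + 2`. -/
def puncture (m j : ℕ) : ℂ := Complex.exp (2 * Real.pi * Complex.I * j / (2 * m + 2))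

/-- `D = diag (exp (iπm/n), exp (-iπm/n))`, `n = 2m + 2`. -/
def matD (m : ℕ) : Mat :=
  !![Complex.exp (Complex.I * Real.pi * m / (2 * m + 2)), 0;
     0, Complex.exp (-(Complex.I * Real.pi * m / (2 * m + 2)))]

/-- The residue matrices: `A₀(λ) = (a, λ⁻¹ b; λ c, -a)` and `A_{j+1}(λ) = D⁻¹ A_j(-λ) D`. -/
def matA {ρ : ℝ} (m : ℕ) (x : Params ρ) : ℕ → ℂ → Mat
  | 0, l => !![x.2.1.eval l, l⁻¹ * x.2.2.1.eval l; l * x.2.2.2.eval l, -x.2.1.eval l]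
  | j + 1, l => (matD m)⁻¹ * matA m x j (-l) * matD m

/-- The coefficient of `dz` in the potential
`η_t^x = (0, 0; m r z^{m-1}, 0) dz + t ∑_{j < n} A_j(λ) dz / (z - p_j)`. -/
def potential {ρ : ℝ} (m : ℕ) (t : ℝ) (x : Params ρ) (l z : ℂ) : Mat :=
  !![0, 0; m * x.1 * z ^ (m - 1), 0] +
    (t : ℂ) • ∑ j ∈ Finset.range (2 * m + 2), (z - puncture m j)⁻¹ • matA m x j l

/-! ### The monodromy -/

/-- `Y` is the continuation along `γ : [0, 1] → ℂ` of the solution of `dΦ = Φ η` that is the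
identity at `γ 0`. -/
def IsSolutionAlong (η : ℂ → Mat) (γ : ℝ → ℂ) (Y : ℝ → Mat) : Prop :=
  Y 0 = 1 ∧ ∀ s ∈ Set.Icc (0 : ℝ) 1, ∀ i j,
    HasDerivWithinAt (fun u => Y u i j) (deriv γ s * (Y s * η (γ s)) i j) (Set.Icc 0 1) s

open Classical in
/-- The monodromy along the loop `γ` of the solution of `dΦ = Φ η` that is the identity at the base
point: the value at the end of `γ` of its continuation along `γ` (which exists and is unique when
`η` is continuous along the smooth loop `γ`). -/
def monodromy (η : ℂ → Mat) (γ : ℝ → ℂ) : Mat :=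
  if h : ∃ Y, IsSolutionAlong η γ Y then h.choose 1 else 1

/-- The generator `γ₀` of the fundamental group with base point `0`: the circle through `0`
centred on the positive real axis and passing through `exp (± iπ/n)`, `n = 2m + 2`, run through
once counterclockwise. It encloses the point `exp (iθ)` of the unit circle if and only if
`cos θ > cos (π/n)`, hence `p₀ = 1` and no other puncture. -/
def loop (m : ℕ) (s : ℝ) : ℂ :=
  ((1 / (2 * Real.cos (Real.pi / (2 * m + 2))) : ℝ) : ℂ) *
    (1 - Complex.exp (2 * Real.pi * Complex.I * s))

/-- `M(t)(λ)`, the monodromy of `Φ_t` along `γ₀`, for the parameter `x`. -/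
def M {ρ : ℝ} (m : ℕ) (t : ℝ) (x : Params ρ) (l : ℂ) : Mat :=
  monodromy (potential m t x l) (loop m)

/-- The principal logarithm of a matrix close to the identity. -/
def matLog (B : Mat) : Mat := ∑' k : ℕ, ((-1) ^ k / ((k : ℂ) + 1)) • (B - 1) ^ (k + 1)

/-- `M̃(t) = (1/t) log M(t)` for `t ≠ 0`, extended by `M̃(0) = M'(0)`. -/
def Mtilde {ρ : ℝ} (m : ℕ) (t : ℝ) (x : Params ρ) (l : ℂ) : Mat :=
  if t = 0 then Matrix.of fun i j => deriv (fun s : ℝ => M m s x l i j) 0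
  else (t : ℂ)⁻¹ • matLog (M m t x l)

/-! ### The monodromy problem -/

/-- The involution `f*(λ) = conj (f (1 / conj λ))`. -/
def starLoop (f : ℂ → ℂ) (l : ℂ) : ℂ := starRingEnd ℂ (f (1 / starRingEnd ℂ l))

/-- `ℱ(t, x) = (M̃₁₁ + M̃₁₁*) / (2πi)`. -/
def F {ρ : ℝ} (m : ℕ) (t : ℝ) (x : Params ρ) (l : ℂ) : ℂ :=
  1 / (2 * Real.pi * Complex.I) *
    (Mtilde m t x l 0 0 + starLoop (fun w => Mtilde m t x w 0 0) l)

/-- `𝒢(t, x) = (M̃₂₁ + M̃₁₂*) / (2πi)`. -/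
def G {ρ : ℝ} (m : ℕ) (t : ℝ) (x : Params ρ) (l : ℂ) : ℂ :=
  1 / (2 * Real.pi * Complex.I) *
    (Mtilde m t x l 1 0 + starLoop (fun w => Mtilde m t x w 0 1) l)

/-- `ℋ₁(t, x) = M̃₁₂(λ = 1) / (2πi)`. -/
def H₁ {ρ : ℝ} (m : ℕ) (t : ℝ) (x : Params ρ) : ℂ :=
  1 / (2 * Real.pi * Complex.I) * Mtilde m t x 1 0 1

/-- `ℋ₂(t, x) = M̃₁₂(λ = -1) / (2πi)`. -/
def H₂ {ρ : ℝ} (m : ℕ) (t : ℝ) (x : Params ρ) : ℂ :=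
  1 / (2 * Real.pi * Complex.I) * Mtilde m t x (-1) 0 1

/-- `𝒦(x) = (a⁰)² + b⁰ c⁰`. -/
def K {ρ : ℝ} (x : Params ρ) : ℝ :=
  x.2.1.coeff 0 ^ 2 + x.2.2.1.coeff 0 * x.2.2.2.coeff 0

/-- The normalised monodromy problem `ℱ = 0`, `𝒢 = 0` (as loops on the unit circle),
`ℋ₁ = ℋ₂ = 0`, `𝒦 = 1`. -/
def SolvesMonodromyProblem {ρ : ℝ} (m : ℕ) (t : ℝ) (x : Params ρ) : Prop :=
  (∀ l : ℂ, ‖l‖ = 1 → F m t x l = 0) ∧ (∀ l : ℂ, ‖l‖ = 1 → G m t x l = 0) ∧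
    H₁ m t x = 0 ∧ H₂ m t x = 0 ∧ K x = 1

/-- The initial value `r = 1`, `a = λ`, `b = (λ² - 1)/2`, `c = -2`. -/
def x₀ (ρ : ℝ) : Params ρ :=
  (1, W.ofPoly X, W.ofPoly (C (1 / 2) * (X ^ 2 - 1)), W.ofPoly (C (-2)))

/-- `κ_m = (n/2) ∫₀¹ (1 - xᵐ)² / (1 - xⁿ) dx`, `n = 2m + 2`. -/
def kappa (m : ℕ) : ℝ :=
  ((2 * m + 2 : ℝ) / 2) * ∫ x in (0 : ℝ)..1, (1 - x ^ m) ^ 2 / (1 - x ^ (2 * m + 2))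

end LawsonDPW

end

noncomputable section

/-! For t = 0 the equation is solved by g(z) = (1, 0; r zᵐ, 1). Hence Φ_t = U g along the loop,
where U' = t U B and B is the pullback of g (∑ A_j dz / (z - p_j)) g⁻¹ (`gaugedPotential`). Since
g(0) = 1 and the loop closes up at 0, M(t) = U(1). The equation for U is solved by a Neumann series
in the Banach algebra of matrices over a Wiener algebra of Laurent series in λ (`transport`,
`M_eq`), so that all λ on the circle are treated at once. Writing (U(1) - 1)/t as an integral
removes the division by t and gives M̃ = ∫B + t (∫(∫₀ˢ B) B - ½ (∫B)²) + o(t), strictly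
differentiable in (t, x) at t = 0 (`hasStrictFDerivAt_logTransport_sub`).

The potential is invariant under complex conjugation of z, λ and the matrix entries, while
conjugation reverses the loop. So conj M(λ̄) = M(λ)⁻¹, and the Laurent coefficients of M̃/(2πi) are
real (`conj_coeff_logMonodromy`). The equations (1) become a system of real equations with values in
W³ × ℝ² × ℝ: the linear map `defect` applied to M̃/(2πi), together with 𝒦 = 1
(`solvesMonodromyProblem_iff_defect`).

By the residue theorem M̃(0)/(2πi) is the conjugate of A₀ by g(1), so the x-derivative at (0, x₀) is
explicit. Comparing coefficients shows that it is bijective (`IsLinearisation.eq_zero`,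
`exists_linearisation_eq`), and the implicit function theorem gives the curve x(t).

The velocity needs the t-derivative at x₀. There the residues are powers of p_j times fixed loops,
and B is a combination of the forms c_k = n zᵏ dz/(zⁿ - 1) for k = 0, m, 2m (`gaugedPotential_x₀`).
Up to terms invariant under λ ↦ 1/λ, only a commutator of iterated integrals of c_m against v = c₀ -
2c_m + c_{2m} = n (1 - zᵐ)² dz/(zⁿ - 1) survives. The form v is regular at z = 1, so it has a
primitive h with h(0) = 0 on the disc. Integration by parts and the residue 1 of c_m at z = 1 give
-4πi h(1) = 8πi κ_m (`iterInt_sub_swap`). The stated velocity solves the resulting linear system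
(`defect_linearisation_initialVelocity`). -/

namespace LawsonDPW

open unitInterval

/-! ### Linear differential equations in a Banach algebra, solved by Neumann series. -/

section Volterra

/-- The Banach algebra of continuous functions on `[0, 1]` with values in `𝒜`. -/
def Path (𝒜 : Type*) [NormedRing 𝒜] : Type _ := C(I, 𝒜)

instance (𝒜 : Type*) [NormedRing 𝒜] : NormedRing (Path 𝒜) := inferInstanceAs (NormedRing C(I, 𝒜))

instance (𝒜 : Type*) [NormedRing 𝒜] [NormedAlgebra ℂ 𝒜] : NormedAlgebra ℂ (Path 𝒜) :=
  inferInstanceAs (NormedAlgebra ℂ C(I, 𝒜))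

instance (𝒜 : Type*) [NormedRing 𝒜] [CompleteSpace 𝒜] : CompleteSpace (Path 𝒜) :=
  inferInstanceAs (CompleteSpace C(I, 𝒜))

instance (𝒜 : Type*) [NormedRing 𝒜] : FunLike (Path 𝒜) I 𝒜 :=
  inferInstanceAs (FunLike C(I, 𝒜) I 𝒜)

namespace Path

variable {𝒜 : Type*} [NormedRing 𝒜]

@[ext] theorem ext {u v : Path 𝒜} (h : ∀ s, u s = v s) : u = v := ContinuousMap.ext h

protected theorem continuous (u : Path 𝒜) : Continuous u := ContinuousMap.continuous (X := I) u

@[simp] theorem add_apply (u v : Path 𝒜) (s : I) : (u + v) s = u s + v s := rfl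

@[simp] theorem mul_apply (u v : Path 𝒜) (s : I) : (u * v) s = u s * v s := rfl

@[simp] theorem one_apply (s : I) : (1 : Path 𝒜) s = 1 := rfl

@[simp] theorem smul_apply [NormedAlgebra ℂ 𝒜] (c : ℂ) (u : Path 𝒜) (s : I) :
    (c • u) s = c • u s := rfl

theorem norm_apply_le (u : Path 𝒜) (s : I) : ‖u s‖ ≤ ‖u‖ := ContinuousMap.norm_coe_le_norm (α := I) u s

theorem norm_le (u : Path 𝒜) {C : ℝ} (hC : 0 ≤ C) (h : ∀ s, ‖u s‖ ≤ C) : ‖u‖ ≤ C :=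
  (ContinuousMap.norm_le (α := I) u hC).2 h

/-- Evaluation at `s`. -/
def evalCLM [NormedAlgebra ℂ 𝒜] (s : I) : Path 𝒜 →L[ℂ] 𝒜 :=
  LinearMap.mkContinuous ⟨⟨fun u => u s, fun _ _ => rfl⟩, fun _ _ => rfl⟩ 1
    (fun u => by rw [one_mul]; exact u.norm_apply_le s)

end Path

variable {𝒜 : Type*} [NormedRing 𝒜] [NormedAlgebra ℂ 𝒜] [CompleteSpace 𝒜]

/-- The Volterra operator `u ↦ (s ↦ ∫₀ˢ u)` on continuous functions on `[0, 1]`. -/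
def volterra (𝒜 : Type*) [NormedRing 𝒜] [NormedAlgebra ℂ 𝒜] [CompleteSpace 𝒜] :
    Path 𝒜 →L[ℂ] Path 𝒜 :=
  LinearMap.mkContinuous
    { toFun := fun u => (⟨fun s => ∫ x in (0 : ℝ)..s, Set.IccExtend zero_le_one u x, by
        have h : Continuous fun s : ℝ => ∫ x in (0 : ℝ)..s, Set.IccExtend zero_le_one u x :=
          intervalIntegral.continuous_primitive
            (fun a b => (u.continuous.Icc_extend').intervalIntegrable a b) 0
        exact h.comp continuous_subtype_val⟩ : C(I, 𝒜))
      map_add' := fun u v => by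
        ext s
        refine Eq.trans ?_ (intervalIntegral.integral_add
          ((u.continuous.Icc_extend').intervalIntegrable _ _)
          ((v.continuous.Icc_extend').intervalIntegrable _ _))
        rfl
      map_smul' := fun c u => by
        ext s
        exact intervalIntegral.integral_smul c _ } 1 (fun u => by
    rw [one_mul]
    refine Path.norm_le _ (norm_nonneg u) fun s => ?_
    have h := intervalIntegral.norm_integral_le_of_norm_le_const (a := 0) (b := (s : ℝ))
      (f := Set.IccExtend zero_le_one u) (C := ‖u‖) (fun x _ => u.norm_apply_le _)
    refine h.trans ?_
    rw [sub_zero, abs_of_nonneg s.2.1]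
    exact mul_le_of_le_one_right (norm_nonneg u) s.2.2)

theorem volterra_apply (u : Path 𝒜) (s : I) :
    volterra 𝒜 u s = ∫ x in (0 : ℝ)..s, Set.IccExtend zero_le_one u x := rfl

/-- The operator `u ↦ (s ↦ ∫₀ˢ u B)`, as a continuous linear function of `B`. -/
def transportOp (𝒜 : Type*) [NormedRing 𝒜] [NormedAlgebra ℂ 𝒜] [CompleteSpace 𝒜] :
    Path 𝒜 →L[ℂ] Path 𝒜 →L[ℂ] Path 𝒜 :=
  (ContinuousLinearMap.compL ℂ (Path 𝒜) (Path 𝒜) (Path 𝒜) (volterra 𝒜)).comp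
    (ContinuousLinearMap.mul ℂ (Path 𝒜)).flip

@[simp] theorem transportOp_apply (B u : Path 𝒜) :
    transportOp 𝒜 B u = volterra 𝒜 (u * B) := rfl

/-- The solution of `U' = t U B`, `U(0) = 1`, as a Neumann series in `t`. -/
def transport (t : ℂ) (B : Path 𝒜) : Path 𝒜 := Ring.inverse (1 - t • transportOp 𝒜 B) 1

theorem transport_eq {t : ℂ} {B : Path 𝒜} (h : ‖t • transportOp 𝒜 B‖ < 1) :
    transport t B = 1 + t • volterra 𝒜 (transport t B * B) := by
  have hu : IsUnit (1 - t • transportOp 𝒜 B) := isUnit_one_sub_of_norm_lt_one h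
  have h1 := congrArg (fun T : Path 𝒜 →L[ℂ] Path 𝒜 => T 1) (Ring.mul_inverse_cancel _ hu)
  simp only [mul_apply_eq_comp, sub_apply, one_apply_eq_self, smul_apply, transportOp_apply] at h1
  rw [sub_eq_iff_eq_add] at h1
  exact h1

/-- The difference quotient `(U(1) - 1) / t` of the solution of `U' = t U B`, `U(0) = 1`. -/
def transportQuot (t : ℂ) (B : Path 𝒜) : 𝒜 := volterra 𝒜 (transport t B * B) 1

theorem transport_one {t : ℂ} {B : Path 𝒜} (h : ‖t • transportOp 𝒜 B‖ < 1) :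
    transport t B 1 = 1 + t • transportQuot t B := by
  conv_lhs => rw [transport_eq h]
  rfl

theorem transport_zero {t : ℂ} {B : Path 𝒜} (h : ‖t • transportOp 𝒜 B‖ < 1) :
    transport t B 0 = 1 := by
  rw [transport_eq h]
  simp [volterra_apply]

theorem hasDerivWithinAt_volterra (u : Path 𝒜) {s : ℝ} (hs : s ∈ Set.Icc (0 : ℝ) 1) :
    HasDerivWithinAt (Set.IccExtend zero_le_one (volterra 𝒜 u)) (u ⟨s, hs⟩)
      (Set.Icc 0 1) s := by
  have hc : Continuous (Set.IccExtend zero_le_one u) := u.continuous.Icc_extend'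
  have h : HasDerivAt (fun y : ℝ => ∫ x in (0 : ℝ)..y, Set.IccExtend zero_le_one u x)
      (Set.IccExtend zero_le_one u s) s :=
    intervalIntegral.integral_hasDerivAt_right (hc.intervalIntegrable _ _)
      (hc.stronglyMeasurableAtFilter _ _) hc.continuousAt
  rw [Set.IccExtend_of_mem _ _ hs] at h
  refine h.hasDerivWithinAt.congr (fun y hy => ?_) ?_
  · rw [Set.IccExtend_of_mem _ _ hy]; rfl
  · rw [Set.IccExtend_of_mem _ _ hs]; rfl

theorem hasDerivWithinAt_transport {t : ℂ} {B : Path 𝒜} (h : ‖t • transportOp 𝒜 B‖ < 1)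
    {s : ℝ} (hs : s ∈ Set.Icc (0 : ℝ) 1) :
    HasDerivWithinAt (Set.IccExtend zero_le_one (transport t B))
      (t • (transport t B ⟨s, hs⟩ * B ⟨s, hs⟩)) (Set.Icc 0 1) s := by
  have h1 := ((hasDerivWithinAt_volterra (transport t B * B) hs).const_smul t).const_add 1
  refine h1.congr (fun y hy => ?_) ?_
  · conv_lhs => rw [transport_eq h]
    rw [Set.IccExtend_of_mem _ _ hy, Pi.smul_apply, Set.IccExtend_of_mem _ _ hy]; rfl
  · conv_lhs => rw [transport_eq h]
    rw [Set.IccExtend_of_mem _ _ hs, Pi.smul_apply, Set.IccExtend_of_mem _ _ hs]; rfl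

/-- The total integral `∫₀¹ B`. -/
def totalIntegral (𝒜 : Type*) [NormedRing 𝒜] [NormedAlgebra ℂ 𝒜] [CompleteSpace 𝒜] :
    Path 𝒜 →L[ℂ] 𝒜 :=
  (Path.evalCLM (1 : I)).comp (volterra 𝒜)

theorem totalIntegral_apply (u : Path 𝒜) : totalIntegral 𝒜 u = volterra 𝒜 u 1 := rfl

/-- At t = 0 the solution is 1 whatever B is, so the derivative has no component along B; along t it
is the first term of the Neumann series. Differentiability comes from that of the inverse at the
unit 1 in the algebra of operators. -/
theorem hasStrictFDerivAt_transport (B₀ : Path 𝒜) :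
    ∃ D : ℂ × Path 𝒜 →L[ℂ] Path 𝒜,
      HasStrictFDerivAt (fun p : ℂ × Path 𝒜 => transport p.1 p.2) D (0, B₀) ∧
      ∀ τ H, D (τ, H) = τ • volterra 𝒜 B₀ := by
  have h1 := ((hasStrictFDerivAt_fst (𝕜 := ℂ) (p := ((0 : ℂ), B₀))).fun_smul
      ((transportOp 𝒜).hasStrictFDerivAt.comp _ hasStrictFDerivAt_snd)).const_sub 1
  have h2 := hasStrictFDerivAt_ringInverse (𝕜 := ℂ) (1 : (Path 𝒜 →L[ℂ] Path 𝒜)ˣ)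
  have e : ((1 : (Path 𝒜 →L[ℂ] Path 𝒜)ˣ) : Path 𝒜 →L[ℂ] Path 𝒜) =
      (fun p : ℂ × Path 𝒜 => 1 - p.1 • transportOp 𝒜 p.2) (0, B₀) := by
    have h0 : (0 : ℂ) • transportOp 𝒜 B₀ = 0 := by ext1 u; exact zero_smul ℂ (transportOp 𝒜 _ u)
    simp [h0]
  rw [e] at h2
  have h3 := (h2.comp ((0 : ℂ), B₀) h1).clm_apply (hasStrictFDerivAt_const (1 : Path 𝒜) _)
  refine ⟨_, h3, fun τ H => ?_⟩
  simp

theorem transport_zero_left (B : Path 𝒜) : transport 0 B = 1 := by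
  have h0 : (0 : ℂ) • transportOp 𝒜 B = 0 := by ext1 u; exact zero_smul ℂ (transportOp 𝒜 _ u)
  simp [transport, h0]

/-- The quotient is the integral of U B, a product of differentiable functions, so nothing is
divided by t and t = 0 needs no separate treatment. -/
theorem hasStrictFDerivAt_transportQuot (B₀ : Path 𝒜) :
    ∃ D : ℂ × Path 𝒜 →L[ℂ] 𝒜,
      HasStrictFDerivAt (fun p : ℂ × Path 𝒜 => transportQuot p.1 p.2) D (0, B₀) ∧
      ∀ τ H, D (τ, H) = totalIntegral 𝒜 H + τ • totalIntegral 𝒜 (volterra 𝒜 B₀ * B₀) := by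
  obtain ⟨D, hD, hD'⟩ := hasStrictFDerivAt_transport B₀
  have h := (totalIntegral 𝒜).hasStrictFDerivAt.comp (0, B₀)
    (hD.fun_mul' hasStrictFDerivAt_snd)
  refine ⟨_, h, fun τ H => ?_⟩
  simp [transport_zero_left, hD']

theorem transportQuot_zero_left (B : Path 𝒜) : transportQuot 0 B = totalIntegral 𝒜 B := by
  simp [transportQuot, transport_zero_left, totalIntegral_apply]

end Volterra

/-! ### The logarithm series and the expansion of log U(1) / t. -/

section Log

/-- The series `∑ (-1)ᵏ Xᵏ / (k + 1)`, that is `log (1 + X) / X`. -/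
def logQuot {𝒜 : Type*} [NormedRing 𝒜] [NormedAlgebra ℂ 𝒜] (X : 𝒜) : 𝒜 := ∑' k : ℕ, ((-1) ^ k / ((k : ℂ) + 1)) • X ^ k

variable {𝒜 : Type*} [NormedRing 𝒜] [NormedAlgebra ℂ 𝒜] [CompleteSpace 𝒜]

/-- The ratio test gives radius of convergence at least 1, so the sum is analytic at 0, and its
derivative there is the coefficient -1/2 of the linear term. -/
theorem hasStrictFDerivAt_logQuot :
    ∃ D : 𝒜 →L[ℂ] 𝒜, HasStrictFDerivAt (logQuot : 𝒜 → 𝒜) D 0 ∧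
      ∀ X, D X = (-(1 / 2) : ℂ) • X := by
  set c : ℕ → ℂ := fun k => (-1) ^ k / ((k : ℂ) + 1) with hc
  have hr : (1 : ENNReal) ≤ (FormalMultilinearSeries.ofScalars 𝒜 c).radius := by
    have := FormalMultilinearSeries.inv_le_ofScalars_radius_of_tendsto (E := 𝒜) c (r := 1)
      one_ne_zero ?_
    · simpa using this
    · have h1 : ∀ n : ℕ, ‖c n.succ‖ / ‖c n‖ = ((n : ℝ) + 1) / (n + 1 + 1) := by
        intro n
        have e1 : ‖(n : ℂ) + 1‖ = (n : ℝ) + 1 := by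
          rw [← Nat.cast_succ, Complex.norm_natCast]; simp
        have e2 : ‖(n : ℂ) + 1 + 1‖ = (n : ℝ) + 1 + 1 := by
          rw [← Nat.cast_succ, ← Nat.cast_succ, Complex.norm_natCast]; simp
        simp only [hc, norm_div, norm_pow, norm_neg, norm_one, one_pow, Nat.succ_eq_add_one,
          Nat.cast_add, Nat.cast_one, e1, e2]
        field_simp
      simp_rw [h1]
      have := tendsto_natCast_div_add_atTop (1 : ℝ)
      have h2 := (Filter.tendsto_add_atTop_iff_nat 1).2 this
      simpa using h2
  have hs : HasFPowerSeriesAt (logQuot : 𝒜 → 𝒜) (FormalMultilinearSeries.ofScalars 𝒜 c) 0 := by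
    have h := (FormalMultilinearSeries.ofScalars 𝒜 c).hasFPowerSeriesOnBall
      (lt_of_lt_of_le one_pos hr)
    have e : (FormalMultilinearSeries.ofScalars 𝒜 c).sum = (logQuot : 𝒜 → 𝒜) :=
      FormalMultilinearSeries.ofScalarsSum_eq_tsum c
    rw [e] at h
    exact h.hasFPowerSeriesAt
  refine ⟨_, hs.hasStrictFDerivAt, fun X => ?_⟩
  simp [FormalMultilinearSeries.ofScalars, hc]
  norm_num

theorem logQuot_zero {𝒜 : Type*} [NormedRing 𝒜] [NormedAlgebra ℂ 𝒜] : logQuot (0 : 𝒜) = 1 := by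
  rw [logQuot, tsum_eq_single 0 (fun k hk => by simp [hk])]
  simp

theorem summable_logQuot {X : 𝒜} (hX : ‖X‖ < 1) :
    Summable fun k : ℕ => ((-1) ^ k / ((k : ℂ) + 1)) • X ^ k := by
  refine Summable.of_norm ?_
  rw [← summable_nat_add_iff 1]
  refine Summable.of_nonneg_of_le (fun k => norm_nonneg _) (fun k => ?_)
    ((summable_geometric_of_lt_one (norm_nonneg X) hX).mul_right ‖X‖)
  rw [norm_smul, ← pow_succ]
  refine (mul_le_of_le_one_left (norm_nonneg _) ?_).trans (norm_pow_le' X k.succ_pos)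
  rw [norm_div, norm_pow, norm_neg, norm_one, one_pow]
  have : ((k + 1 : ℕ) : ℂ) + 1 = ((k + 2 : ℕ) : ℂ) := by push_cast; ring
  rw [this, Complex.norm_natCast]
  refine div_le_one_of_le₀ ?_ (by positivity)
  push_cast; linarith [(Nat.cast_nonneg k : (0:ℝ) ≤ k)]

/-- The quotient `log U(1) / t` for the solution of `U' = t U B`, `U(0) = 1`. -/
def logTransport (t : ℂ) (B : Path 𝒜) : 𝒜 :=
  transportQuot t B * logQuot (t • transportQuot t B)

/-- Subtracting the value at t = 0, which is linear in B, leaves a derivative in the direction of t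
alone. The value at t = 0 is differentiated separately later, from a closed formula in x. -/
theorem hasStrictFDerivAt_logTransport_sub (B₀ : Path 𝒜) :
    ∃ D : ℂ × Path 𝒜 →L[ℂ] 𝒜,
      HasStrictFDerivAt
        (fun p : ℂ × Path 𝒜 => logTransport p.1 p.2 - totalIntegral 𝒜 p.2) D (0, B₀) ∧
      ∀ τ H, D (τ, H) = τ • (totalIntegral 𝒜 (volterra 𝒜 B₀ * B₀) -
        (1 / 2 : ℂ) • (totalIntegral 𝒜 B₀ * totalIntegral 𝒜 B₀)) := by
  obtain ⟨D, hD, hD'⟩ := hasStrictFDerivAt_transportQuot B₀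
  obtain ⟨G, hG, hG'⟩ := hasStrictFDerivAt_logQuot (𝒜 := 𝒜)
  have h1 := (hasStrictFDerivAt_fst (𝕜 := ℂ) (p := ((0 : ℂ), B₀))).fun_smul hD
  have e : (0 : 𝒜) = (fun p : ℂ × Path 𝒜 => p.1 • transportQuot p.1 p.2) (0, B₀) := by simp
  rw [e] at hG
  have h2 := (hD.fun_mul' (hG.comp ((0 : ℂ), B₀) h1)).fun_sub
    ((totalIntegral 𝒜).hasStrictFDerivAt.comp ((0 : ℂ), B₀) hasStrictFDerivAt_snd)
  refine ⟨_, h2, fun τ H => ?_⟩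
  simp [hD', hG', transportQuot_zero_left, logQuot_zero, smul_sub, smul_smul, mul_comm]
  module

theorem continuousAt_transportQuot (B : Path 𝒜) :
    ContinuousAt (fun t : ℂ => transportQuot t B) 0 := by
  obtain ⟨D, hD, -⟩ := hasStrictFDerivAt_transportQuot B
  exact hD.continuousAt.comp (f := fun t : ℂ => (t, B)) (by fun_prop)

end Log

end LawsonDPW

namespace LawsonDPW

/-! ### The logarithm of an inverse. -/

section LogInverse

variable {𝒜 : Type*} [NormedRing 𝒜] [NormedAlgebra ℂ 𝒜] [CompleteSpace 𝒜]

theorem mul_logQuot_eq_tsum {X : 𝒜} (hX : ‖X‖ < 1) :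
    X * logQuot X = ∑' k : ℕ, ((-1) ^ k / ((k : ℂ) + 1)) • X ^ (k + 1) := by
  rw [logQuot, ← (summable_logQuot hX).tsum_mul_left]
  refine tsum_congr fun k => ?_
  rw [mul_smul_comm, pow_succ']

/-- This integral form of log (1 + X) turns inversion of 1 + X into the substitution s ↦ 1 - s. It
follows by integrating the geometric series of (1 + sX)⁻¹ termwise on [0, 1]. -/
theorem mul_logQuot_eq_integral {X : 𝒜} (hX : ‖X‖ < 1) :
    X * logQuot X = ∫ s in (0 : ℝ)..1, X * Ring.inverse (1 + (s : ℂ) • X) := by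
  let f : ℕ → C(ℝ, 𝒜) := fun k => ⟨fun s => ((-(s : ℂ)) ^ k) • X ^ (k + 1), by fun_prop⟩
  have hf : Summable fun k => ‖(f k).restrict (⟨Set.uIcc (0 : ℝ) 1, isCompact_uIcc⟩ :
      TopologicalSpace.Compacts ℝ)‖ := by
    refine Summable.of_nonneg_of_le (fun k => norm_nonneg _) (fun k => ?_)
      ((summable_geometric_of_lt_one (norm_nonneg X) hX).mul_right ‖X‖)
    refine (ContinuousMap.norm_le _ (by positivity)).2 ?_
    rintro ⟨s, hs⟩
    replace hs : s ∈ Set.uIcc (0 : ℝ) 1 := hs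
    rw [Set.uIcc_of_le zero_le_one] at hs
    change ‖((-(s : ℂ)) ^ k) • X ^ (k + 1)‖ ≤ _
    rw [norm_smul, ← pow_succ, norm_pow, norm_neg, Complex.norm_real, Real.norm_eq_abs,
      abs_of_nonneg hs.1]
    exact (mul_le_of_le_one_left (norm_nonneg _) (pow_le_one₀ hs.1 hs.2)).trans
      (norm_pow_le' X k.succ_pos)
  have h := intervalIntegral.tsum_intervalIntegral_eq_of_summable_norm hf
  have e1 : ∀ k, ∫ s in (0 : ℝ)..1, f k s = ((-1) ^ k / ((k : ℂ) + 1)) • X ^ (k + 1) := by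
    intro k
    change ∫ s in (0 : ℝ)..1, ((-(s : ℂ)) ^ k) • X ^ (k + 1) = _
    rw [intervalIntegral.integral_smul_const]
    congr 1
    have : ∀ s : ℝ, (-(s : ℂ)) ^ k = (-1) ^ k * ((s ^ k : ℝ) : ℂ) := by
      intro s; rw [neg_pow]; push_cast; ring
    simp_rw [this]
    rw [intervalIntegral.integral_const_mul, intervalIntegral.integral_ofReal, integral_pow]
    push_cast
    simp [div_eq_mul_inv]
  rw [mul_logQuot_eq_tsum hX]
  simp_rw [e1] at h
  rw [h]
  refine intervalIntegral.integral_congr fun s hs => ?_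
  rw [Set.uIcc_of_le zero_le_one] at hs
  have hn : ‖-((s : ℂ) • X)‖ < 1 := by
    rw [norm_neg, norm_smul, Complex.norm_real, Real.norm_eq_abs, abs_of_nonneg hs.1]
    exact (mul_le_of_le_one_left (norm_nonneg _) hs.2).trans_lt hX
  have e2 : Ring.inverse (1 + (s : ℂ) • X) = ∑' k : ℕ, (-((s : ℂ) • X)) ^ k := by
    rw [show 1 + (s : ℂ) • X = 1 - -((s : ℂ) • X) by rw [sub_neg_eq_add],
      NormedRing.inverse_one_sub _ hn]
    rfl
  simp only [e2]
  rw [← (summable_geometric_of_norm_lt_one hn).tsum_mul_left]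
  refine tsum_congr fun k => ?_
  change ((-(s : ℂ)) ^ k) • X ^ (k + 1) = _
  rw [← neg_smul, _root_.smul_pow, mul_smul_comm, pow_succ']

theorem isUnit_one_add_smul {X : 𝒜} (hX : ‖X‖ < 1) {s : ℝ} (hs : s ∈ Set.Icc (0 : ℝ) 1) :
    IsUnit (1 + (s : ℂ) • X) := by
  have hn : ‖-((s : ℂ) • X)‖ < 1 := by
    rw [norm_neg, norm_smul, Complex.norm_real, Real.norm_eq_abs, abs_of_nonneg hs.1]
    exact (mul_le_of_le_one_left (norm_nonneg _) hs.2).trans_lt hX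
  simpa using isUnit_one_sub_of_norm_lt_one hn

/-- `log (1 + X)⁻¹ = -log (1 + X)`. -/
theorem mul_logQuot_inverse {X Z : 𝒜} (hX : ‖X‖ < 1) (hZ : ‖Z‖ < 1) (h : (1 + X) * (1 + Z) = 1) :
    Z * logQuot Z = -(X * logQuot X) := by
  rw [mul_logQuot_eq_integral hX, mul_logQuot_eq_integral hZ]
  -- From (1 + X)(1 + Z) = 1 follow X(1 + Z) = -Z and 1 + sZ = (1 + (1 - s)X)(1 + Z); the two
  -- integrands then differ by sign and by s ↦ 1 - s.
  have key : ∀ s ∈ Set.uIcc (0 : ℝ) 1, Z * Ring.inverse (1 + (s : ℂ) • Z) =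
      -(X * Ring.inverse (1 + ((1 - s : ℝ) : ℂ) • X)) := by
    intro s hs
    rw [Set.uIcc_of_le zero_le_one] at hs
    have hs' : 1 - s ∈ Set.Icc (0 : ℝ) 1 := ⟨by linarith [hs.2], by linarith [hs.1]⟩
    have hu := isUnit_one_add_smul hX hs'
    have hX1 : X * (1 + Z) = -Z := by
      have : X * (1 + Z) = (1 + X) * (1 + Z) - (1 + Z) := by noncomm_ring
      rw [this, h]; abel
    have hfac : 1 + (s : ℂ) • Z = (1 + ((1 - s : ℝ) : ℂ) • X) * (1 + Z) := by
      have : (1 + ((1 - s : ℝ) : ℂ) • X) * (1 + Z) =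
          (1 + X) * (1 + Z) - (s : ℂ) • (X * (1 + Z)) := by
        push_cast
        rw [sub_smul, one_smul]
        simp only [add_mul, sub_mul, smul_mul_assoc, one_mul]
        abel
      rw [this, h, hX1, smul_neg, sub_neg_eq_add]
    symm
    rw [Ring.eq_mul_inverse_iff_mul_eq _ _ _ (isUnit_one_add_smul hZ hs), hfac, neg_mul, mul_assoc,
      ← mul_assoc (Ring.inverse _), Ring.inverse_mul_cancel _ hu, one_mul, hX1, neg_neg]
  rw [intervalIntegral.integral_congr key, intervalIntegral.integral_neg,
    intervalIntegral.integral_comp_sub_left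
      (fun s : ℝ => X * Ring.inverse (1 + ((s : ℝ) : ℂ) • X)) 1]
  simp

end LogInverse

/-! ### Uniqueness for linear matrix equations. -/

section ODE

/-- Uniqueness for the linear matrix equation `Y' = Y G` on `[0, 1]`. -/
theorem linear_ode_unique {G Y Z : ℝ → Mat}
    (hG : ∀ i j, ContinuousOn (fun s => G s i j) (Set.Icc 0 1))
    (hY : ∀ s ∈ Set.Icc (0 : ℝ) 1, ∀ i j,
      HasDerivWithinAt (fun u => Y u i j) ((Y s * G s) i j) (Set.Icc 0 1) s)
    (hZ : ∀ s ∈ Set.Icc (0 : ℝ) 1, ∀ i j,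
      HasDerivWithinAt (fun u => Z u i j) ((Z s * G s) i j) (Set.Icc 0 1) s)
    (h0 : Y 0 = Z 0) {s : ℝ} (hs : s ∈ Set.Icc (0 : ℝ) 1) : Y s = Z s := by
  have hbd : ∀ i j, ∃ C : ℝ, ∀ s ∈ Set.Icc (0 : ℝ) 1, ‖G s i j‖ ≤ C := fun i j =>
    isCompact_Icc.exists_bound_of_continuousOn (hG i j)
  choose C hC using hbd
  set K : ℝ := ∑ i, ∑ j, |C i j| with hK
  have hK0 : 0 ≤ K := by positivity
  -- Matrices are read as functions of two indices, with the supremum norm, in which right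
  -- multiplication by G(s) is Lipschitz with the constant K for every s.
  let v : ℝ → (Fin 2 → Fin 2 → ℂ) → (Fin 2 → Fin 2 → ℂ) := fun s y =>
    (Matrix.of y * G s : Mat)
  have hv : ∀ s ∈ Set.Ico (0 : ℝ) 1, LipschitzOnWith K.toNNReal (v s) Set.univ := by
    intro s hs
    refine LipschitzOnWith.of_dist_le_mul fun y _ z _ => ?_
    rw [dist_eq_norm, dist_eq_norm, Real.coe_toNNReal _ hK0]
    refine (pi_norm_le_iff_of_nonneg (by positivity)).2 fun i => ?_
    refine (pi_norm_le_iff_of_nonneg (by positivity)).2 fun j => ?_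
    have e : (v s y - v s z) i j = ∑ k, (y i k - z i k) * G s k j := by
      change (Matrix.of y * G s) i j - (Matrix.of z * G s) i j = _
      simp [Matrix.mul_apply, sub_mul]
    rw [e]
    refine (norm_sum_le _ _).trans ?_
    have hb : ∀ k, ‖(y i k - z i k) * G s k j‖ ≤ |C k j| * ‖y - z‖ := by
      intro k
      rw [norm_mul, mul_comm]
      gcongr
      · exact (hC k j s ⟨hs.1, hs.2.le⟩).trans (le_abs_self _)
      · exact (norm_le_pi_norm ((y - z) i) k).trans (norm_le_pi_norm (y - z) i)
    refine (Finset.sum_le_sum fun k _ => hb k).trans ?_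
    rw [← Finset.sum_mul]
    gcongr
    rw [hK]
    refine Finset.sum_le_sum fun k _ => ?_
    exact Finset.single_le_sum (f := fun j => |C k j|) (fun _ _ => abs_nonneg _)
      (Finset.mem_univ j)
  have hcont : ∀ {X : ℝ → Mat}, (∀ s ∈ Set.Icc (0 : ℝ) 1, ∀ i j,
      HasDerivWithinAt (fun u => X u i j) ((X s * G s) i j) (Set.Icc 0 1) s) →
      ContinuousOn (fun s i j => X s i j) (Set.Icc 0 1) ∧
      ∀ s ∈ Set.Ico (0 : ℝ) 1, HasDerivWithinAt (fun s i j => X s i j)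
        (v s (X s)) (Set.Ici s) s := by
    intro X hX
    have hd : ∀ s ∈ Set.Icc (0 : ℝ) 1, HasDerivWithinAt (fun s i j => X s i j)
        (v s (X s)) (Set.Icc 0 1) s := fun s hs =>
      hasDerivWithinAt_pi.2 fun i => hasDerivWithinAt_pi.2 fun j => hX s hs i j
    refine ⟨fun s hs => (hd s hs).continuousWithinAt, fun s hs => ?_⟩
    refine (hd s ⟨hs.1, hs.2.le⟩).mono_of_mem_nhdsWithin ?_
    exact Icc_mem_nhdsGE_of_mem hs
  have := ODE_solution_unique_of_mem_Icc_right hv (hcont hY).1 (hcont hY).2 (fun _ _ => trivial)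
    (hcont hZ).1 (hcont hZ).2 (fun _ _ => trivial) h0
  exact this hs

end ODE

/-! ### Uniqueness of Laurent coefficients. -/

section Fourier

/-- An absolutely convergent Laurent series that vanishes on the unit circle is zero. -/
theorem laurent_unique {f : ℤ → ℂ} (hf : Summable fun k => ‖f k‖)
    (h : ∀ l : ℂ, ‖l‖ = 1 → ∑' k, f k * l ^ k = 0) : f = 0 := by
  have : Fact (0 < (1 : ℝ)) := ⟨one_pos⟩
  have hs : Summable fun k : ℤ => f k • (fourier k : C(AddCircle (1 : ℝ), ℂ)) := by
    refine Summable.of_norm (hf.congr fun k => ?_)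
    rw [norm_smul, fourier_norm, mul_one]
  have hz : ∑' k : ℤ, f k • (fourier k : C(AddCircle (1 : ℝ), ℂ)) = 0 := by
    ext x
    have h1 := (ContinuousMap.evalCLM ℂ x).map_tsum hs
    change (ContinuousMap.evalCLM ℂ x) _ = 0
    rw [h1, ← h (AddCircle.toCircle x) (Circle.norm_coe _)]
    refine tsum_congr fun k => ?_
    simp [ContinuousMap.evalCLM_apply, fourier_apply, AddCircle.toCircle_zsmul]
  -- The series converges uniformly, hence in L², where the inner product with the n-th exponential
  -- isolates f n.
  have hsum : HasSum (fun k : ℤ => f k • (fourier k : C(AddCircle (1 : ℝ), ℂ))) 0 :=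
    hz ▸ hs.hasSum
  have h2 := hsum.mapL (ContinuousMap.toLp (E := ℂ) 2 (AddCircle.haarAddCircle (T := 1)) ℂ)
  funext n
  have h3 := h2.mapL (innerSL ℂ (fourierLp (T := 1) 2 n))
  have e : ∀ k, innerSL ℂ (fourierLp (T := 1) 2 n)
      (ContinuousMap.toLp (E := ℂ) 2 (AddCircle.haarAddCircle (T := 1)) ℂ
        (f k • fourier k)) = if k = n then f k else 0 := by
    intro k
    rw [map_smul, map_smul]
    have := (orthonormal_iff_ite.1 (orthonormal_fourier (T := 1))) n k
    change f k • inner ℂ (fourierLp 2 n) (fourierLp 2 k) = _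
    rw [this]
    by_cases hk : k = n
    · simp [hk]
    · simp [hk, Ne.symm hk]
  simp_rw [e] at h3
  have h4 := h3.tsum_eq
  simpa using h4

end Fourier

end LawsonDPW

namespace LawsonDPW

open unitInterval

/-! ### The loop and the punctures -/

/-- The centre, equal to the radius, of the circle `γ₀`. -/
def loopRadius (m : ℕ) : ℝ := 1 / (2 * Real.cos (Real.pi / (2 * m + 2)))

theorem puncture_eq_pow (m j : ℕ) :
    puncture m j = Complex.exp (2 * Real.pi * Complex.I / ((2 * m + 2 : ℕ) : ℂ)) ^ j := by
  rw [puncture, ← Complex.exp_nat_mul]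
  congr 1
  push_cast
  ring

theorem puncture_zero (m : ℕ) : puncture m 0 = 1 := by simp [puncture]

theorem puncture_ne_zero (m j : ℕ) : puncture m j ≠ 0 := Complex.exp_ne_zero _

theorem puncture_pow_card (m j : ℕ) : puncture m j ^ (2 * m + 2) = 1 := by
  rw [puncture_eq_pow, ← pow_mul, mul_comm j, pow_mul,
    (Complex.isPrimitiveRoot_exp (2 * m + 2) (by omega)).pow_eq_one, one_pow]

theorem puncture_succ (m j : ℕ) : puncture m (j + 1) = puncture m j * puncture m 1 := by
  rw [puncture_eq_pow, puncture_eq_pow, puncture_eq_pow, pow_succ, pow_one]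

theorem puncture_eq_exp_ofReal (m j : ℕ) :
    puncture m j = Complex.exp (((2 * Real.pi * j / (2 * m + 2) : ℝ) : ℂ) * Complex.I) := by
  rw [puncture]
  congr 1
  push_cast
  ring

/-- With c the radius R of the loop, exp (iθ) lies inside the circle exactly when 2R cos θ > 1, that
is cos θ > cos (π/n). This decides which punctures are enclosed. -/
theorem normSq_sub_real_exp (c θ : ℝ) :
    ‖Complex.exp ((θ : ℂ) * Complex.I) - c‖ ^ 2 = 1 - 2 * c * Real.cos θ + c ^ 2 := by
  rw [← Complex.normSq_eq_norm_sq, Complex.normSq_apply]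
  have h1 : (Complex.exp ((θ : ℂ) * Complex.I) - c).re = Real.cos θ - c := by
    simp [Complex.exp_ofReal_mul_I_re]
  have h2 : (Complex.exp ((θ : ℂ) * Complex.I) - c).im = Real.sin θ := by
    simp [Complex.exp_ofReal_mul_I_im]
  rw [h1, h2]
  nlinarith [Real.sin_sq_add_cos_sq θ]

theorem norm_puncture (m j : ℕ) : ‖puncture m j‖ = 1 := by
  rw [puncture_eq_exp_ofReal, Complex.norm_exp_ofReal_mul_I]

theorem cos_pos {m : ℕ} (hm : 1 ≤ m) : 0 < Real.cos (Real.pi / (2 * m + 2)) := by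
  have hm' : (1 : ℝ) ≤ m := by exact_mod_cast hm
  refine Real.cos_pos_of_mem_Ioo ⟨?_, ?_⟩
  · have : 0 < Real.pi / (2 * m + 2) := by positivity
    linarith [Real.pi_pos]
  · rw [div_lt_div_iff₀ (by positivity) (by norm_num)]
    nlinarith [Real.pi_pos]

theorem cos_lt_one {m : ℕ} (hm : 1 ≤ m) : Real.cos (Real.pi / (2 * m + 2)) < 1 := by
  have hm' : (1 : ℝ) ≤ m := by exact_mod_cast hm
  rw [← Real.cos_zero]
  refine Real.cos_lt_cos_of_nonneg_of_le_pi le_rfl ?_ (by positivity)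
  exact div_le_self Real.pi_pos.le (by linarith)

theorem loopRadius_pos {m : ℕ} (hm : 1 ≤ m) : 0 < loopRadius m := by
  have := cos_pos hm
  rw [loopRadius]; positivity

theorem two_mul_loopRadius_mul_cos {m : ℕ} (hm : 1 ≤ m) :
    2 * loopRadius m * Real.cos (Real.pi / (2 * m + 2)) = 1 := by
  have := (cos_pos hm).ne'
  rw [loopRadius, mul_one_div, ← mul_div_right_comm, div_eq_one_iff_eq (by simpa using this)]

theorem cos_puncture_lt {m : ℕ} (hm : 1 ≤ m) {j : ℕ} (hj : 1 ≤ j) (hj' : j < 2 * m + 2) :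
    Real.cos (2 * Real.pi * j / (2 * m + 2)) < Real.cos (Real.pi / (2 * m + 2)) := by
  have key : ∀ i : ℕ, 1 ≤ i → i ≤ m + 1 →
      Real.cos (2 * Real.pi * i / (2 * m + 2)) < Real.cos (Real.pi / (2 * m + 2)) := by
    intro i hi hi'
    have h1 : (1 : ℝ) ≤ i := by exact_mod_cast hi
    have h2 : (i : ℝ) ≤ m + 1 := by exact_mod_cast hi'
    refine Real.cos_lt_cos_of_nonneg_of_le_pi (by positivity) ?_ ?_
    · rw [div_le_iff₀ (by positivity)]; nlinarith [Real.pi_pos]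
    · rw [div_lt_div_iff_of_pos_right (by positivity)]; nlinarith [Real.pi_pos]
  by_cases h : j ≤ m + 1
  · exact key j hj h
  -- Beyond half a turn, the reflection j ↦ n - j leaves the cosine unchanged.
  · have := key (2 * m + 2 - j) (by omega) (by omega)
    rw [Nat.cast_sub hj'.le] at this
    have e : 2 * Real.pi * (((2 * m + 2 : ℕ) : ℝ) - j) / (2 * m + 2) =
        2 * Real.pi - 2 * Real.pi * j / (2 * m + 2) := by
      push_cast
      field_simp
    rwa [e, Real.cos_two_pi_sub] at this

theorem loopRadius_lt_norm_puncture_sub {m : ℕ} (hm : 1 ≤ m) {j : ℕ} (hj : 1 ≤ j) (hj' : j < 2 * m + 2) :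
    loopRadius m < ‖puncture m j - loopRadius m‖ := by
  have h0 := loopRadius_pos hm
  refine lt_of_pow_lt_pow_left₀ 2 (norm_nonneg _) ?_
  rw [puncture_eq_exp_ofReal, normSq_sub_real_exp]
  have h1 := cos_puncture_lt hm hj hj'
  have h2 := two_mul_loopRadius_mul_cos hm
  nlinarith

theorem one_mem_ball {m : ℕ} (hm : 1 ≤ m) : (1 : ℂ) ∈ Metric.ball (loopRadius m : ℂ) (loopRadius m) := by
  have h0 := loopRadius_pos hm
  rw [Metric.mem_ball, dist_eq_norm]
  refine lt_of_pow_lt_pow_left₀ 2 h0.le ?_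
  have := normSq_sub_real_exp (loopRadius m) 0
  simp only [Complex.ofReal_zero, zero_mul, Complex.exp_zero, Real.cos_zero] at this
  rw [this]
  have h1 := cos_lt_one hm
  have h2 := two_mul_loopRadius_mul_cos hm
  nlinarith

theorem ne_puncture_of_mem_closedBall {m : ℕ} (hm : 1 ≤ m) {j : ℕ} (hj : 1 ≤ j) (hj' : j < 2 * m + 2) {z : ℂ}
    (hz : z ∈ Metric.closedBall (loopRadius m : ℂ) (loopRadius m)) : z ≠ puncture m j := by
  rintro rfl
  rw [Metric.mem_closedBall, dist_eq_norm] at hz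
  exact absurd (loopRadius_lt_norm_puncture_sub hm hj hj') (not_lt.2 hz)

theorem loop_eq (m : ℕ) (s : ℝ) :
    loop m s = loopRadius m * (1 - Complex.exp (2 * Real.pi * Complex.I * s)) := rfl

theorem loop_zero (m : ℕ) : loop m 0 = 0 := by simp [loop]

theorem loop_one (m : ℕ) : loop m 1 = 0 := by
  simp [loop, Complex.exp_two_pi_mul_I]

theorem hasDerivAt_loop (m : ℕ) (s : ℝ) :
    HasDerivAt (loop m)
      (-(loopRadius m * (2 * Real.pi * Complex.I * Complex.exp (2 * Real.pi * Complex.I * s)))) s := by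
  have h1 : HasDerivAt (fun s : ℝ => 2 * Real.pi * Complex.I * (s : ℂ))
      (2 * Real.pi * Complex.I) s := by
    simpa using (Complex.ofRealCLM.hasDerivAt (x := s)).const_mul (2 * Real.pi * Complex.I : ℂ)
  have h := ((h1.cexp.const_sub 1).const_mul (loopRadius m : ℂ))
  convert! h using 1
  ring

theorem deriv_loop (m : ℕ) (s : ℝ) : deriv (loop m) s =
    -(loopRadius m * (2 * Real.pi * Complex.I * Complex.exp (2 * Real.pi * Complex.I * s))) :=
  (hasDerivAt_loop m s).deriv

theorem continuous_loop (m : ℕ) : Continuous (loop m) :=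
  continuous_iff_continuousAt.2 fun s => (hasDerivAt_loop m s).continuousAt

theorem continuous_deriv_loop (m : ℕ) : Continuous (deriv (loop m)) := by
  have : deriv (loop m) = fun s : ℝ =>
    -(loopRadius m * (2 * Real.pi * Complex.I * Complex.exp (2 * Real.pi * Complex.I * s))) :=
    funext (deriv_loop m)
  rw [this]
  fun_prop

theorem loop_eq_circleMap (m : ℕ) (s : ℝ) :
    loop m s = circleMap (loopRadius m) (loopRadius m) (2 * Real.pi * s + Real.pi) := by
  rw [loop_eq, circleMap]
  push_cast
  rw [add_mul, Complex.exp_add, Complex.exp_pi_mul_I]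
  ring_nf

theorem norm_loop_sub {m : ℕ} (hm : 1 ≤ m) (s : ℝ) : ‖loop m s - loopRadius m‖ = loopRadius m := by
  rw [loop_eq_circleMap, circleMap_sub_center, norm_circleMap_zero,
    abs_of_pos (loopRadius_pos hm)]

theorem loop_mem_closedBall {m : ℕ} (hm : 1 ≤ m) (s : ℝ) :
    loop m s ∈ Metric.closedBall (loopRadius m : ℂ) (loopRadius m) := by
  rw [Metric.mem_closedBall, dist_eq_norm, norm_loop_sub hm]

theorem loop_ne_puncture (m j : ℕ) (s : ℝ) : loop m s ≠ puncture m j := by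
  -- For m = 0 the radius is 1 / (2 cos (π/2)) = 1/0 = 0 and the loop is constant at 0. Covering
  -- this case lets `loopForm` be defined for every m.
  rcases Nat.eq_zero_or_pos m with rfl | hm
  · have : loop 0 s = 0 := by simp [loop]
    rw [this]
    exact (puncture_ne_zero 0 j).symm
  intro h
  have hmod : puncture m j = puncture m (j % (2 * m + 2)) := by
    conv_lhs => rw [puncture_eq_pow, ← Nat.mod_add_div j (2 * m + 2), pow_add, pow_mul,
      (Complex.isPrimitiveRoot_exp (2 * m + 2) (by omega)).pow_eq_one, one_pow, mul_one,
      ← puncture_eq_pow]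
  rw [hmod] at h
  have hlt : j % (2 * m + 2) < 2 * m + 2 := Nat.mod_lt _ (by omega)
  generalize j % (2 * m + 2) = i at h hlt
  rcases Nat.eq_zero_or_pos i with rfl | hi
  · have h1 := one_mem_ball hm
    rw [puncture_zero] at h
    rw [← h, Metric.mem_ball, dist_eq_norm, norm_loop_sub hm] at h1
    exact lt_irrefl _ h1
  · exact ne_puncture_of_mem_closedBall hm hi hlt (loop_mem_closedBall hm s) h

/-- The loop is the standard parametrisation of the circle started at the angle π, and by
periodicity the starting angle is irrelevant. -/
theorem integral_loop {m : ℕ} (f : ℂ → ℂ) :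
    ∫ s in (0 : ℝ)..1, deriv (loop m) s * f (loop m s) =
      ∮ z in C(loopRadius m, loopRadius m), f z := by
  set c : ℂ := (loopRadius m : ℂ)
  set R : ℝ := loopRadius m
  let g : ℝ → ℂ := fun θ => deriv (circleMap c R) θ • f (circleMap c R θ)
  have hg : Function.Periodic g (2 * Real.pi) := by
    intro θ
    simp only [g, deriv_circleMap, periodic_circleMap c R θ, periodic_circleMap 0 R θ]
  have e : ∀ s : ℝ, deriv (loop m) s * f (loop m s) =
      (2 * Real.pi : ℝ) • g (2 * Real.pi * s + Real.pi) := by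
    intro s
    simp only [g]
    rw [← loop_eq_circleMap, deriv_loop, deriv_circleMap, circleMap, Complex.real_smul]
    push_cast
    rw [add_mul (2 * (Real.pi : ℂ) * s), Complex.exp_add, Complex.exp_pi_mul_I]
    simp only [smul_eq_mul, R]
    ring_nf
  simp_rw [e]
  rw [intervalIntegral.integral_smul]
  have h1 := intervalIntegral.smul_integral_comp_mul_add (a := 0) (b := 1) g (2 * Real.pi) Real.pi
  rw [h1, circleIntegral]
  have h2 := hg.intervalIntegral_add_eq Real.pi 0
  rw [mul_zero, mul_one, zero_add, add_comm (2 * Real.pi), h2, zero_add]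

/-! ### Partial fractions -/

theorem sum_puncture_pow (m e : ℕ) :
    ∑ j ∈ Finset.range (2 * m + 2), puncture m j ^ e =
      if (2 * m + 2) ∣ e then ((2 * m + 2 : ℕ) : ℂ) else 0 := by
  have hζ := Complex.isPrimitiveRoot_exp (2 * m + 2) (by omega)
  simp_rw [puncture_eq_pow, ← pow_mul, mul_comm _ e, pow_mul]
  split_ifs with h
  · rw [(hζ.pow_eq_one_iff_dvd e).2 h]
    simp
  · have h1 : Complex.exp (2 * Real.pi * Complex.I / ((2 * m + 2 : ℕ) : ℂ)) ^ e ≠ 1 := fun h' =>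
      h ((hζ.pow_eq_one_iff_dvd e).1 h')
    rw [geom_sum_eq h1, ← pow_mul, mul_comm e, pow_mul, hζ.pow_eq_one, one_pow, sub_self, zero_div]

/-- After multiplication by zⁿ - 1 = zⁿ - p_jⁿ each summand is a geometric sum in z and p_j, and
orthogonality of the roots of unity keeps a single power of z. -/
theorem sum_puncture_pow_mul_inv {m k : ℕ} (hk : k < 2 * m + 2) {z : ℂ}
    (hz : z ^ (2 * m + 2) ≠ 1) :
    ∑ j ∈ Finset.range (2 * m + 2), puncture m j ^ (k + 1) * (z - puncture m j)⁻¹ =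
      ((2 * m + 2 : ℕ) : ℂ) * z ^ k / (z ^ (2 * m + 2) - 1) := by
  have hz' : z ^ (2 * m + 2) - 1 ≠ 0 := sub_ne_zero.2 hz
  rw [eq_div_iff hz', Finset.sum_mul]
  have h1 : ∀ j, puncture m j ^ (k + 1) * (z - puncture m j)⁻¹ * (z ^ (2 * m + 2) - 1) =
      ∑ i ∈ Finset.range (2 * m + 2), z ^ i * puncture m j ^ (k + 1 + (2 * m + 2 - 1 - i)) := by
    intro j
    have hne : z - puncture m j ≠ 0 := by
      intro h
      rw [sub_eq_zero] at h
      exact hz (h ▸ puncture_pow_card m j)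
    have h2 := geom_sum₂_mul z (puncture m j) (2 * m + 2)
    rw [puncture_pow_card] at h2
    rw [← h2]
    field_simp
    rw [Finset.mul_sum]
    refine Finset.sum_congr rfl fun i _ => ?_
    rw [pow_add]; ring
  rw [Finset.sum_congr rfl fun j _ => h1 j, Finset.sum_comm]
  simp_rw [← Finset.mul_sum, sum_puncture_pow]
  -- The exponent of p_j is n + k - i, strictly between 0 and 2n, so n divides it only for i = k.
  rw [Finset.sum_eq_single k]
  · rw [if_pos ⟨1, by omega⟩, mul_comm]
  · intro i hi hik
    rw [Finset.mem_range] at hi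
    rw [if_neg, mul_zero]
    rintro ⟨d, hd⟩
    have hd1 : d < 2 := by
      by_contra h
      have : (2 * m + 2) * 2 ≤ (2 * m + 2) * d := Nat.mul_le_mul_left _ (by omega)
      omega
    interval_cases d <;> omega
  · intro h
    exact absurd (Finset.mem_range.2 hk) h

theorem pow_card_ne_one {m : ℕ} {z : ℂ} (h : ∀ j, z ≠ puncture m j) : z ^ (2 * m + 2) ≠ 1 := by
  intro h1
  obtain ⟨i, -, hi⟩ := (Complex.isPrimitiveRoot_exp (2 * m + 2) (by omega)).eq_pow_of_pow_eq_one h1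
  exact h i (by rw [puncture_eq_pow, hi])

end LawsonDPW

namespace LawsonDPW

/-! ### Residues and iterated integrals along the loop. -/

open unitInterval

/-- The form `zᵏ dz / (z - p_j)` pulled back to `[0, 1]` by the loop. -/
def loopForm (m j k : ℕ) : Path ℂ :=
  (⟨fun s => deriv (loop m) s * (loop m s ^ k * (loop m s - puncture m j)⁻¹), by
    have h1 := continuous_loop m
    have h2 := continuous_deriv_loop m
    have h3 : Continuous fun s : ℝ => deriv (loop m) s *
        (loop m s ^ k * (loop m s - puncture m j)⁻¹) :=
      h2.mul ((h1.pow k).mul ((h1.sub continuous_const).inv₀ fun s =>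
        sub_ne_zero.2 (loop_ne_puncture m j s)))
    exact h3.comp continuous_subtype_val⟩ : C(I, ℂ))

theorem loopForm_apply (m j k : ℕ) (s : I) :
    loopForm m j k s = deriv (loop m) s * (loop m s ^ k * (loop m s - puncture m j)⁻¹) := rfl

theorem totalIntegral_eq_integral (u : Path ℂ) (f : ℝ → ℂ) (h : ∀ s : I, u s = f s) :
    totalIntegral ℂ u = ∫ s in (0 : ℝ)..1, f s := by
  change ∫ x in (0 : ℝ)..(1 : ℝ), Set.IccExtend zero_le_one u x = _
  refine intervalIntegral.integral_congr fun s hs => ?_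
  rw [Set.uIcc_of_le zero_le_one] at hs
  simp only [Set.IccExtend_of_mem zero_le_one u hs]
  exact h _

theorem volterra_eq_integral (u : Path ℂ) (f : ℝ → ℂ) (h : ∀ s : I, u s = f s) (s : I) :
    volterra ℂ u s = ∫ x in (0 : ℝ)..s, f x := by
  rw [volterra_apply]
  refine intervalIntegral.integral_congr fun x hx => ?_
  rw [Set.uIcc_of_le s.2.1] at hx
  have hx' : x ∈ Set.Icc (0 : ℝ) 1 := ⟨hx.1, hx.2.trans s.2.2⟩
  simp only [Set.IccExtend_of_mem zero_le_one u hx']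
  exact h _

/-- Cauchy's formula: among the punctures only p₀ = 1 is enclosed, and zᵏ takes the value 1 there
for every k. -/
theorem totalIntegral_loopForm {m : ℕ} (hm : 1 ≤ m) {j : ℕ} (hj : j < 2 * m + 2) (k : ℕ) :
    totalIntegral ℂ (loopForm m j k) = if j = 0 then 2 * Real.pi * Complex.I else 0 := by
  rw [totalIntegral_eq_integral _ (fun s => deriv (loop m) s *
    (fun z : ℂ => z ^ k * (z - puncture m j)⁻¹) (loop m s)) (fun s => rfl),
    integral_loop (fun z : ℂ => z ^ k * (z - puncture m j)⁻¹)]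
  split_ifs with h
  · subst h
    rw [puncture_zero]
    have hd : DifferentiableOn ℂ (fun z : ℂ => z ^ k)
        (Metric.closedBall (loopRadius m : ℂ) (loopRadius m)) := by fun_prop
    have := hd.circleIntegral_sub_inv_smul (one_mem_ball hm)
    simp only [smul_eq_mul, one_pow, mul_one] at this
    rw [← this]
    simp_rw [mul_comm]
  · have hne : ∀ z ∈ Metric.closedBall (loopRadius m : ℂ) (loopRadius m), z - puncture m j ≠ 0 :=
      fun z hz => sub_ne_zero.2
        (ne_puncture_of_mem_closedBall hm (Nat.one_le_iff_ne_zero.2 h) hj hz)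
    have hd : ∀ z ∈ Metric.closedBall (loopRadius m : ℂ) (loopRadius m),
        DifferentiableAt ℂ (fun z : ℂ => z ^ k * (z - puncture m j)⁻¹) z := by
      intro z hz
      have := hne z hz
      fun_prop (disch := assumption)
    exact Complex.circleIntegral_eq_zero_of_differentiable_on_off_countable
      (loopRadius_pos hm).le Set.countable_empty
      (fun z hz => (hd z hz).continuousAt.continuousWithinAt)
      (fun z hz => hd z (Metric.ball_subset_closedBall hz.1))

/-- The form `n zᵏ dz / (zⁿ - 1)`, `n = 2m + 2`, pulled back to `[0, 1]` by the loop. -/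
def cyclotomicForm (m k : ℕ) : Path ℂ :=
  ∑ j ∈ Finset.range (2 * m + 2), puncture m j • loopForm m j k

theorem Path.sum_apply {𝒜 ι : Type*} [NormedRing 𝒜] (s : Finset ι) (f : ι → Path 𝒜) (x : I) :
    (∑ i ∈ s, f i) x = ∑ i ∈ s, f i x := by
  induction s using Finset.cons_induction with
  | empty => rfl
  | cons a s ha ih => rw [Finset.sum_cons, Finset.sum_cons, Path.add_apply, ih]

/-- Powers of p_j in the residues can be traded for powers of z. At x₀ the residues depend on j
through such powers only, so each sum over the punctures collapses to one cyclotomic form. -/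
theorem sum_puncture_pow_smul_loopForm {m i : ℕ} (hi : i < 2 * m + 2) (k : ℕ) :
    ∑ j ∈ Finset.range (2 * m + 2), puncture m j ^ (i + 1) • loopForm m j k =
      cyclotomicForm m (i + k) := by
  have key : ∀ e, e < 2 * m + 2 → ∀ k (s : I),
      (∑ j ∈ Finset.range (2 * m + 2), puncture m j ^ (e + 1) • loopForm m j k) s =
        deriv (loop m) s * (((2 * m + 2 : ℕ) : ℂ) * loop m s ^ (e + k) /
          (loop m s ^ (2 * m + 2) - 1)) := by
    intro e he k s
    have h := sum_puncture_pow_mul_inv he (pow_card_ne_one (loop_ne_puncture m · s))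
    rw [Path.sum_apply]
    calc _ = deriv (loop m) s * loop m s ^ k * ∑ j ∈ Finset.range (2 * m + 2),
          puncture m j ^ (e + 1) * (loop m s - puncture m j)⁻¹ := by
          rw [Finset.mul_sum]
          refine Finset.sum_congr rfl fun j _ => ?_
          rw [Path.smul_apply, loopForm_apply, smul_eq_mul]
          ring
      _ = _ := by rw [h, pow_add]; ring
  ext s
  have h0 := key 0 (by omega) (i + k) s
  simp only [zero_add, pow_one] at h0
  rw [key i hi k s, cyclotomicForm, h0]

/-- The function `n (1 - zᵐ)² / (zⁿ - 1)`, `n = 2m + 2`, by partial fractions. -/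
def kappaForm (m : ℕ) (z : ℂ) : ℂ := ∑ j ∈ Finset.range (2 * m + 2),
  (puncture m j - 2 * puncture m j ^ (m + 1) + puncture m j ^ (2 * m + 1)) * (z - puncture m j)⁻¹

theorem differentiableAt_kappaForm {m : ℕ} {z : ℂ}
    (hz : ∀ j, 1 ≤ j → j < 2 * m + 2 → z ≠ puncture m j) :
    DifferentiableAt ℂ (kappaForm m) z := by
  unfold kappaForm
  refine DifferentiableAt.fun_sum fun j hj => ?_
  rcases Nat.eq_zero_or_pos j with rfl | h
  -- The residue at p₀ = 1 is 1 - 2 + 1 = 0: the double zero of (1 - zᵐ)² absorbs the pole.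
  · have : ∀ z : ℂ, (puncture m 0 - 2 * puncture m 0 ^ (m + 1) + puncture m 0 ^ (2 * m + 1)) *
        (z - puncture m 0)⁻¹ = 0 := by
      intro z; rw [puncture_zero]; ring
    simp_rw [this]
    exact differentiableAt_const _
  · have := sub_ne_zero.2 (hz j h (Finset.mem_range.1 hj))
    fun_prop (disch := assumption)

theorem kappaForm_ofReal {m : ℕ} {x : ℝ} (hx : x ∈ Set.Ioo (0 : ℝ) 1) :
    kappaForm m x = ((-((2 * m + 2 : ℝ) * ((1 - x ^ m) ^ 2 / (1 - x ^ (2 * m + 2)))) : ℝ) : ℂ) := by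
  have hlt : x ^ (2 * m + 2) < 1 := pow_lt_one₀ hx.1.le hx.2 (by omega)
  have hz : (x : ℂ) ^ (2 * m + 2) ≠ 1 := by
    intro h
    have : x ^ (2 * m + 2) = 1 := by exact_mod_cast h
    exact hlt.ne this
  have h0 := sum_puncture_pow_mul_inv (k := 0) (by omega) hz
  have h1 := sum_puncture_pow_mul_inv (k := m) (by omega) hz
  have h2 := sum_puncture_pow_mul_inv (k := 2 * m) (by omega) hz
  have e : kappaForm m x = (∑ j ∈ Finset.range (2 * m + 2),
        puncture m j ^ (0 + 1) * ((x : ℂ) - puncture m j)⁻¹) -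
      2 * (∑ j ∈ Finset.range (2 * m + 2), puncture m j ^ (m + 1) * ((x : ℂ) - puncture m j)⁻¹) +
      ∑ j ∈ Finset.range (2 * m + 2), puncture m j ^ (2 * m + 1) * ((x : ℂ) - puncture m j)⁻¹ := by
    rw [kappaForm, Finset.mul_sum, ← Finset.sum_sub_distrib, ← Finset.sum_add_distrib]
    refine Finset.sum_congr rfl fun j _ => ?_
    ring
  rw [e, h0, h1, h2]
  have hz1 : (x : ℂ) ^ (2 * m + 2) - 1 ≠ 0 := sub_ne_zero.2 hz
  have hz2 : 1 - (x : ℂ) ^ (2 * m + 2) ≠ 0 := sub_ne_zero.2 (Ne.symm hz)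
  push_cast
  have hz3 : (1 - (x : ℂ) ^ (2 * m + 2))⁻¹ = -((x : ℂ) ^ (2 * m + 2) - 1)⁻¹ := by
    rw [← neg_sub, inv_neg]
  rw [div_eq_mul_inv _ (1 - (x : ℂ) ^ (2 * m + 2)), hz3]
  simp only [div_eq_mul_inv]
  ring

/-- A primitive `h` of `n (1 - zᵐ)² / (zⁿ - 1)` with `h(0) = 0` on a disc containing the closed
disc bounded by the loop. -/
theorem exists_primitive_kappaForm {m : ℕ} (hm : 1 ≤ m) :
    ∃ h : ℂ → ℂ, h 0 = 0 ∧ (∀ z ∈ Metric.closedBall (loopRadius m : ℂ) (loopRadius m),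
      HasDerivAt h (kappaForm m z) z) := by
  let S : Set ℂ := ((Finset.Ico 1 (2 * m + 2)).image (puncture m) : Finset ℂ)
  have hS : IsOpen Sᶜ := (Finset.finite_toSet _).isClosed.isOpen_compl
  have hmem : ∀ z ∈ Sᶜ, ∀ j, 1 ≤ j → j < 2 * m + 2 → z ≠ puncture m j := by
    intro z hz j h1 h2 h
    refine hz ?_
    simp only [S, Finset.coe_image, Finset.coe_Ico]
    exact ⟨j, ⟨h1, h2⟩, h.symm⟩
  have hsub : Metric.closedBall (loopRadius m : ℂ) (loopRadius m) ⊆ Sᶜ := by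
    intro z hz h
    simp only [S, Finset.coe_image, Finset.coe_Ico] at h
    obtain ⟨j, ⟨h1, h2⟩, h⟩ := h
    exact ne_puncture_of_mem_closedBall hm h1 h2 hz h.symm
  -- A slightly larger open disc still avoids p_1, …, p_{n-1}; on it the primitive exists and is
  -- differentiable also at the points of the loop.
  obtain ⟨δ, hδ, hthick⟩ :=
    (isCompact_closedBall (loopRadius m : ℂ) (loopRadius m)).exists_thickening_subset_open hS hsub
  rw [thickening_closedBall hδ (loopRadius_pos hm).le] at hthick
  have hd : DifferentiableOn ℂ (kappaForm m) (Metric.ball (loopRadius m : ℂ) (δ + loopRadius m)) :=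
    fun z hz => (differentiableAt_kappaForm (hmem z (hthick hz))).differentiableWithinAt
  obtain ⟨h, h0, hh⟩ := hd.isExactOn_ball.with_val_at 0 0
  refine ⟨h, h0, fun z hz => hh z ?_⟩
  exact Metric.closedBall_subset_ball (by linarith) hz

theorem segment_mem_closedBall {m : ℕ} (hm : 1 ≤ m) {x : ℝ} (hx : x ∈ Set.Icc (0 : ℝ) 1) :
    (x : ℂ) ∈ Metric.closedBall (loopRadius m : ℂ) (loopRadius m) := by
  have h1 := one_mem_ball hm
  have h0 := loopRadius_pos hm
  rw [Metric.mem_ball, dist_eq_norm, ← Complex.ofReal_one, ← Complex.ofReal_sub,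
    Complex.norm_real, Real.norm_eq_abs, abs_lt] at h1
  rw [Metric.mem_closedBall, dist_eq_norm, ← Complex.ofReal_sub,
    Complex.norm_real, Real.norm_eq_abs, abs_le]
  exact ⟨by linarith [hx.1], by linarith [hx.2, h1.2]⟩

theorem continuousOn_kappaForm {m : ℕ} (hm : 1 ≤ m) :
    ContinuousOn (kappaForm m) (Metric.closedBall (loopRadius m : ℂ) (loopRadius m)) :=
  fun _ hz => (differentiableAt_kappaForm fun _ h1 h2 =>
    ne_puncture_of_mem_closedBall hm h1 h2 hz).continuousAt.continuousWithinAt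

theorem primitive_kappaForm_one {m : ℕ} (hm : 1 ≤ m) {h : ℂ → ℂ} (h0 : h 0 = 0)
    (hh : ∀ z ∈ Metric.closedBall (loopRadius m : ℂ) (loopRadius m),
      HasDerivAt h (kappaForm m z) z) : h 1 = -(2 * kappa m : ℝ) := by
  have hd : ∀ x ∈ Set.uIcc (0 : ℝ) 1, HasDerivAt (fun x : ℝ => h x) (kappaForm m x) x := by
    intro x hx
    rw [Set.uIcc_of_le zero_le_one] at hx
    exact (hh x (segment_mem_closedBall hm hx)).comp_ofReal
  have hc : ContinuousOn (fun x : ℝ => kappaForm m x) (Set.uIcc 0 1) := by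
    rw [Set.uIcc_of_le zero_le_one]
    exact (continuousOn_kappaForm hm).comp Complex.continuous_ofReal.continuousOn
      fun x hx => segment_mem_closedBall hm hx
  have h1 := intervalIntegral.integral_eq_sub_of_hasDerivAt hd hc.intervalIntegrable
  simp only [Complex.ofReal_one, Complex.ofReal_zero, h0, sub_zero] at h1
  rw [← h1]
  have h2 : ∫ x in (0 : ℝ)..1, kappaForm m x = ∫ x in (0 : ℝ)..1,
      ((-((2 * m + 2 : ℝ) * ((1 - x ^ m) ^ 2 / (1 - x ^ (2 * m + 2)))) : ℝ) : ℂ) := by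
    -- At x = 1 the integrand of κ_m is the quotient 0/0, so the integrands are compared on the open
    -- interval only.
    rw [intervalIntegral.integral_of_le zero_le_one, intervalIntegral.integral_of_le zero_le_one,
      MeasureTheory.integral_Ioc_eq_integral_Ioo, MeasureTheory.integral_Ioc_eq_integral_Ioo]
    exact MeasureTheory.setIntegral_congr_fun measurableSet_Ioo fun x hx => kappaForm_ofReal hx
  rw [h2, intervalIntegral.integral_ofReal, intervalIntegral.integral_neg,
    intervalIntegral.integral_const_mul, kappa]
  push_cast
  ring

/-- The iterated integral `∫₀¹ (∫₀ˢ u) v ds`. -/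
def iterInt (u v : Path ℂ) : ℂ := totalIntegral ℂ (volterra ℂ u * v)

theorem cyclotomicForm_comb (m : ℕ) (s : I) :
    (cyclotomicForm m 0 - (2 : ℂ) • cyclotomicForm m m + cyclotomicForm m (2 * m)) s =
      deriv (loop m) s * kappaForm m (loop m s) := by
  have h0 := sum_puncture_pow_smul_loopForm (m := m) (i := 0) (by omega) 0
  have h1 := sum_puncture_pow_smul_loopForm (m := m) (i := m) (by omega) 0
  have h2 := sum_puncture_pow_smul_loopForm (m := m) (i := 2 * m) (by omega) 0
  rw [add_zero] at h0 h1 h2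
  rw [← h0, ← h1, ← h2, Finset.smul_sum, ← Finset.sum_sub_distrib, ← Finset.sum_add_distrib,
    Path.sum_apply, kappaForm, Finset.mul_sum]
  refine Finset.sum_congr rfl fun j _ => ?_
  change puncture m j ^ (0 + 1) * loopForm m j 0 s -
    2 * (puncture m j ^ (m + 1) * loopForm m j 0 s) + puncture m j ^ (2 * m + 1) * loopForm m j 0 s = _
  rw [loopForm_apply]
  ring

/-- The form v has a primitive h on the disc, with h(0) = 0. Integrating ∫(∫₀ˢ u) v by parts turns
it into -∫ h u, and ∫(∫₀ˢ v) u is ∫ h u. Since u = c_m has residue 1 at its only enclosed pole z =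
1, the difference is -2 · 2πi h(1), where h(1) = -2κ_m. -/
theorem iterInt_sub_swap {m : ℕ} (hm : 1 ≤ m) :
    iterInt (cyclotomicForm m m)
        (cyclotomicForm m 0 - (2 : ℂ) • cyclotomicForm m m + cyclotomicForm m (2 * m)) -
      iterInt (cyclotomicForm m 0 - (2 : ℂ) • cyclotomicForm m m + cyclotomicForm m (2 * m))
        (cyclotomicForm m m) = 8 * Real.pi * Complex.I * kappa m := by
  obtain ⟨h, h0, hh⟩ := exists_primitive_kappaForm hm
  have h1 := primitive_kappaForm_one hm h0 hh
  set v := cyclotomicForm m 0 - (2 : ℂ) • cyclotomicForm m m + cyclotomicForm m (2 * m) with hv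
  set u := cyclotomicForm m m with hu
  let U : ℝ → ℂ := fun s => Set.IccExtend zero_le_one (volterra ℂ u) s
  have hUd : ∀ s ∈ Set.Icc (0 : ℝ) 1, HasDerivWithinAt U (Set.IccExtend zero_le_one u s)
      (Set.Icc 0 1) s := by
    intro s hs
    have := hasDerivWithinAt_volterra u hs
    rwa [Set.IccExtend_of_mem zero_le_one u hs]
  have hHd : ∀ s : ℝ, HasDerivAt (fun s => h (loop m s))
      (deriv (loop m) s * kappaForm m (loop m s)) s := by
    intro s
    have h2 := (hh _ (loop_mem_closedBall hm s)).comp s (h₂ := h) (h := loop m)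
      ((hasDerivAt_loop m s).differentiableAt.hasDerivAt)
    rw [mul_comm]
    exact h2
  have hk : Continuous fun s : ℝ => deriv (loop m) s * kappaForm m (loop m s) :=
    (continuous_deriv_loop m).mul ((continuousOn_kappaForm hm).comp_continuous (continuous_loop m)
      (loop_mem_closedBall hm))
  have hu' : Continuous (Set.IccExtend zero_le_one u) := u.continuous.Icc_extend'
  have hHc : Continuous fun s => h (loop m s) :=
    continuous_iff_continuousAt.2 fun s => (hHd s).continuousAt
  have e1 : iterInt u v =
      ∫ s in (0 : ℝ)..1, U s * (deriv (loop m) s * kappaForm m (loop m s)) := by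
    refine totalIntegral_eq_integral _ _ fun s => ?_
    rw [Path.mul_apply, hv, cyclotomicForm_comb]
    simp [U]
  have e2 : iterInt v u = ∫ s in (0 : ℝ)..1, h (loop m s) * Set.IccExtend zero_le_one u s := by
    refine totalIntegral_eq_integral _ _ fun s => ?_
    rw [Path.mul_apply, volterra_eq_integral v
      (fun s => deriv (loop m) s * kappaForm m (loop m s)) (fun s => by
        rw [hv, cyclotomicForm_comb]), intervalIntegral.integral_eq_sub_of_hasDerivAt
        (fun x _ => hHd x) (hk.intervalIntegrable _ _), loop_zero, h0, sub_zero]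
    simp
  -- The boundary terms vanish because both ends of the loop are 0 and h(0) = 0.
  have e3 : ∫ s in (0 : ℝ)..1, U s * (deriv (loop m) s * kappaForm m (loop m s)) =
      -∫ s in (0 : ℝ)..1, Set.IccExtend zero_le_one u s * h (loop m s) := by
    have := intervalIntegral.integral_mul_deriv_eq_deriv_mul_of_hasDerivWithinAt
      (u := U) (v := fun s => h (loop m s)) (a := 0) (b := 1)
      (u' := Set.IccExtend zero_le_one u)
      (v' := fun s => deriv (loop m) s * kappaForm m (loop m s))
      (by rw [Set.uIcc_of_le zero_le_one]; exact hUd)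
      (fun s _ => (hHd s).hasDerivWithinAt)
      (hu'.intervalIntegrable _ _) (hk.intervalIntegrable _ _)
    rw [this]
    simp [loop_zero, loop_one, h0]
  have e4 : ∫ s in (0 : ℝ)..1, h (loop m s) * Set.IccExtend zero_le_one u s =
      2 * Real.pi * Complex.I * h 1 := by
    let q : ℂ → ℂ := fun z => h z * ∑ j ∈ Finset.range (2 * m + 2),
      puncture m j ^ (m + 1) * (z - puncture m j)⁻¹
    have e5 : ∫ s in (0 : ℝ)..1, h (loop m s) * Set.IccExtend zero_le_one u s =
        ∫ s in (0 : ℝ)..1, deriv (loop m) s * q (loop m s) := by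
      refine intervalIntegral.integral_congr fun s hs => ?_
      rw [Set.uIcc_of_le zero_le_one] at hs
      simp only [Set.IccExtend_of_mem zero_le_one u hs]
      have h3 := sum_puncture_pow_smul_loopForm (m := m) (i := m) (by omega) 0
      rw [add_zero] at h3
      rw [hu, ← h3, Path.sum_apply, Finset.mul_sum]
      simp only [q]
      rw [Finset.mul_sum, Finset.mul_sum]
      refine Finset.sum_congr rfl fun j _ => ?_
      rw [Path.smul_apply, loopForm_apply, smul_eq_mul]
      ring
    rw [e5, integral_loop]
    -- The simple pole at 1 is split off: what multiplies (z - 1)⁻¹ is holomorphic on the closed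
    -- disc and equals h(1) at z = 1, so Cauchy's formula applies.
    have hq : ∀ z ∈ Metric.sphere (loopRadius m : ℂ) (loopRadius m), q z =
        (z - 1)⁻¹ • (h z + (z - 1) * (h z * ∑ j ∈ Finset.Ico 1 (2 * m + 2),
          puncture m j ^ (m + 1) * (z - puncture m j)⁻¹)) := by
      intro z hz
      have hz1 : z - 1 ≠ 0 := by
        rw [sub_ne_zero]
        rintro rfl
        exact (Metric.sphere_disjoint_ball.le_bot ⟨hz, one_mem_ball hm⟩ : _)
      simp only [q]
      rw [Finset.range_eq_Ico, Finset.sum_eq_sum_Ico_succ_bot (by omega), puncture_zero]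
      simp only [smul_eq_mul, one_pow, one_mul, zero_add]
      field_simp
    rw [circleIntegral.integral_congr (loopRadius_pos hm).le hq]
    have hd : DifferentiableOn ℂ (fun z : ℂ => h z + (z - 1) * (h z *
        ∑ j ∈ Finset.Ico 1 (2 * m + 2), puncture m j ^ (m + 1) * (z - puncture m j)⁻¹))
        (Metric.closedBall (loopRadius m : ℂ) (loopRadius m)) := by
      intro z hz
      have hz' := (hh z hz).differentiableAt
      have hs : DifferentiableAt ℂ (fun z : ℂ => ∑ j ∈ Finset.Ico 1 (2 * m + 2),
          puncture m j ^ (m + 1) * (z - puncture m j)⁻¹) z := by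
        refine DifferentiableAt.fun_sum fun j hj => ?_
        rw [Finset.mem_Ico] at hj
        have := sub_ne_zero.2 (ne_puncture_of_mem_closedBall hm hj.1 hj.2 hz)
        fun_prop (disch := assumption)
      exact (hz'.add (((differentiableAt_id).sub_const 1).mul
        (hz'.mul hs))).differentiableWithinAt
    rw [hd.circleIntegral_sub_inv_smul (one_mem_ball hm)]
    simp
  have e6 : ∫ s in (0 : ℝ)..1, Set.IccExtend zero_le_one u s * h (loop m s) =
      2 * Real.pi * Complex.I * h 1 := by
    rw [← e4]; simp_rw [mul_comm]
  rw [e1, e2, e3, e4, e6, h1]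
  push_cast
  ring

/-- By bilinearity, the term -2c_m of v cancels against itself. The two differences on the left come
from the entries (1, 0) and (0, 1) of the second order term at x₀, and only their sum enters the
equations. -/
theorem iterInt_cyclotomicForm {m : ℕ} (hm : 1 ≤ m) :
    iterInt (cyclotomicForm m m) (cyclotomicForm m (2 * m)) -
      iterInt (cyclotomicForm m (2 * m)) (cyclotomicForm m m) +
      (iterInt (cyclotomicForm m m) (cyclotomicForm m 0) -
      iterInt (cyclotomicForm m 0) (cyclotomicForm m m)) = 8 * Real.pi * Complex.I * kappa m := by
  rw [← iterInt_sub_swap hm]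
  simp only [iterInt, mul_add, mul_sub, map_add, map_sub, add_mul, sub_mul, map_smul,
    smul_mul_assoc, mul_smul_comm]
  ring

end LawsonDPW

namespace LawsonDPW

open scoped ENNReal

/-! ### Lifting bounded families to weighted `ℓ¹` spaces -/

theorem summable_norm_lp_one {ι 𝕜 : Type*} [RCLike 𝕜] (x : lp (fun _ : ι => 𝕜) 1) :
    Summable fun k => ‖x k‖ := by
  simpa using (lp.memℓp x).summable (by simp)

theorem norm_lp_one {ι 𝕜 : Type*} [RCLike 𝕜] (x : lp (fun _ : ι => 𝕜) 1) :
    ‖x‖ = ∑' k, ‖x k‖ := by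
  rw [lp.norm_eq_tsum_rpow (by simp)]
  simp

theorem summable_smul_of_bound {ι 𝕜 F : Type*} [RCLike 𝕜] [NormedAddCommGroup F] [NormedSpace 𝕜 F]
    {v : ι → F} {C : ℝ} (hv : ∀ k, ‖v k‖ ≤ C) (x : lp (fun _ : ι => 𝕜) 1) :
    Summable fun k => ‖x k • v k‖ := by
  refine Summable.of_nonneg_of_le (fun k => norm_nonneg _) (fun k => ?_)
    ((summable_norm_lp_one x).mul_right C)
  rw [norm_smul]
  exact mul_le_mul_of_nonneg_left (hv k) (norm_nonneg _)

/-- The continuous linear map on `ℓ¹` that sends the basis to a bounded family. -/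
def lpLift {ι 𝕜 F : Type*} [RCLike 𝕜] [NormedAddCommGroup F] [NormedSpace 𝕜 F] [CompleteSpace F]
    (v : ι → F) (C : ℝ) (hv : ∀ k, ‖v k‖ ≤ C) : lp (fun _ : ι => 𝕜) 1 →L[𝕜] F :=
  LinearMap.mkContinuous
    { toFun := fun x => ∑' k, x k • v k
      map_add' := fun x y => by
        rw [← (summable_smul_of_bound hv x).of_norm.tsum_add (summable_smul_of_bound hv y).of_norm]
        refine tsum_congr fun k => ?_
        rw [lp.coeFn_add, Pi.add_apply, add_smul]
      map_smul' := fun c x => by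
        rw [RingHom.id_apply, ← (summable_smul_of_bound hv x).of_norm.tsum_const_smul]
        refine tsum_congr fun k => ?_
        rw [lp.coeFn_smul, Pi.smul_apply, smul_assoc] } C (fun x => by
    refine (norm_tsum_le_tsum_norm (summable_smul_of_bound hv x)).trans ?_
    rw [norm_lp_one, mul_comm, ← tsum_mul_right]
    refine (summable_smul_of_bound hv x).tsum_le_tsum (fun k => ?_)
      ((summable_norm_lp_one x).mul_right C)
    rw [norm_smul]
    exact mul_le_mul_of_nonneg_left (hv k) (norm_nonneg _))

theorem lpLift_apply {ι 𝕜 F : Type*} [RCLike 𝕜] [NormedAddCommGroup F] [NormedSpace 𝕜 F]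
    [CompleteSpace F] (v : ι → F) (C : ℝ) (hv : ∀ k, ‖v k‖ ≤ C) (x : lp (fun _ : ι => 𝕜) 1) :
    lpLift v C hv x = ∑' k, x k • v k := rfl

theorem norm_lpLift_le {ι 𝕜 F : Type*} [RCLike 𝕜] [NormedAddCommGroup F] [NormedSpace 𝕜 F]
    [CompleteSpace F] (v : ι → F) (C : ℝ) (hC : 0 ≤ C) (hv : ∀ k, ‖v k‖ ≤ C) :
    ‖lpLift (𝕜 := 𝕜) v C hv‖ ≤ C := LinearMap.mkContinuous_norm_le _ hC _

theorem lpLift_single {ι 𝕜 F : Type*} [RCLike 𝕜] [DecidableEq ι] [NormedAddCommGroup F]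
    [NormedSpace 𝕜 F] [CompleteSpace F] (v : ι → F) (C : ℝ) (hv : ∀ k, ‖v k‖ ≤ C) (k : ι) :
    lpLift v C hv (lp.single 1 k (1 : 𝕜)) = v k := by
  rw [lpLift_apply, tsum_eq_single k, lp.single_apply_self, one_smul]
  intro j hj
  rw [lp.single_apply_ne _ _ _ hj, zero_smul]

theorem lp_clm_ext {ι 𝕜 F : Type*} [RCLike 𝕜] [DecidableEq ι] [NormedAddCommGroup F]
    [NormedSpace 𝕜 F] {S T : lp (fun _ : ι => 𝕜) 1 →L[𝕜] F}
    (h : ∀ k, S (lp.single 1 k (1 : 𝕜)) = T (lp.single 1 k (1 : 𝕜))) : S = T := by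
  ext1 x
  have hx := lp.hasSum_single (p := 1) (by simp) x
  have e : ∀ k, (lp.single 1 k (x k) : lp (fun _ : ι => 𝕜) 1) =
      x k • (lp.single 1 k (1 : 𝕜) : lp (fun _ : ι => 𝕜) 1) := by
    intro k
    rw [← lp.single_smul, smul_eq_mul, mul_one]
  have h1 := hx.mapL S
  have h2 := hx.mapL T
  simp_rw [e, map_smul, h] at h1
  simp_rw [e, map_smul] at h2
  exact h1.unique h2

/-! ### The space `W` -/

namespace W

variable {ρ : ℝ} [hρ : Fact (1 < ρ)]

theorem abs_rho_pow_pos (k : ℕ) : 0 < |ρ| ^ k :=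
  pow_pos (abs_pos.2 (by linarith [hρ.out])) k

/-- `W` is isometric to `ℓ¹`. -/
def toLp : W ρ ≃ₗᵢ[ℝ] lp (fun _ : ℕ => ℝ) 1 where
  toFun f := ⟨fun k => f.coeff k * |ρ| ^ k, by
    refine (memℓp_gen_iff (by simp)).2 ?_
    simpa [abs_mul] using f.summable⟩
  invFun x := ⟨fun k => x k / |ρ| ^ k, by
    refine (summable_norm_lp_one x).congr fun k => ?_
    rw [abs_div, abs_of_pos (abs_rho_pow_pos k), div_mul_cancel₀ _ (abs_rho_pow_pos k).ne']
    rfl⟩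
  map_add' f g := by
    ext k
    exact add_mul _ _ _
  map_smul' c f := by
    ext k
    exact mul_assoc _ _ _
  left_inv f := by
    ext k
    exact mul_div_cancel_right₀ _ (abs_rho_pow_pos k).ne'
  right_inv x := by
    ext k
    exact div_mul_cancel₀ _ (abs_rho_pow_pos k).ne'
  norm_map' f := by
    rw [norm_lp_one, norm_def]
    refine tsum_congr fun k => ?_
    change |f.coeff k * |ρ| ^ k| = _
    rw [abs_mul, abs_of_pos (abs_rho_pow_pos k)]

theorem toLp_apply (f : W ρ) (k : ℕ) : toLp f k = f.coeff k * |ρ| ^ k := rfl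

instance : CompleteSpace (W ρ) :=
  (completeSpace_congr (e := (toLp (ρ := ρ)).toEquiv)
    (toLp (ρ := ρ)).isometry.isUniformEmbedding).2 inferInstance

/-- The continuous linear map `f ↦ ∑ fₖ vₖ` for a family `v` with `‖vₖ‖ ≤ ρᵏ`. -/
def lift {F : Type*} [NormedAddCommGroup F] [NormedSpace ℝ F] [CompleteSpace F]
    (v : ℕ → F) (hv : ∀ k, ‖v k‖ ≤ |ρ| ^ k) : W ρ →L[ℝ] F :=
  (lpLift (𝕜 := ℝ) (fun k => (|ρ| ^ k)⁻¹ • v k) 1 (fun k => by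
    rw [norm_smul, norm_inv, norm_pow, Real.norm_eq_abs, abs_abs, inv_mul_le_iff₀
      (abs_rho_pow_pos k), mul_one]
    exact hv k)).comp (toLp (ρ := ρ)).toContinuousLinearEquiv.toContinuousLinearMap

theorem lift_apply {F : Type*} [NormedAddCommGroup F] [NormedSpace ℝ F] [CompleteSpace F]
    (v : ℕ → F) (hv : ∀ k, ‖v k‖ ≤ |ρ| ^ k) (f : W ρ) : lift v hv f = ∑' k, f.coeff k • v k := by
  change ∑' k, toLp f k • ((|ρ| ^ k)⁻¹ • v k) = _
  refine tsum_congr fun k => ?_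
  rw [toLp_apply, smul_smul, mul_assoc, mul_inv_cancel₀ (abs_rho_pow_pos k).ne', mul_one]

theorem summable_lift {ρ : ℝ} {F : Type*} [NormedAddCommGroup F] [NormedSpace ℝ F]
    [CompleteSpace F] {v : ℕ → F} (hv : ∀ k, ‖v k‖ ≤ |ρ| ^ k) (f : W ρ) : Summable fun k => f.coeff k • v k := by
  refine Summable.of_norm (Summable.of_nonneg_of_le (fun k => norm_nonneg _) (fun k => ?_)
    f.summable)
  rw [norm_smul, Real.norm_eq_abs]
  exact mul_le_mul_of_nonneg_left (hv k) (abs_nonneg _)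

end W

/-! ### The Wiener algebra -/

/-- Laurent series with `∑ |fₖ| ρ^|k| < ∞`, through the rescaled coefficients `fₖ ρ^|k|`. -/
abbrev Laurent := lp (fun _ : ℤ => ℂ) 1

section Wiener

variable (ρ : ℝ) [hρ : Fact (1 < ρ)]

theorem one_le_weight (k : ℤ) : 1 ≤ ρ ^ k.natAbs := one_le_pow₀ hρ.out.le

theorem weight_pos (k : ℤ) : 0 < ρ ^ k.natAbs := lt_of_lt_of_le one_pos (one_le_weight ρ k)

/-- The value of a Laurent series at a point of the unit circle. -/
def circleEval (l : Circle) : Laurent →L[ℂ] ℂ :=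
  lpLift (fun k : ℤ => ((ρ ^ k.natAbs : ℝ) : ℂ)⁻¹ * (l : ℂ) ^ k) 1 (fun k => by
    rw [norm_mul, norm_inv, norm_zpow, Circle.norm_coe, one_zpow, mul_one, Complex.norm_real,
      Real.norm_eq_abs, abs_of_pos (weight_pos ρ k)]
    exact inv_le_one_of_one_le₀ (one_le_weight ρ k))

theorem circleEval_apply (l : Circle) (x : Laurent) :
    circleEval ρ l x = ∑' k, x k / ((ρ ^ k.natAbs : ℝ) : ℂ) * (l : ℂ) ^ k := by
  rw [circleEval, lpLift_apply]
  refine tsum_congr fun k => ?_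
  rw [smul_eq_mul, div_eq_mul_inv, mul_assoc]

theorem summable_coeff (x : Laurent) : Summable fun k => ‖x k / ((ρ ^ k.natAbs : ℝ) : ℂ)‖ := by
  refine Summable.of_nonneg_of_le (fun k => norm_nonneg _) (fun k => ?_) (summable_norm_lp_one x)
  rw [norm_div, Complex.norm_real, Real.norm_eq_abs, abs_of_pos (weight_pos ρ k)]
  exact div_le_self (norm_nonneg _) (one_le_weight ρ k)

theorem norm_circleEval_le (l : Circle) (x : Laurent) : ‖circleEval ρ l x‖ ≤ ‖x‖ := by
  have h := (circleEval ρ l).le_of_opNorm_le (norm_lpLift_le _ 1 zero_le_one _) x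
  rwa [one_mul] at h

theorem circleEval_single (l : Circle) (k : ℤ) :
    circleEval ρ l (lp.single 1 k 1) = ((ρ ^ k.natAbs : ℝ) : ℂ)⁻¹ * (l : ℂ) ^ k :=
  lpLift_single _ _ _ _

theorem circleEval_one (l : Circle) : circleEval ρ l (lp.single 1 0 1) = 1 := by
  simp [circleEval_single]

/-- The multiplication operators on Laurent series, as a closed algebra of operators. -/
def wienerSubalgebra : Subalgebra ℂ (Laurent →L[ℂ] Laurent) where
  carrier := {T | ∀ (l : Circle) (x : Laurent),
    circleEval ρ l (T x) = circleEval ρ l (T (lp.single 1 0 1)) * circleEval ρ l x}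
  mul_mem' := by
    intro S T hS hT l x
    rw [mul_apply_eq_comp, mul_apply_eq_comp, hS l (T x), hS l (T (lp.single 1 0 1)), hT l x]
    ring
  add_mem' := by
    intro S T hS hT l x
    rw [add_apply, add_apply, map_add, map_add, hS l x, hT l x, add_mul]
  algebraMap_mem' := by
    intro c l x
    have h : ∀ y : Laurent, (algebraMap ℂ (Laurent →L[ℂ] Laurent) c) y = c • y := fun y => rfl
    rw [h, h, map_smul, map_smul, circleEval_one, smul_eq_mul, smul_eq_mul, mul_one]

/-- Each defining condition equates two continuous functions of T. Realised as a closed subalgebra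
of operators on ℓ¹, the Wiener algebra inherits its product, submultiplicative norm and
completeness, so no convolution of series is needed. -/
theorem isClosed_wienerSubalgebra : IsClosed (wienerSubalgebra ρ : Set (Laurent →L[ℂ] Laurent)) := by
  have : (wienerSubalgebra ρ : Set (Laurent →L[ℂ] Laurent)) =
      ⋂ (l : Circle), ⋂ (x : Laurent), {T | circleEval ρ l (T x) =
        circleEval ρ l (T (lp.single 1 0 1)) * circleEval ρ l x} := by
    ext T
    simp only [Set.mem_iInter, Set.mem_ofPred_eq]
    rfl
  rw [this]
  refine isClosed_iInter fun l => isClosed_iInter fun x => isClosed_eq ?_ ?_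
  · exact (circleEval ρ l).continuous.comp (ContinuousLinearMap.apply ℂ Laurent x).continuous
  · exact ((circleEval ρ l).continuous.comp
      (ContinuousLinearMap.apply ℂ Laurent (lp.single 1 0 1 : Laurent)).continuous).mul
      continuous_const

/-- The Wiener algebra of Laurent series with `∑ |fₖ| ρ^|k| < ∞`. -/
def Wiener : Type := wienerSubalgebra ρ

instance : NormedRing (Wiener ρ) := inferInstanceAs (NormedRing (wienerSubalgebra ρ))

instance : NormedAlgebra ℂ (Wiener ρ) := inferInstanceAs (NormedAlgebra ℂ (wienerSubalgebra ρ))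

instance : CompleteSpace (Wiener ρ) :=
  (isClosed_wienerSubalgebra ρ).completeSpace_coe

end Wiener

namespace Wiener

variable {ρ : ℝ} [hρ : Fact (1 < ρ)]

/-- The Laurent series of an element of the Wiener algebra. -/
def toLaurent : Wiener ρ →L[ℂ] Laurent :=
  (ContinuousLinearMap.apply ℂ Laurent (lp.single 1 0 1 : Laurent)).comp
    (wienerSubalgebra ρ).toSubmodule.subtypeL

theorem norm_toLaurent_le (T : Wiener ρ) : ‖toLaurent T‖ ≤ ‖T‖ := by
  have h := (T.1 : Laurent →L[ℂ] Laurent).le_opNorm (lp.single 1 0 1)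
  rw [lp.norm_single (by simp), norm_one, mul_one] at h
  exact h

/-- Evaluation at a point of the unit circle. -/
def eval (l : Circle) : Wiener ρ →ₐ[ℂ] ℂ :=
  AlgHom.ofLinearMap ((circleEval ρ l).toLinearMap.comp (toLaurent (ρ := ρ)).toLinearMap)
    (circleEval_one ρ l) (fun S T => S.2 l (T.1 (lp.single 1 0 1)))

theorem norm_eval_le (l : Circle) (T : Wiener ρ) : ‖eval l T‖ ≤ ‖T‖ :=
  (norm_circleEval_le ρ l _).trans (norm_toLaurent_le T)

/-- Evaluation at a point of the unit circle, as a continuous linear map. -/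
def evalL (l : Circle) : Wiener ρ →L[ℂ] ℂ := (circleEval ρ l).comp toLaurent

/-- The Laurent coefficients. -/
def coeff (T : Wiener ρ) (k : ℤ) : ℂ := toLaurent T k / ((ρ ^ k.natAbs : ℝ) : ℂ)

theorem summable_coeff (T : Wiener ρ) : Summable fun k => ‖T.coeff k‖ :=
  LawsonDPW.summable_coeff ρ (toLaurent T)

theorem eval_eq_tsum (l : Circle) (T : Wiener ρ) : eval l T = ∑' k, T.coeff k * (l : ℂ) ^ k :=
  circleEval_apply ρ l (toLaurent T)

theorem summable_mul_zpow {f : ℤ → ℂ} (hf : Summable fun k => ‖f k‖) (l : Circle) :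
    Summable fun k => f k * (l : ℂ) ^ k := by
  refine Summable.of_norm (hf.congr fun k => ?_)
  rw [norm_mul, norm_zpow, Circle.norm_coe, one_zpow, mul_one]

theorem eq_of_hasSum {f g : ℤ → ℂ} (hf : Summable fun k => ‖f k‖) (hg : Summable fun k => ‖g k‖)
    (h : ∀ l : Circle, ∑' k, f k * (l : ℂ) ^ k = ∑' k, g k * (l : ℂ) ^ k) : f = g := by
  have h1 : Summable fun k => ‖f k - g k‖ :=
    Summable.of_nonneg_of_le (fun k => norm_nonneg _) (fun k => norm_sub_le _ _) (hf.add hg)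
  have h2 := laurent_unique h1 (fun l hl => by
    have h3 := h ⟨l, by simpa [Submonoid.unitSphere] using hl⟩
    simp_rw [sub_mul]
    rw [(summable_mul_zpow hf ⟨l, by simpa [Submonoid.unitSphere] using hl⟩).tsum_sub
      (summable_mul_zpow hg ⟨l, by simpa [Submonoid.unitSphere] using hl⟩), h3, sub_self])
  funext k
  exact sub_eq_zero.1 (congrFun h2 k)

theorem coeff_eq_of_eval {T : Wiener ρ} {f : ℤ → ℂ} (hf : Summable fun k => ‖f k‖)
    (h : ∀ l : Circle, eval l T = ∑' k, f k * (l : ℂ) ^ k) : T.coeff = f :=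
  eq_of_hasSum T.summable_coeff hf fun l => by rw [← eval_eq_tsum, h]

/-- Laurent coefficients are stored multiplied by ρ^|k|, so a shift by d costs the ratio of two
weights, at most ρ. The bound ‖λ‖ ≤ ρ is what lets power series in W ρ converge in the Wiener
algebra. -/
theorem norm_shift_le {d : ℤ} (hd : d.natAbs ≤ 1) (k : ℤ) :
    ‖(((ρ ^ (k + d).natAbs : ℝ) : ℂ) / ((ρ ^ k.natAbs : ℝ) : ℂ)) •
      (lp.single 1 (k + d) 1 : Laurent)‖ ≤ ρ := by
  rw [norm_smul, lp.norm_single (by simp), norm_one, mul_one, norm_div, Complex.norm_real,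
    Complex.norm_real, Real.norm_eq_abs, Real.norm_eq_abs, abs_of_pos (weight_pos ρ _),
    abs_of_pos (weight_pos ρ _), div_le_iff₀ (weight_pos ρ k), ← pow_succ']
  exact pow_le_pow_right₀ hρ.out.le (by omega)

/-- The shift `f ↦ λ^d f` of Laurent series, for `|d| ≤ 1`. -/
def shift (ρ : ℝ) [Fact (1 < ρ)] {d : ℤ} (hd : d.natAbs ≤ 1) : Laurent →L[ℂ] Laurent :=
  lpLift _ ρ (norm_shift_le (ρ := ρ) hd)

theorem circleEval_shift {d : ℤ} (hd : d.natAbs ≤ 1) (l : Circle) (x : Laurent) :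
    circleEval ρ l (shift ρ hd x) = (l : ℂ) ^ d * circleEval ρ l x := by
  rw [← ContinuousLinearMap.comp_apply, ← smul_eq_mul, ← smul_apply]
  congr 1
  refine lp_clm_ext fun k => ?_
  have h1 : ((ρ ^ (k + d).natAbs : ℝ) : ℂ) ≠ 0 := Complex.ofReal_ne_zero.2 (weight_pos ρ _).ne'
  rw [ContinuousLinearMap.comp_apply, shift, lpLift_single, map_smul, circleEval_single, smul_apply,
    circleEval_single, zpow_add₀ (Circle.coe_ne_zero l), smul_eq_mul, smul_eq_mul]
  field_simp

/-- The monomial `λ^d`, for `|d| ≤ 1`. -/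
def monomial {d : ℤ} (hd : d.natAbs ≤ 1) : Wiener ρ :=
  ⟨shift ρ hd, fun l x => by
    rw [circleEval_shift, circleEval_shift, circleEval_one, mul_one]⟩

theorem eval_monomial {d : ℤ} (hd : d.natAbs ≤ 1) (l : Circle) :
    eval l (monomial hd : Wiener ρ) = (l : ℂ) ^ d := by
  have := circleEval_shift (ρ := ρ) hd l (lp.single 1 0 1)
  rw [circleEval_one, mul_one] at this
  exact this

theorem norm_monomial_le {d : ℤ} (hd : d.natAbs ≤ 1) : ‖(monomial hd : Wiener ρ)‖ ≤ ρ :=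
  norm_lpLift_le _ ρ (zero_le_one.trans hρ.out.le) (norm_shift_le hd)

/-- The loop parameter `λ`. -/
def lam : Wiener ρ := monomial (d := 1) (by simp)

/-- The inverse `λ⁻¹` of the loop parameter. -/
def lamInv : Wiener ρ := monomial (d := -1) (by simp)

@[simp] theorem eval_lam (l : Circle) : eval l (lam : Wiener ρ) = l := by
  rw [lam, eval_monomial, zpow_one]

@[simp] theorem eval_lamInv (l : Circle) : eval l (lamInv : Wiener ρ) = (l : ℂ)⁻¹ := by
  rw [lamInv, eval_monomial, zpow_neg_one]

theorem norm_smul_lam_pow_le (j k : ℕ) : ‖((-1 : ℂ) ^ j • (lam : Wiener ρ)) ^ k‖ ≤ |ρ| ^ k := by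
  have hρ' : |ρ| = ρ := abs_of_pos (zero_lt_one.trans hρ.out)
  rcases Nat.eq_zero_or_pos k with rfl | hk
  · rw [pow_zero, pow_zero]
    exact ContinuousLinearMap.norm_id_le
  · refine (norm_pow_le' _ hk).trans (pow_le_pow_left₀ (norm_nonneg _) ?_ k)
    rw [norm_smul, norm_pow, norm_neg, norm_one, one_pow, one_mul, hρ']
    exact norm_monomial_le _

/-- The power series `f((-1)ʲ λ)` as an element of the Wiener algebra. -/
def ofW (j : ℕ) : W ρ →L[ℝ] Wiener ρ :=
  W.lift (fun k => ((-1 : ℂ) ^ j • (lam : Wiener ρ)) ^ k) (norm_smul_lam_pow_le j)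

theorem eval_ofW (j : ℕ) (f : W ρ) (l : Circle) :
    eval l (ofW j f) = f.eval ((-1) ^ j * l) := by
  have h := (W.summable_lift (norm_smul_lam_pow_le (ρ := ρ) j) f).hasSum
  rw [← W.lift_apply _ (norm_smul_lam_pow_le (ρ := ρ) j)] at h
  have h1 := (h.mapL ((evalL (ρ := ρ) l).restrictScalars ℝ)).tsum_eq
  change _ = eval l (ofW j f) at h1
  rw [← h1, W.eval]
  refine tsum_congr fun k => ?_
  rw [map_smul]
  change f.coeff k • eval l _ = _
  rw [map_pow, map_smul, eval_lam, Complex.real_smul, smul_eq_mul]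

theorem injective_mul_natCast {e : ℤ} (he : e.natAbs = 1) :
    Function.Injective fun k : ℕ => e * (k : ℤ) := by
  intro a b h
  have : (e * (a : ℤ)).natAbs = (e * (b : ℤ)).natAbs := congrArg _ h
  simpa [Int.natAbs_mul, he] using this

theorem abs_re_coeff_mul_le {e : ℤ} (he : e.natAbs = 1) (T : Wiener ρ) (k : ℕ) :
    |(T.coeff (e * k)).re| * |ρ| ^ k ≤ ‖toLaurent T (e * k)‖ := by
  rw [coeff, Int.natAbs_mul, he, one_mul, Int.natAbs_natCast, abs_of_pos (zero_lt_one.trans hρ.out),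
    Complex.div_ofReal_re, abs_div, abs_of_pos (pow_pos (zero_lt_one.trans hρ.out) k),
    div_mul_cancel₀ _ (pow_pos (zero_lt_one.trans hρ.out) k).ne']
  exact Complex.abs_re_le_norm _

theorem summable_part (e : ℤ) (he : e.natAbs = 1) (T : Wiener ρ) :
    Summable fun k : ℕ => |(T.coeff (e * k)).re| * |ρ| ^ k := by
  exact Summable.of_nonneg_of_le (fun k => by positivity) (fun k => abs_re_coeff_mul_le he T k)
    ((summable_norm_lp_one (toLaurent T)).comp_injective (injective_mul_natCast he))

/-- The real parts of the Laurent coefficients of index `0, e, 2e, …`, for `e = ±1`. -/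
def part (e : ℤ) (he : e.natAbs = 1) : Wiener ρ →L[ℝ] W ρ :=
  LinearMap.mkContinuous
    { toFun := fun T => ⟨fun k => (T.coeff (e * k)).re, summable_part e he T⟩
      map_add' := fun S T => by
        refine W.ext fun k => ?_
        change (coeff (S + T) (e * k)).re = (coeff S (e * k)).re + (coeff T (e * k)).re
        rw [← Complex.add_re, coeff, coeff, coeff, ← add_div, map_add]
        rfl
      map_smul' := fun c T => by
        refine W.ext fun k => ?_
        change (coeff (c • T) (e * k)).re = c * (coeff T (e * k)).re
        have : coeff (c • T) (e * k) = (c : ℂ) * coeff T (e * k) := by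
          rw [coeff, coeff, ← mul_div_assoc]
          have h := map_smul (toLaurent (ρ := ρ)) (c : ℂ) T
          change toLaurent ((c : ℂ) • T) _ / _ = _
          rw [h]; rfl
        rw [this, Complex.re_ofReal_mul] } 1 (fun T => by
    rw [one_mul]
    refine le_trans ?_ (norm_toLaurent_le T)
    rw [W.norm_def, norm_lp_one]
    refine le_trans ?_ (tsum_comp_le_tsum_of_inj (summable_norm_lp_one (toLaurent T))
      (fun _ => norm_nonneg _) (injective_mul_natCast he))
    exact (summable_part e he T).tsum_le_tsum (fun k => abs_re_coeff_mul_le he T k)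
      ((summable_norm_lp_one (toLaurent T)).comp_injective (injective_mul_natCast he)))

theorem coeff_part (e : ℤ) (he : e.natAbs = 1) (T : Wiener ρ) (k : ℕ) :
    (part e he T).coeff k = (T.coeff (e * k)).re := rfl

end Wiener

end LawsonDPW

namespace LawsonDPW

open unitInterval

/-! ### Matrix loops -/

/-- `2 × 2` matrices with entries in the Wiener algebra. -/
def LoopMat (ρ : ℝ) [Fact (1 < ρ)] : Type := Matrix (Fin 2) (Fin 2) (Wiener ρ)

namespace LoopMat

variable {ρ : ℝ} [hρ : Fact (1 < ρ)]

instance : NormedRing (LoopMat ρ) :=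
  Matrix.linftyOpNormedRing (n := Fin 2) (α := Wiener ρ)

instance : NormedAlgebra ℂ (LoopMat ρ) :=
  Matrix.linftyOpNormedAlgebra (n := Fin 2) (α := Wiener ρ) (R := ℂ)

instance : CompleteSpace (LoopMat ρ) :=
  inferInstanceAs (CompleteSpace (Matrix (Fin 2) (Fin 2) (Wiener ρ)))

theorem norm_def (A : LoopMat ρ) :
    ‖A‖ = ((Finset.univ.sup fun i : Fin 2 => ∑ j : Fin 2, ‖(A i j : Wiener ρ)‖₊ : NNReal) : ℝ) :=
  Matrix.linfty_opNorm_def (α := Wiener ρ) A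

theorem norm_apply_le (A : LoopMat ρ) (i j : Fin 2) : ‖(A i j : Wiener ρ)‖ ≤ ‖A‖ := by
  rw [norm_def, ← coe_nnnorm, NNReal.coe_le_coe]
  refine le_trans ?_ (Finset.le_sup (f := fun i : Fin 2 => ∑ j : Fin 2, ‖(A i j : Wiener ρ)‖₊)
    (Finset.mem_univ i))
  exact Finset.single_le_sum (f := fun j => ‖(A i j : Wiener ρ)‖₊) (fun _ _ => zero_le)
    (Finset.mem_univ j)

/-- The entry of index `(i, j)`. -/
def entry (i j : Fin 2) : LoopMat ρ →L[ℂ] Wiener ρ :=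
  LinearMap.mkContinuous ⟨⟨fun A => A i j, fun _ _ => rfl⟩, fun _ _ => rfl⟩ 1
    (fun A => by rw [one_mul]; exact A.norm_apply_le i j)

/-- The matrix with a single entry. -/
def single (i j : Fin 2) : Wiener ρ →L[ℂ] LoopMat ρ :=
  LinearMap.mkContinuous
    ⟨⟨fun f => Matrix.single i j f, fun f g => Matrix.single_add i j f g⟩,
      fun c f => (Matrix.smul_single c i j f).symm⟩ 1
    (fun f => by
      rw [one_mul, norm_def, ← coe_nnnorm, NNReal.coe_le_coe]
      refine Finset.sup_le fun a _ => ?_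
      change ∑ b, ‖Matrix.single i j f a b‖₊ ≤ _
      rw [Finset.sum_eq_single j]
      · by_cases h : i = a
        · subst h; simp
        · simp [h]
      · intro b _ hb
        simp [hb.symm]
      · simp)

/-- Evaluation at a point of the unit circle. -/
def eval (l : Circle) : LoopMat ρ →ₐ[ℂ] Mat := (Wiener.eval (ρ := ρ) l).mapMatrix

theorem eval_apply (l : Circle) (A : LoopMat ρ) (i j : Fin 2) :
    eval l A i j = Wiener.eval l (entry i j A) := rfl

theorem norm_eval_apply_le (l : Circle) (A : LoopMat ρ) (i j : Fin 2) : ‖eval l A i j‖ ≤ ‖A‖ :=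
  (Wiener.norm_eval_le l _).trans (A.norm_apply_le i j)

/-- An entry of the value at a point of the unit circle. -/
def evalEntry (l : Circle) (i j : Fin 2) : LoopMat ρ →L[ℂ] ℂ := (Wiener.evalL l).comp (entry i j)

theorem evalEntry_apply (l : Circle) (i j : Fin 2) (A : LoopMat ρ) :
    evalEntry l i j A = eval l A i j := rfl

theorem eval_single (l : Circle) (i j : Fin 2) (f : Wiener ρ) :
    eval l (single i j f) = Matrix.single i j (Wiener.eval l f) := by
  change (Matrix.single i j f).map (Wiener.eval l) = _
  rw [Matrix.map_single]

end LoopMat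

/-! ### The residues -/

theorem matD_sq (m : ℕ) :
    Complex.exp (Complex.I * Real.pi * m / (2 * m + 2)) ^ 2 = puncture m 1 ^ m := by
  rw [puncture, ← Complex.exp_nat_mul, ← Complex.exp_nat_mul]
  congr 1
  push_cast
  ring

theorem matD_conj (m : ℕ) (a b c d : ℂ) :
    (matD m)⁻¹ * !![a, b; c, d] * matD m =
      !![a, (puncture m 1 ^ m)⁻¹ * b; puncture m 1 ^ m * c, d] := by
  set e := Complex.exp (Complex.I * Real.pi * m / (2 * m + 2)) with he
  have h0 : e ≠ 0 := Complex.exp_ne_zero _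
  have hD : matD m = !![e, 0; 0, e⁻¹] := by rw [matD, Complex.exp_neg]
  have hinv : (matD m)⁻¹ = !![e⁻¹, 0; 0, e] := by
    refine Matrix.inv_eq_left_inv ?_
    rw [hD, Matrix.mul_fin_two, Matrix.one_fin_two]
    simp [h0]
  rw [hinv, hD, ← matD_sq, ← he, Matrix.mul_fin_two, Matrix.mul_fin_two]
  ext i j
  fin_cases i <;> fin_cases j <;> simp <;> field_simp

/-- Conjugation by D scales the off-diagonal entries by p_1^{∓m}, hence by p_j^{∓m} after j steps;
the factors λ^{±1} contribute the sign (-1)ʲ. -/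
theorem matA_eq {ρ : ℝ} (m : ℕ) (x : Params ρ) (j : ℕ) (l : ℂ) :
    matA m x j l = !![x.2.1.eval ((-1) ^ j * l),
      (puncture m j ^ m)⁻¹ * ((-1) ^ j * (l⁻¹ * x.2.2.1.eval ((-1) ^ j * l)));
      puncture m j ^ m * ((-1) ^ j * (l * x.2.2.2.eval ((-1) ^ j * l))),
      -x.2.1.eval ((-1) ^ j * l)] := by
  induction j generalizing l with
  | zero => simp [matA, puncture_zero]
  | succ j ih =>
    rw [matA, ih, matD_conj]
    have e : (-1 : ℂ) ^ j * -l = (-1) ^ (j + 1) * l := by ring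
    have hp := puncture_succ m j
    rw [e, hp, mul_pow, mul_inv, inv_neg]
    congr 1
    ext i k
    fin_cases i <;> fin_cases k <;> simp <;> ring

section Residue

variable {ρ : ℝ} [hρ : Fact (1 < ρ)]

/-- Multiplication by a fixed element, as a real linear map. -/
def mulLeftR {𝒜 : Type*} [NormedRing 𝒜] [NormedAlgebra ℂ 𝒜] (T : 𝒜) : 𝒜 →L[ℝ] 𝒜 :=
  (ContinuousLinearMap.mul ℂ 𝒜 T).restrictScalars ℝ

/-- The residue `A_j` as a matrix loop. -/
def residue (m j : ℕ) : Params ρ →L[ℝ] LoopMat ρ :=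
  let a : Params ρ →L[ℝ] W ρ := (ContinuousLinearMap.fst ℝ _ _).comp (ContinuousLinearMap.snd ℝ _ _)
  let b : Params ρ →L[ℝ] W ρ := (ContinuousLinearMap.fst ℝ _ _).comp
    ((ContinuousLinearMap.snd ℝ _ _).comp (ContinuousLinearMap.snd ℝ _ _))
  let c : Params ρ →L[ℝ] W ρ := (ContinuousLinearMap.snd ℝ _ _).comp
    ((ContinuousLinearMap.snd ℝ _ _).comp (ContinuousLinearMap.snd ℝ _ _))
  ((LoopMat.single 0 0).restrictScalars ℝ).comp ((Wiener.ofW j).comp a) +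
  ((LoopMat.single 0 1).restrictScalars ℝ).comp
    ((mulLeftR (((puncture m j ^ m)⁻¹ * (-1) ^ j) • Wiener.lamInv)).comp ((Wiener.ofW j).comp b)) +
  ((LoopMat.single 1 0).restrictScalars ℝ).comp
    ((mulLeftR ((puncture m j ^ m * (-1) ^ j) • Wiener.lam)).comp ((Wiener.ofW j).comp c)) +
  ((LoopMat.single 1 1).restrictScalars ℝ).comp ((mulLeftR (-1)).comp ((Wiener.ofW j).comp a))

theorem residue_apply (m j : ℕ) (x : Params ρ) : residue m j x =
    LoopMat.single 0 0 (Wiener.ofW j x.2.1) +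
    LoopMat.single 0 1 ((((puncture m j ^ m)⁻¹ * (-1) ^ j) • Wiener.lamInv) * Wiener.ofW j x.2.2.1) +
    LoopMat.single 1 0 (((puncture m j ^ m * (-1) ^ j) • Wiener.lam) * Wiener.ofW j x.2.2.2) +
    LoopMat.single 1 1 (-1 * Wiener.ofW j x.2.1) := rfl

theorem eval_residue (m j : ℕ) (x : Params ρ) (l : Circle) :
    LoopMat.eval l (residue m j x) = matA m x j l := by
  rw [residue_apply, matA_eq, map_add, map_add, map_add, LoopMat.eval_single, LoopMat.eval_single,
    LoopMat.eval_single, LoopMat.eval_single, map_mul, map_mul, map_mul, map_neg, map_one, map_smul,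
    map_smul,    Wiener.eval_ofW, Wiener.eval_ofW, Wiener.eval_ofW, Wiener.eval_lam, Wiener.eval_lamInv]
  ext i k
  fin_cases i <;> fin_cases k <;> simp [Matrix.single] <;> ring

end Residue

/-! ### The gauged potential along the loop -/

/-- The function `s ↦ u(s) E` for a scalar function `u` and a fixed `E`. -/
def Path.tensor {𝒜 : Type*} [NormedRing 𝒜] [NormedAlgebra ℂ 𝒜] (u : Path ℂ) :
    𝒜 →L[ℂ] Path 𝒜 :=
  LinearMap.mkContinuous
    { toFun := fun E => (⟨fun s => u s • E, u.continuous.smul continuous_const⟩ : C(I, 𝒜))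
      map_add' := fun E F => Path.ext fun s => smul_add (u s) E F
      map_smul' := fun c E => Path.ext fun s => smul_comm (u s) c E } ‖u‖ (fun E => by
    refine Path.norm_le _ (by positivity) fun s => ?_
    change ‖u s • E‖ ≤ _
    rw [norm_smul]
    exact mul_le_mul_of_nonneg_right (u.norm_apply_le s) (norm_nonneg _))

section Tensor

variable {𝒜 : Type*} [NormedRing 𝒜] [NormedAlgebra ℂ 𝒜]

theorem Path.tensor_apply (u : Path ℂ) (E : 𝒜) (s : I) : Path.tensor u E s = u s • E := rfl

theorem Path.tensor_mul (u v : Path ℂ) (E F : 𝒜) :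
    Path.tensor u E * Path.tensor v F = Path.tensor (u * v) (E * F) :=
  Path.ext fun s => by
    rw [Path.mul_apply, Path.tensor_apply, Path.tensor_apply, Path.tensor_apply, Path.mul_apply,
      smul_mul_smul_comm]

theorem Path.sum_smul_tensor {ι : Type*} (t : Finset ι) (c : ι → ℂ) (u : ι → Path ℂ) (E : 𝒜) :
    ∑ j ∈ t, Path.tensor (u j) (c j • E) = Path.tensor (∑ j ∈ t, c j • u j) E :=
  Path.ext fun s => by
    rw [Path.sum_apply, Path.tensor_apply, Path.sum_apply, Finset.sum_smul]
    refine Finset.sum_congr rfl fun j _ => ?_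
    rw [Path.tensor_apply, Path.smul_apply, smul_smul, smul_eq_mul, mul_comm]

variable [CompleteSpace 𝒜]

theorem volterra_tensor (u : Path ℂ) (E : 𝒜) :
    volterra 𝒜 (Path.tensor u E) = Path.tensor (volterra ℂ u) E :=
  Path.ext fun s => by
    rw [Path.tensor_apply, volterra_apply, volterra_apply, ← intervalIntegral.integral_smul_const]
    rfl

theorem totalIntegral_tensor (u : Path ℂ) (E : 𝒜) :
    totalIntegral 𝒜 (Path.tensor u E) = totalIntegral ℂ u • E := by
  rw [totalIntegral_apply, volterra_tensor]
  rfl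

end Tensor

/-! ### Uniqueness of the continuation -/

theorem continuous_potential (m : ℕ) (t : ℝ) {ρ : ℝ} (x : Params ρ) (l : ℂ) (i j : Fin 2) :
    Continuous fun s => potential m t x l (loop m s) i j := by
  have h1 := continuous_loop m
  have h2 : ∀ p, Continuous fun s => (loop m s - puncture m p)⁻¹ := fun p =>
    (h1.sub continuous_const).inv₀ fun s => sub_ne_zero.2 (loop_ne_puncture m p s)
  simp only [potential, Matrix.add_apply, Matrix.smul_apply, Matrix.sum_apply, smul_eq_mul]
  refine Continuous.add ?_ (continuous_const.mul (continuous_finsetSum _ fun p _ =>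
    (h2 p).mul continuous_const))
  fin_cases i <;> fin_cases j <;> simp <;> fun_prop

theorem linear_ode_of_isSolutionAlong {η : ℂ → Mat} {γ : ℝ → ℂ} {Y : ℝ → Mat}
    (h : IsSolutionAlong η γ Y) : ∀ s ∈ Set.Icc (0 : ℝ) 1, ∀ i j,
      HasDerivWithinAt (fun u => Y u i j) ((Y s * (deriv γ s • η (γ s))) i j) (Set.Icc 0 1) s := by
  intro s hs i j
  rw [mul_smul_comm, Matrix.smul_apply, smul_eq_mul]
  exact h.2 s hs i j

theorem continuousOn_potential (m : ℕ) (t : ℝ) {ρ : ℝ} (x : Params ρ) (l : ℂ) (i j : Fin 2) :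
    ContinuousOn (fun s => (deriv (loop m) s • potential m t x l (loop m s)) i j)
      (Set.Icc 0 1) :=
  ((continuous_deriv_loop m).mul (continuous_potential m t x l i j)).continuousOn

/-- The monodromy is defined through an arbitrarily chosen solution; uniqueness replaces it by any
explicit one. -/
theorem M_eq_of_isSolutionAlong {m : ℕ} {t : ℝ} {ρ : ℝ} {x : Params ρ} {l : ℂ} {Y : ℝ → Mat}
    (h : IsSolutionAlong (potential m t x l) (loop m) Y) : M m t x l = Y 1 := by
  have hex : ∃ Y, IsSolutionAlong (potential m t x l) (loop m) Y := ⟨Y, h⟩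
  rw [M, monodromy, dif_pos hex]
  exact linear_ode_unique (continuousOn_potential m t x l)
    (linear_ode_of_isSolutionAlong hex.choose_spec) (linear_ode_of_isSolutionAlong h)
    (hex.choose_spec.1.trans h.1.symm) (Set.right_mem_Icc.2 zero_le_one)

section Gauge

variable {ρ : ℝ} [hρ : Fact (1 < ρ)]

/-- The lower triangular nilpotent matrix. -/
def nilp : LoopMat ρ := LoopMat.single 1 0 1

/-- The potential along the loop after gauging by the solution for `t = 0`. -/
def gaugedPotential (m : ℕ) (x : Params ρ) : Path (LoopMat ρ) :=
  ∑ j ∈ Finset.range (2 * m + 2),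
    (Path.tensor (loopForm m j 0) (residue m j x) +
      Path.tensor (loopForm m j m)
        ((x.1 : ℂ) • (nilp * residue m j x - residue m j x * nilp)) -
      Path.tensor (loopForm m j (2 * m)) (((x.1 : ℂ) ^ 2) • (nilp * residue m j x * nilp)))

/-- The solution for `t = 0`. -/
def gauge (m : ℕ) (r : ℝ) (z : ℂ) : Mat := !![1, 0; r * z ^ m, 1]

theorem eval_nilp (l : Circle) : LoopMat.eval l (nilp : LoopMat ρ) = !![0, 0; 1, 0] := by
  rw [nilp, LoopMat.eval_single, map_one]
  ext i j
  fin_cases i <;> fin_cases j <;> simp [Matrix.single]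

/-- With g = 1 + r zᵐ N and N² = 0 one has g A g⁻¹ = A + r zᵐ (N A - A N) - r² z^{2m} N A N, which
are the three kinds of terms in `gaugedPotential`. The form B g = g A avoids the inverse of g. -/
theorem eval_gaugedPotential_mul (m : ℕ) (x : Params ρ) (l : Circle) (s : I) :
    LoopMat.eval l (gaugedPotential m x s) * gauge m x.1 (loop m s) =
      deriv (loop m) s • (gauge m x.1 (loop m s) * ∑ j ∈ Finset.range (2 * m + 2),
        (loop m s - puncture m j)⁻¹ • matA m x j l) := by
  rw [gaugedPotential, Path.sum_apply, map_sum, Finset.sum_mul, Finset.mul_sum, Finset.smul_sum]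
  refine Finset.sum_congr rfl fun j _ => ?_
  have e : ((Path.tensor (loopForm m j 0) (residue m j x) +
      Path.tensor (loopForm m j m)
        ((x.1 : ℂ) • (nilp * residue m j x - residue m j x * nilp)) -
      Path.tensor (loopForm m j (2 * m)) (((x.1 : ℂ) ^ 2) • (nilp * residue m j x * nilp)) : Path (LoopMat ρ))) s =
      loopForm m j 0 s • residue m j x +
      loopForm m j m s • ((x.1 : ℂ) • (nilp * residue m j x - residue m j x * nilp)) -
      loopForm m j (2 * m) s • (((x.1 : ℂ) ^ 2) • (nilp * residue m j x * nilp)) := rfl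
  rw [e]
  simp only [map_sub, map_add, map_smul, map_mul, eval_nilp, eval_residue, loopForm_apply]
  generalize matA m x j l = A
  rw [Matrix.eta_fin_two A, gauge]
  generalize deriv (loop m) s = d
  generalize (loop m s - puncture m j)⁻¹ = q
  ext i k
  fin_cases i <;> fin_cases k <;> simp [Matrix.mul_apply, Fin.sum_univ_two] <;> ring

theorem hasDerivAt_gauge (m : ℕ) (r : ℝ) (s : ℝ) (i j : Fin 2) :
    HasDerivAt (fun s => gauge m r (loop m s) i j)
      (deriv (loop m) s * (gauge m r (loop m s) *
        !![0, 0; m * r * loop m s ^ (m - 1), 0]) i j) s := by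
  have h := ((hasDerivAt_loop m s).differentiableAt.hasDerivAt.pow m).const_mul (r : ℂ)
  fin_cases i <;> fin_cases j <;> simp [gauge, Matrix.mul_apply, Fin.sum_univ_two]
  · exact hasDerivAt_const _ _
  · exact hasDerivAt_const _ _
  · convert! h using 1
    ring
  · exact hasDerivAt_const _ _

theorem gauge_zero {m : ℕ} (hm : 1 ≤ m) (r : ℝ) : gauge m r 0 = 1 := by
  rw [gauge, zero_pow (by omega), mul_zero, Matrix.one_fin_two]

/-- Product rule: (U g)' = t U B g + U g', where B g = g ∑ A_j dz/(z - p_j) and g' is g times the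
potential for t = 0, both pulled back to the loop. -/
theorem isSolutionAlong_transport {m : ℕ} (hm : 1 ≤ m) (t : ℝ) (x : Params ρ) (l : Circle)
    (h : ‖(t : ℂ) • transportOp (LoopMat ρ) (gaugedPotential m x)‖ < 1) :
    IsSolutionAlong (potential m t x l) (loop m) fun s =>
      LoopMat.eval l (Set.IccExtend zero_le_one (transport (t : ℂ) (gaugedPotential m x)) s) *
        gauge m x.1 (loop m s) := by
  set B := gaugedPotential m x with hB
  set U := transport (t : ℂ) B with hU
  refine ⟨?_, fun s hs i j => ?_⟩
  · have h0 : Set.IccExtend zero_le_one U (0 : ℝ) = 1 := by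
      rw [Set.IccExtend_of_mem zero_le_one U (Set.left_mem_Icc.2 zero_le_one)]
      exact transport_zero h
    beta_reduce
    rw [h0, map_one, one_mul, loop_zero, gauge_zero hm]
  · have hUd := hasDerivWithinAt_transport h hs
    have hU' : ∀ k, HasDerivWithinAt
        (fun u => LoopMat.eval l (Set.IccExtend zero_le_one U u) i k)
        (LoopMat.eval l ((t : ℂ) • (U ⟨s, hs⟩ * B ⟨s, hs⟩)) i k) (Set.Icc 0 1) s := fun k =>
      ((LoopMat.evalEntry l i k).restrictScalars ℝ).hasFDerivAt.comp_hasDerivWithinAt s hUd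
    have hprod : HasDerivWithinAt (fun u => ∑ k,
        LoopMat.eval l (Set.IccExtend zero_le_one U u) i k * gauge m x.1 (loop m u) k j)
        (∑ k, (LoopMat.eval l ((t : ℂ) • (U ⟨s, hs⟩ * B ⟨s, hs⟩)) i k *
          gauge m x.1 (loop m s) k j + LoopMat.eval l (Set.IccExtend zero_le_one U s) i k *
          (deriv (loop m) s * (gauge m x.1 (loop m s) *
            !![0, 0; m * x.1 * loop m s ^ (m - 1), 0]) k j))) (Set.Icc 0 1) s :=
      HasDerivWithinAt.fun_sum fun k _ => (hU' k).mul (hasDerivAt_gauge m x.1 s k j).hasDerivWithinAt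
    convert! hprod using 1
    change deriv (loop m) s * (LoopMat.eval l (Set.IccExtend zero_le_one U s) *
      gauge m x.1 (loop m s) * potential m t x l (loop m s)) i j = _
    rw [Set.IccExtend_of_mem zero_le_one U hs]
    have key : (t : ℂ) • (LoopMat.eval l (U ⟨s, hs⟩) * LoopMat.eval l (B ⟨s, hs⟩)) *
        gauge m x.1 (loop m s) + LoopMat.eval l (U ⟨s, hs⟩) * (deriv (loop m) s •
          (gauge m x.1 (loop m s) * !![0, 0; m * x.1 * loop m s ^ (m - 1), 0])) =
        deriv (loop m) s • (LoopMat.eval l (U ⟨s, hs⟩) * gauge m x.1 (loop m s) *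
          potential m t x l (loop m s)) := by
      have h1 := eval_gaugedPotential_mul m x l ⟨s, hs⟩
      rw [smul_mul_assoc, mul_assoc, hB, h1, potential, mul_add, smul_add, add_comm]
      simp only [mul_smul_comm, mul_assoc]
      rw [smul_comm]
    have key' := congrFun (congrFun key i) j
    rw [Matrix.smul_apply, smul_eq_mul] at key'
    rw [← key', Finset.sum_add_distrib, map_smul, map_mul]
    rfl

theorem M_eq {m : ℕ} (hm : 1 ≤ m) {t : ℝ} {x : Params ρ} (l : Circle)
    (h : ‖(t : ℂ) • transportOp (LoopMat ρ) (gaugedPotential m x)‖ < 1) :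
    M m t x l = 1 + (t : ℂ) • LoopMat.eval l (transportQuot (t : ℂ) (gaugedPotential m x)) := by
  rw [M_eq_of_isSolutionAlong (isSolutionAlong_transport hm t x l h),
    Set.IccExtend_of_mem zero_le_one _ (Set.right_mem_Icc.2 zero_le_one), loop_one]
  have h1 := transport_one h
  rw [gauge_zero hm, mul_one]
  change LoopMat.eval l (transport _ _ 1) = _
  rw [h1, map_add, map_one, map_smul]

end Gauge

end LawsonDPW

namespace LawsonDPW

open unitInterval

/-! ### The logarithm of the monodromy -/

section MatLog

open scoped Matrix.Norms.Operator

/-- The norm is the largest row sum and a row has two entries; hence the bound 1/2 in `IsSmall`,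
while the logarithm series needs norm less than 1. -/
theorem norm_mat_lt_one {X : Mat} (hX : ∀ i j, ‖X i j‖ < 1 / 2) : ‖X‖ < 1 := by
  rw [Matrix.linfty_opNorm_def, ← NNReal.coe_one, NNReal.coe_lt_coe, Finset.sup_lt_iff (by simp)]
  intro i _
  rw [Fin.sum_univ_two, ← NNReal.coe_lt_coe]
  push_cast
  linarith [hX i 0, hX i 1]

theorem matLog_one_add_eq {X : Mat} (hX : ∀ i j, ‖X i j‖ < 1 / 2) :
    matLog (1 + X) = X * logQuot X := by
  rw [mul_logQuot_eq_tsum (norm_mat_lt_one hX), matLog]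
  simp only [add_sub_cancel_left]
  rfl

theorem hasSum_matLog {X : Mat} (hX : ∀ i j, ‖X i j‖ < 1 / 2) :
    HasSum (fun k : ℕ => ((-1) ^ k / ((k : ℂ) + 1)) • X ^ (k + 1)) (matLog (1 + X)) := by
  have h := (summable_logQuot (norm_mat_lt_one hX)).hasSum.mul_left X
  rw [matLog_one_add_eq hX]
  simp_rw [pow_succ', ← mul_smul_comm]
  exact h

theorem matLog_of_mul_eq_one {X Z : Mat} (hX : ∀ i j, ‖X i j‖ < 1 / 2)
    (hZ : ∀ i j, ‖Z i j‖ < 1 / 2) (h : (1 + X) * (1 + Z) = 1) :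
    matLog (1 + Z) = -matLog (1 + X) := by
  rw [matLog_one_add_eq hX, matLog_one_add_eq hZ,
    mul_logQuot_inverse (norm_mat_lt_one hX) (norm_mat_lt_one hZ) h]

end MatLog

/-- Complex conjugation of the entries of a matrix. -/
def matConj : Mat →+* Mat := (starRingEnd ℂ).mapMatrix

theorem matConj_apply (X : Mat) (i j : Fin 2) : matConj X i j = starRingEnd ℂ (X i j) := rfl

theorem matConj_smul (c : ℂ) (X : Mat) : matConj (c • X) = starRingEnd ℂ c • matConj X := by
  ext i j
  simp [matConj_apply]

theorem matLog_matConj {X : Mat} (hX : ∀ i j, ‖X i j‖ < 1 / 2) :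
    matLog (1 + matConj X) = matConj (matLog (1 + X)) := by
  have hc : Continuous matConj := continuous_id.matrix_map Complex.continuous_conj
  have h1 := (hasSum_matLog hX).map matConj hc
  have h2 := hasSum_matLog (X := matConj X) (fun i j => by
    rw [matConj_apply, RCLike.norm_conj]; exact hX i j)
  refine h2.unique ?_
  convert! h1 using 1
  funext k
  simp only [Function.comp_apply, matConj_smul, map_pow]
  simp

section Mtilde

variable {ρ : ℝ} [hρ : Fact (1 < ρ)]

/-- The logarithm of the monodromy divided by `2πi t`, as a matrix of elements of the Wiener
algebra. -/
def logMonodromy (m : ℕ) (t : ℝ) (x : Params ρ) : LoopMat ρ :=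
  (2 * Real.pi * Complex.I : ℂ)⁻¹ • logTransport (t : ℂ) (gaugedPotential m x)

/-- `(t, x)` is so small that the series for the monodromy and its logarithm converge. -/
def IsSmall (m : ℕ) (t : ℝ) (x : Params ρ) : Prop :=
  ‖(t : ℂ) • transportOp (LoopMat ρ) (gaugedPotential m x)‖ < 1 ∧
    ‖(t : ℂ) • transportQuot (t : ℂ) (gaugedPotential m x)‖ < 1 / 2

theorem IsSmall.norm_lt {m : ℕ} {t : ℝ} {x : Params ρ} (h : IsSmall m t x) (l : Circle)
    (i j : Fin 2) :
    ‖((t : ℂ) • LoopMat.eval l (transportQuot (t : ℂ) (gaugedPotential m x))) i j‖ < 1 / 2 := by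
  rw [← map_smul]
  exact (LoopMat.norm_eval_apply_le l _ i j).trans_lt h.2

theorem matLog_M {m : ℕ} (hm : 1 ≤ m) {t : ℝ} {x : Params ρ} (h : IsSmall m t x) (l : Circle) :
    matLog (M m t x l) =
      (t : ℂ) • LoopMat.eval l (logTransport (t : ℂ) (gaugedPotential m x)) := by
  rw [M_eq hm l h.1]
  set Q := transportQuot (t : ℂ) (gaugedPotential m x) with hQ
  have hn : ‖(t : ℂ) • Q‖ < 1 := h.2.trans (by norm_num)
  have h1 := hasSum_matLog (h.norm_lt l)
  have h2 := (summable_logQuot hn).hasSum.mul_left ((t : ℂ) • Q)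
  ext i j
  have h3 := h2.mapL (LoopMat.evalEntry l i j)
  have h4 : HasSum (fun k : ℕ => (((-1) ^ k / ((k : ℂ) + 1)) •
      ((t : ℂ) • LoopMat.eval l Q) ^ (k + 1)) i j)
      (matLog (1 + (t : ℂ) • LoopMat.eval l Q) i j) :=
    (Pi.hasSum.1 (Pi.hasSum.1 h1 i)) j
  refine h4.unique ?_
  convert! h3 using 1
  · funext k
    rw [LoopMat.evalEntry_apply, mul_smul_comm, ← pow_succ', map_smul, map_pow, map_smul]
  · rw [LoopMat.evalEntry_apply, ← map_smul, logTransport, smul_mul_assoc]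
    rfl

theorem logTransport_zero_left (B : Path (LoopMat ρ)) :
    logTransport 0 B = totalIntegral (LoopMat ρ) B := by
  rw [logTransport, zero_smul, logQuot_zero, mul_one, transportQuot_zero_left]

/-- Continuity of g at 0 suffices, since the difference quotient at 0 is g itself. This identifies
the special value M̃(0) = M'(0) with the integral of B. -/
theorem hasDerivAt_const_add_mul {c : ℂ} {g : ℝ → ℂ} (hg : ContinuousAt g 0) :
    HasDerivAt (fun s : ℝ => c + s * g s) (g 0) 0 := by
  rw [hasDerivAt_iff_tendsto_slope]
  refine (hg.tendsto.mono_left nhdsWithin_le_nhds).congr' ?_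
  filter_upwards [self_mem_nhdsWithin] with s hs
  have hs' : (s : ℂ) ≠ 0 := Complex.ofReal_ne_zero.2 hs
  rw [slope_def_module, Complex.real_smul]
  push_cast
  field_simp
  ring

theorem hasDerivAt_eval_transportQuot (B : Path (LoopMat ρ)) (l : Circle) (i j : Fin 2) (c : ℂ) :
    HasDerivAt (fun s : ℝ => c + s * LoopMat.eval l (transportQuot (s : ℂ) B) i j)
      (LoopMat.eval l (totalIntegral (LoopMat ρ) B) i j) 0 := by
  have h1 : ContinuousAt (fun t : ℂ => transportQuot t B) ((0 : ℝ) : ℂ) := by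
    simpa using continuousAt_transportQuot B
  have h2 : ContinuousAt (fun s : ℝ => transportQuot (s : ℂ) B) 0 :=
    ContinuousAt.comp (f := fun s : ℝ => (s : ℂ)) (g := fun t : ℂ => transportQuot t B)
      h1 Complex.continuous_ofReal.continuousAt
  have hg : ContinuousAt (fun s : ℝ => LoopMat.eval l (transportQuot (s : ℂ) B) i j) 0 := by
    have h3 := ContinuousAt.comp (f := fun s : ℝ => transportQuot (s : ℂ) B)
      (LoopMat.evalEntry l i j).continuous.continuousAt h2
    simpa only [Function.comp_def, LoopMat.evalEntry_apply] using h3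
  have h := hasDerivAt_const_add_mul (c := c) hg
  rwa [Complex.ofReal_zero, transportQuot_zero_left] at h

theorem eventually_norm_smul_lt {E : Type*} [NormedAddCommGroup E] [NormedSpace ℂ E] (T : E) :
    ∀ᶠ s : ℝ in nhds 0, ‖(s : ℂ) • T‖ < 1 := by
  have hc : Continuous fun s : ℝ => ‖(s : ℂ) • T‖ :=
    (Complex.continuous_ofReal.smul continuous_const).norm
  exact hc.continuousAt.eventually_lt continuousAt_const (by simp)

theorem hasDerivAt_M {m : ℕ} (hm : 1 ≤ m) (x : Params ρ) (l : Circle) (i j : Fin 2) :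
    HasDerivAt (fun s : ℝ => M m s x l i j)
      (LoopMat.eval l (totalIntegral (LoopMat ρ) (gaugedPotential m x)) i j) 0 := by
  refine (hasDerivAt_eval_transportQuot (gaugedPotential m x) l i j
    ((1 : Mat) i j)).congr_of_eventuallyEq ?_
  filter_upwards [eventually_norm_smul_lt (transportOp (LoopMat ρ) (gaugedPotential m x))]
    with s hs
  rw [M_eq hm l hs, Matrix.add_apply, Matrix.smul_apply, smul_eq_mul]

theorem Mtilde_eq {m : ℕ} (hm : 1 ≤ m) {t : ℝ} {x : Params ρ} (h : IsSmall m t x) (l : Circle) :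
    Mtilde m t x l = (2 * Real.pi * Complex.I : ℂ) • LoopMat.eval l (logMonodromy m t x) := by
  have h2 : (2 * Real.pi * Complex.I : ℂ) ≠ 0 := Complex.two_pi_I_ne_zero
  rw [logMonodromy, map_smul, smul_smul, mul_inv_cancel₀ h2, one_smul, Mtilde]
  split_ifs with ht
  · subst ht
    ext i j
    rw [Matrix.of_apply, (hasDerivAt_M hm x l i j).deriv, Complex.ofReal_zero,
      logTransport_zero_left]
  · rw [matLog_M hm h, smul_smul, inv_mul_cancel₀ (Complex.ofReal_ne_zero.2 ht), one_smul]

end Mtilde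

/-! ### Reality -/

section Reality

open ComplexConjugate

theorem conj_W_eval {ρ : ℝ} (f : W ρ) (l : ℂ) : conj (f.eval (conj l)) = f.eval l := by
  rw [W.eval, W.eval, Complex.conj_tsum]
  refine tsum_congr fun k => ?_
  rw [map_mul, map_pow, Complex.conj_conj, Complex.conj_ofReal]

theorem conj_puncture {m j : ℕ} (hj : j ≤ 2 * m + 2) :
    conj (puncture m j) = puncture m (2 * m + 2 - j) := by
  have h1 : puncture m j * puncture m (2 * m + 2 - j) = 1 := by
    rw [puncture_eq_pow, puncture_eq_pow, ← pow_add, Nat.add_sub_cancel' hj,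
      (Complex.isPrimitiveRoot_exp (2 * m + 2) (by omega)).pow_eq_one]
  have h2 : puncture m j * conj (puncture m j) = 1 := by
    rw [Complex.mul_conj, Complex.normSq_eq_norm_sq, norm_puncture]; simp
  exact mul_left_cancel₀ (puncture_ne_zero m j) (h2.trans h1.symm)

theorem neg_one_pow_sub {m j : ℕ} (hj : j ≤ 2 * m + 2) :
    (-1 : ℂ) ^ (2 * m + 2 - j) = (-1) ^ j := by
  have h : (-1 : ℂ) ^ (2 * m + 2 - j) * (-1) ^ j = (-1) ^ j * (-1) ^ j := by
    rw [← pow_add, Nat.sub_add_cancel hj, ← mul_pow]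
    simp [show 2 * m + 2 = 2 * (m + 1) by ring, pow_mul]
  exact mul_right_cancel₀ (pow_ne_zero _ (by norm_num)) h

theorem matConj_matA {ρ : ℝ} {m j : ℕ} (hj : j ≤ 2 * m + 2) (x : Params ρ) (l : ℂ) :
    matConj (matA m x j (conj l)) = matA m x (2 * m + 2 - j) l := by
  have e : ∀ f : W ρ, conj (f.eval ((-1) ^ j * conj l)) = f.eval ((-1) ^ j * l) := by
    intro f
    rw [← conj_W_eval f ((-1) ^ j * l)]
    simp
  rw [matA_eq, matA_eq, neg_one_pow_sub hj, ← conj_puncture hj]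
  ext i k
  fin_cases i <;> fin_cases k <;> simp [matConj_apply, e]

theorem matConj_potential {ρ : ℝ} (m : ℕ) (t : ℝ) (x : Params ρ) (l z : ℂ) :
    matConj (potential m t x (conj l) (conj z)) = potential m t x l z := by
  rw [potential, potential, map_add, matConj_smul, map_sum, Complex.conj_ofReal]
  congr 1
  · ext i j
    fin_cases i <;> fin_cases j <;> simp [matConj_apply]
  · congr 1
    let f : ℕ → Mat := fun j => (z - puncture m j)⁻¹ • matA m x j l
    have h1 : ∀ j ∈ Finset.range (2 * m + 2),
        matConj ((conj z - puncture m j)⁻¹ • matA m x j (conj l)) = f (2 * m + 2 - 1 - j + 1) := by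
      intro j hj
      rw [Finset.mem_range] at hj
      rw [show 2 * m + 2 - 1 - j + 1 = 2 * m + 2 - j by omega, matConj_smul, matConj_matA hj.le,
        map_inv₀, map_sub, Complex.conj_conj, conj_puncture hj.le]
    -- Conjugation sends the index j to n - j, so the indices 0, …, n - 1 become 1, …, n; the term
    -- of index n is that of index 0 because n is even and p_n = 1.
    have h2 : f (2 * m + 2) = f 0 := by
      have hp : puncture m (2 * m + 2) = 1 := by
        rw [puncture_eq_pow, (Complex.isPrimitiveRoot_exp (2 * m + 2) (by omega)).pow_eq_one]
      have hs : (-1 : ℂ) ^ (2 * m + 2) = 1 := by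
        rw [show 2 * m + 2 = 2 * (m + 1) by ring, pow_mul]; simp
      simp only [f]
      rw [matA_eq, matA_eq, hp, hs, puncture_zero, pow_zero]
    rw [Finset.sum_congr rfl h1, Finset.sum_range_reflect (fun j => f (j + 1))]
    have h3 := Finset.sum_range_succ f (2 * m + 2)
    rw [Finset.sum_range_succ' f, h2] at h3
    exact add_right_cancel h3

theorem conj_loop (m : ℕ) (s : ℝ) : conj (loop m (1 - s)) = loop m s := by
  rw [loop_eq, loop_eq, map_mul, Complex.conj_ofReal, map_sub, map_one, ← Complex.exp_conj]
  congr 2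
  have : conj (2 * Real.pi * Complex.I * ((1 - s : ℝ) : ℂ)) =
      2 * Real.pi * Complex.I * s - 2 * Real.pi * Complex.I := by
    simp only [map_mul, map_ofNat, Complex.conj_ofReal, Complex.conj_I]
    push_cast
    ring
  rw [this, Complex.exp_sub, Complex.exp_two_pi_mul_I, div_one]

theorem conj_deriv_loop (m : ℕ) (s : ℝ) :
    conj (deriv (loop m) (1 - s)) = -deriv (loop m) s := by
  have h1 := conj_loop m s
  rw [loop_eq, loop_eq, map_mul, Complex.conj_ofReal, map_sub, map_one] at h1
  have h2 : conj (deriv (loop m) (1 - s)) = 2 * Real.pi * Complex.I *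
      (loopRadius m * conj (Complex.exp (2 * Real.pi * Complex.I * ((1 - s : ℝ) : ℂ)))) := by
    rw [deriv_loop]
    simp only [map_neg, map_mul, Complex.conj_ofReal, Complex.conj_I, map_ofNat]
    ring
  rw [h2, deriv_loop, neg_neg]
  linear_combination (-(2 * Real.pi * Complex.I)) * h1

/-- Conjugation reverses the loop, so s ↦ conj Y'(1 - s) solves the same linear equation as s ↦ conj
Y'(1) · Y(s). The two agree at s = 0, hence at s = 1, where the first is the identity. -/
theorem matConj_endpoint_mul {ρ : ℝ} {m : ℕ} {t : ℝ} {x : Params ρ} {l : ℂ} {Y Y' : ℝ → Mat}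
    (hY : IsSolutionAlong (potential m t x l) (loop m) Y)
    (hY' : IsSolutionAlong (potential m t x (conj l)) (loop m) Y') :
    matConj (Y' 1) * Y 1 = 1 := by
  have h1 := linear_ode_of_isSolutionAlong hY
  have hl : ∀ s ∈ Set.Icc (0 : ℝ) 1, ∀ i j,
      HasDerivWithinAt (fun u => (matConj (Y' 1) * Y u) i j)
        ((matConj (Y' 1) * Y s * (deriv (loop m) s • potential m t x l (loop m s))) i j)
        (Set.Icc 0 1) s := by
    intro s hs i j
    have h := HasDerivWithinAt.fun_sum (u := Finset.univ) fun k _ =>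
      (h1 s hs k j).const_mul (matConj (Y' 1) i k)
    rw [mul_assoc]
    exact h
  have hr : ∀ s ∈ Set.Icc (0 : ℝ) 1, ∀ i j,
      HasDerivWithinAt (fun u => matConj (Y' (1 - u)) i j)
        ((matConj (Y' (1 - s)) * (deriv (loop m) s • potential m t x l (loop m s))) i j)
        (Set.Icc 0 1) s := by
    intro s hs i j
    have hs' : 1 - s ∈ Set.Icc (0 : ℝ) 1 := ⟨by linarith [hs.2], by linarith [hs.1]⟩
    have h2 := hY'.2 (1 - s) hs' i j
    have h3 : HasDerivWithinAt (fun u : ℝ => 1 - u) (-1) (Set.Icc 0 1) s := by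
      simpa using (hasDerivWithinAt_id s (Set.Icc (0 : ℝ) 1)).const_sub 1
    have h4 := h2.scomp s h3 (fun u hu => ⟨by linarith [hu.2], by linarith [hu.1]⟩)
    have h5 := h4.star
    have e : (matConj (Y' (1 - s)) * (deriv (loop m) s • potential m t x l (loop m s))) i j =
        star ((-1 : ℝ) • (deriv (loop m) (1 - s) *
          (Y' (1 - s) * potential m t x (conj l) (loop m (1 - s))) i j)) := by
      have h6 : conj ((Y' (1 - s) * potential m t x (conj l) (loop m (1 - s))) i j) =
          (matConj (Y' (1 - s)) * potential m t x l (loop m s)) i j := by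
        have h7 := matConj_potential m t x l (loop m s)
        rw [← conj_loop m s, Complex.conj_conj, conj_loop] at h7
        rw [← h7, ← map_mul, matConj_apply]
      rw [neg_one_smul, star_neg, star_mul', Complex.star_def, h6,
        conj_deriv_loop, mul_smul_comm, Matrix.smul_apply, smul_eq_mul, neg_mul, neg_neg]
    rw [e]
    exact h5
  have h0 : matConj (Y' 1) * Y 0 = matConj (Y' (1 - 0)) := by
    rw [hY.1, mul_one, sub_zero]
  have := linear_ode_unique (Y := fun u => matConj (Y' 1) * Y u)
    (Z := fun u => matConj (Y' (1 - u))) (continuousOn_potential m t x l) hl hr h0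
    (Set.right_mem_Icc.2 zero_le_one)
  simp only [sub_self] at this
  rw [this, hY'.1, map_one]

variable {ρ : ℝ} [hρ : Fact (1 < ρ)]

theorem exists_isSolutionAlong {m : ℕ} (hm : 1 ≤ m) {t : ℝ} {x : Params ρ} (h : IsSmall m t x)
    (l : Circle) : ∃ Y, IsSolutionAlong (potential m t x l) (loop m) Y ∧ M m t x l = Y 1 :=
  have h1 := isSolutionAlong_transport hm t x l h.1
  ⟨_, h1, M_eq_of_isSolutionAlong h1⟩

theorem matConj_M_mul {m : ℕ} (hm : 1 ≤ m) {t : ℝ} {x : Params ρ} (h : IsSmall m t x)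
    (l : Circle) : matConj (M m t x (l⁻¹ : Circle)) * M m t x l = 1 := by
  obtain ⟨Y, hY, e⟩ := exists_isSolutionAlong hm h l
  obtain ⟨Y', hY', e'⟩ := exists_isSolutionAlong hm h l⁻¹
  rw [e, e']
  rw [Circle.coe_inv_eq_conj] at hY'
  exact matConj_endpoint_mul hY hY'

theorem totalIntegral_gaugedPotential {m : ℕ} (hm : 1 ≤ m) (x : Params ρ) :
    totalIntegral (LoopMat ρ) (gaugedPotential m x) = (2 * Real.pi * Complex.I : ℂ) •
      (residue m 0 x + (x.1 : ℂ) • (nilp * residue m 0 x - residue m 0 x * nilp) -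
        ((x.1 : ℂ) ^ 2) • (nilp * residue m 0 x * nilp)) := by
  rw [gaugedPotential, map_sum, Finset.sum_eq_single 0]
  · rw [map_sub, map_add, totalIntegral_tensor, totalIntegral_tensor, totalIntegral_tensor,
      totalIntegral_loopForm hm (by omega), totalIntegral_loopForm hm (by omega),
      totalIntegral_loopForm hm (by omega), if_pos rfl]
    simp only [smul_sub, smul_add]
  · intro j hj hj0
    rw [Finset.mem_range] at hj
    rw [map_sub, map_add, totalIntegral_tensor, totalIntegral_tensor, totalIntegral_tensor,
      totalIntegral_loopForm hm hj, totalIntegral_loopForm hm hj,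
      totalIntegral_loopForm hm hj, if_neg hj0, zero_smul, zero_smul, zero_smul]
    simp
  · intro h
    exact absurd (Finset.mem_range.2 (by omega)) h

theorem eval_totalIntegral_gaugedPotential {m : ℕ} (hm : 1 ≤ m) (x : Params ρ) (l : Circle) :
    LoopMat.eval l (totalIntegral (LoopMat ρ) (gaugedPotential m x)) =
      (2 * Real.pi * Complex.I : ℂ) •
      !![x.2.1.eval l - x.1 * ((l : ℂ)⁻¹ * x.2.2.1.eval l), (l : ℂ)⁻¹ * x.2.2.1.eval l;
        l * x.2.2.2.eval l + 2 * x.1 * x.2.1.eval l - x.1 ^ 2 * ((l : ℂ)⁻¹ * x.2.2.1.eval l),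
        x.1 * ((l : ℂ)⁻¹ * x.2.2.1.eval l) - x.2.1.eval l] := by
  rw [totalIntegral_gaugedPotential hm, map_smul]
  congr 1
  simp only [map_sub, map_add, map_smul, map_mul, eval_nilp, eval_residue, matA]
  ext i k
  fin_cases i <;> fin_cases k <;> simp <;> ring

theorem eval_logMonodromy_zero {m : ℕ} (hm : 1 ≤ m) (x : Params ρ) (l : Circle) :
    LoopMat.eval l (logMonodromy m 0 x) =
      !![x.2.1.eval l - x.1 * ((l : ℂ)⁻¹ * x.2.2.1.eval l), (l : ℂ)⁻¹ * x.2.2.1.eval l;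
        l * x.2.2.2.eval l + 2 * x.1 * x.2.1.eval l - x.1 ^ 2 * ((l : ℂ)⁻¹ * x.2.2.1.eval l),
        x.1 * ((l : ℂ)⁻¹ * x.2.2.1.eval l) - x.2.1.eval l] := by
  rw [logMonodromy, map_smul, Complex.ofReal_zero, logTransport_zero_left,
    eval_totalIntegral_gaugedPotential hm, smul_smul, inv_mul_cancel₀ Complex.two_pi_I_ne_zero,
    one_smul]

/-- On the circle λ⁻¹ = λ̄, and conj M(λ̄) = M(λ)⁻¹ makes the conjugated logarithm change sign; the
factor 1/(2πi) changes sign too. For t = 0 the explicit residue formula is used instead. -/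
theorem matConj_eval_logMonodromy {m : ℕ} (hm : 1 ≤ m) {t : ℝ} {x : Params ρ}
    (h : IsSmall m t x) (l : Circle) :
    matConj (LoopMat.eval l⁻¹ (logMonodromy m t x)) = LoopMat.eval l (logMonodromy m t x) := by
  have h2 : (2 * Real.pi * Complex.I : ℂ) ≠ 0 := Complex.two_pi_I_ne_zero
  have hc : conj (2 * Real.pi * Complex.I : ℂ)⁻¹ = -(2 * Real.pi * Complex.I : ℂ)⁻¹ := by
    rw [map_inv₀, ← inv_neg]
    congr 1
    simp only [map_mul, map_ofNat, Complex.conj_ofReal, Complex.conj_I]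
    ring
  rcases eq_or_ne t 0 with rfl | ht
  · rw [eval_logMonodromy_zero hm, eval_logMonodromy_zero hm, Circle.coe_inv_eq_conj]
    ext i j
    have h2 : conj (2 : ℂ) = 2 := map_ofNat _ 2
    fin_cases i <;> fin_cases j <;> simp [matConj_apply, conj_W_eval, h2]
  · have ht' : (t : ℂ) ≠ 0 := Complex.ofReal_ne_zero.2 ht
    have e : ∀ l : Circle, LoopMat.eval l (logMonodromy m t x) =
        (2 * Real.pi * Complex.I : ℂ)⁻¹ • (t : ℂ)⁻¹ • matLog (M m t x l) := by
      intro l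
      rw [logMonodromy, map_smul, matLog_M hm h, smul_smul (t : ℂ)⁻¹, inv_mul_cancel₀ ht', one_smul]
    have hlog : matConj (matLog (M m t x (l⁻¹ : Circle))) = -matLog (M m t x l) := by
      have h3 := matConj_M_mul hm h l
      rw [M_eq hm l h.1, M_eq hm l⁻¹ h.1, map_add, map_one] at h3
      have h4 := mul_eq_one_comm.1 h3
      rw [M_eq hm l h.1, M_eq hm l⁻¹ h.1, ← matLog_matConj (h.norm_lt l⁻¹)]
      refine matLog_of_mul_eq_one (h.norm_lt l) (fun i j => ?_) h4
      rw [matConj_apply, RCLike.norm_conj]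
      exact h.norm_lt l⁻¹ i j
    rw [e, e, matConj_smul, matConj_smul, hlog, hc, map_inv₀, Complex.conj_ofReal, smul_neg,
      smul_neg, neg_smul, neg_neg]

/-- The Laurent coefficients of the logarithm of the monodromy are real. -/
theorem conj_coeff_logMonodromy {m : ℕ} (hm : 1 ≤ m) {t : ℝ} {x : Params ρ}
    (h : IsSmall m t x) (i j : Fin 2) (k : ℤ) :
    conj ((LoopMat.entry i j (logMonodromy m t x)).coeff k) =
      (LoopMat.entry i j (logMonodromy m t x)).coeff k := by
  set T := LoopMat.entry i j (logMonodromy m t x) with hT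
  have h1 : T.coeff = fun k => conj (T.coeff k) := by
    refine Wiener.coeff_eq_of_eval (by simpa using T.summable_coeff) fun l => ?_
    have h2 := congrFun (congrFun (matConj_eval_logMonodromy hm h l) i) j
    rw [matConj_apply, LoopMat.eval_apply, LoopMat.eval_apply, ← hT] at h2
    rw [← h2, Wiener.eval_eq_tsum, Complex.conj_tsum]
    refine tsum_congr fun k => ?_
    rw [map_mul, map_zpow₀, Circle.coe_inv_eq_conj, Complex.conj_conj]
  exact (congrFun h1 k).symm

end Reality

end LawsonDPW

namespace LawsonDPW

/-! ### The monodromy problem in terms of Laurent coefficients -/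

theorem Wiener.eval_eq_eval_inv_iff {ρ : ℝ} [Fact (1 < ρ)] (S T : Wiener ρ) :
    (∀ l : Circle, Wiener.eval l S = Wiener.eval l⁻¹ T) ↔ ∀ k, S.coeff k = T.coeff (-k) := by
  have e : ∀ l : Circle, Wiener.eval l⁻¹ T = ∑' k, T.coeff (-k) * (l : ℂ) ^ k := by
    intro l
    rw [Wiener.eval_eq_tsum, ← (Equiv.neg ℤ).tsum_eq]
    refine tsum_congr fun k => ?_
    simp
  constructor
  · intro h
    have h1 : Summable fun k => ‖T.coeff (-k)‖ :=
      (Equiv.neg ℤ).summable_iff.2 T.summable_coeff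
    exact congrFun (Wiener.coeff_eq_of_eval h1 fun l => by rw [h, e])
  · intro h l
    rw [e, Wiener.eval_eq_tsum]
    exact tsum_congr fun k => by rw [h]

section Conditions

open ComplexConjugate

variable {ρ : ℝ} [hρ : Fact (1 < ρ)]

theorem one_div_conj_circle (l : Circle) : 1 / conj (l : ℂ) = l := by
  rw [← Circle.coe_inv_eq_conj, Circle.coe_inv, one_div, inv_inv]

/-- On the unit circle the star is plain conjugation, which by reality of the coefficients amounts
to λ ↦ λ⁻¹. The minus sign is that of conj (2πi), so the sums in ℱ and 𝒢 become differences. -/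
theorem starLoop_Mtilde {m : ℕ} (hm : 1 ≤ m) {t : ℝ} {x : Params ρ} (h : IsSmall m t x)
    (l : Circle) (i j : Fin 2) : starLoop (fun w => Mtilde m t x w i j) l =
      -(2 * Real.pi * Complex.I) *
        Wiener.eval l⁻¹ (LoopMat.entry i j (logMonodromy m t x)) := by
  have h1 := congrFun (congrFun (matConj_eval_logMonodromy hm h l⁻¹) i) j
  rw [inv_inv, matConj_apply, LoopMat.eval_apply, LoopMat.eval_apply] at h1
  rw [starLoop, one_div_conj_circle, Mtilde_eq hm h, Matrix.smul_apply, smul_eq_mul,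
    LoopMat.eval_apply, map_mul, h1]
  simp only [map_mul, map_ofNat, Complex.conj_ofReal, Complex.conj_I]
  ring

theorem forall_unit_iff {p : ℂ → Prop} : (∀ l : ℂ, ‖l‖ = 1 → p l) ↔ ∀ l : Circle, p l :=
  ⟨fun h l => h l l.norm_coe, fun h l hl => h ⟨l, mem_sphere_zero_iff_norm.2 hl⟩⟩

theorem solvesMonodromyProblem_iff {m : ℕ} (hm : 1 ≤ m) {t : ℝ} {x : Params ρ}
    (h : IsSmall m t x) : SolvesMonodromyProblem m t x ↔
      (∀ k, (LoopMat.entry 0 0 (logMonodromy m t x)).coeff k =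
        (LoopMat.entry 0 0 (logMonodromy m t x)).coeff (-k)) ∧
      (∀ k, (LoopMat.entry 1 0 (logMonodromy m t x)).coeff k =
        (LoopMat.entry 0 1 (logMonodromy m t x)).coeff (-k)) ∧
      Wiener.eval 1 (LoopMat.entry 0 1 (logMonodromy m t x)) = 0 ∧
      Wiener.eval (-1) (LoopMat.entry 0 1 (logMonodromy m t x)) = 0 ∧ K x = 1 := by
  have h2 : (2 * Real.pi * Complex.I : ℂ) ≠ 0 := Complex.two_pi_I_ne_zero
  have hM : ∀ (l : Circle) (i j : Fin 2), 1 / (2 * Real.pi * Complex.I) * Mtilde m t x l i j =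
      Wiener.eval l (LoopMat.entry i j (logMonodromy m t x)) := fun l i j => by
    rw [Mtilde_eq hm h, Matrix.smul_apply, smul_eq_mul, LoopMat.eval_apply, ← mul_assoc,
      one_div_mul_cancel h2, one_mul]
  have hS : ∀ (l : Circle) (i j p q : Fin 2), 1 / (2 * Real.pi * Complex.I) *
      (Mtilde m t x l i j + starLoop (fun w => Mtilde m t x w p q) l) =
      Wiener.eval l (LoopMat.entry i j (logMonodromy m t x)) -
        Wiener.eval l⁻¹ (LoopMat.entry p q (logMonodromy m t x)) := fun l i j p q => by
    rw [mul_add, hM, starLoop_Mtilde hm h, ← mul_assoc, mul_neg, one_div_mul_cancel h2]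
    ring
  rw [SolvesMonodromyProblem, forall_unit_iff, forall_unit_iff,
    ← Wiener.eval_eq_eval_inv_iff, ← Wiener.eval_eq_eval_inv_iff]
  have e1 : H₁ m t x = Wiener.eval 1 (LoopMat.entry 0 1 (logMonodromy m t x)) := by
    rw [← hM, H₁, Circle.coe_one]
  have e2 : H₂ m t x = Wiener.eval (-1) (LoopMat.entry 0 1 (logMonodromy m t x)) := by
    rw [← hM, H₂, Circle.coe_neg, Circle.coe_one]
  rw [e1, e2]
  simp only [F, G, hS, sub_eq_zero]

end Conditions

/-! ### Smoothness -/

section Smooth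

variable {ρ : ℝ} [hρ : Fact (1 < ρ)]

theorem contDiff_gaugedPotential (m : ℕ) :
    ContDiff ℝ 1 (gaugedPotential m : Params ρ → Path (LoopMat ρ)) := by
  have hr : ContDiff ℝ 1 fun x : Params ρ => (x.1 : ℂ) :=
    Complex.ofRealCLM.contDiff.comp contDiff_fst
  have hT : ∀ u : Path ℂ, ContDiff ℝ 1 (Path.tensor u : LoopMat ρ → Path (LoopMat ρ)) := fun u =>
    (Path.tensor (𝒜 := LoopMat ρ) u).contDiff.restrict_scalars ℝ
  have hA : ∀ j, ContDiff ℝ 1 (residue m j : Params ρ → LoopMat ρ) := fun j =>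
    (residue (ρ := ρ) m j).contDiff
  refine ContDiff.sum fun j _ => ((hT _).comp (hA j)).add ((hT _).comp
    (hr.smul ((contDiff_const.mul (hA j)).sub ((hA j).mul contDiff_const)))) |>.sub ((hT _).comp
    ((hr.pow 2).smul ((contDiff_const.mul (hA j)).mul contDiff_const)))

theorem eventually_isSmall (m : ℕ) (x : Params ρ) :
    ∀ᶠ p : ℝ × Params ρ in nhds (0, x), IsSmall m p.1 p.2 := by
  have hB : Continuous (gaugedPotential m : Params ρ → Path (LoopMat ρ)) :=
    (contDiff_gaugedPotential m).continuous
  have ht : Continuous fun p : ℝ × Params ρ => (p.1 : ℂ) :=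
    Complex.continuous_ofReal.comp continuous_fst
  have hp : Continuous fun p : ℝ × Params ρ => ((p.1 : ℂ), gaugedPotential m p.2) :=
    ht.prodMk (hB.comp continuous_snd)
  have h1 : Continuous fun p : ℝ × Params ρ =>
      ‖(p.1 : ℂ) • transportOp (LoopMat ρ) (gaugedPotential m p.2)‖ :=
    (ht.smul ((transportOp (LoopMat ρ)).continuous.comp (hB.comp continuous_snd))).norm
  obtain ⟨D, hD, -⟩ := hasStrictFDerivAt_transportQuot (gaugedPotential m x)
  have h2 : ContinuousAt (fun p : ℝ × Params ρ =>
      transportQuot (p.1 : ℂ) (gaugedPotential m p.2)) (0, x) := by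
    refine ContinuousAt.comp (f := fun p : ℝ × Params ρ => ((p.1 : ℂ), gaugedPotential m p.2))
      (g := fun q : ℂ × Path (LoopMat ρ) => transportQuot q.1 q.2) ?_ hp.continuousAt
    rw [Complex.ofReal_zero]
    exact hD.continuousAt
  have h3 := (ht.continuousAt.fun_smul h2).norm
  refine (h1.continuousAt.eventually_lt continuousAt_const ?_).and
    (h3.eventually_lt continuousAt_const ?_)
  · refine (norm_smul_le ((0 : ℝ) : ℂ) (transportOp (LoopMat ρ) (gaugedPotential m x))).trans_lt ?_
    rw [Complex.ofReal_zero, norm_zero, zero_mul]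
    exact zero_lt_one
  · exact (norm_smul_le _ _).trans_lt (by simp)

/-- The second order part of the logarithm of the monodromy at `t = 0`. -/
def logMonodromyDeriv (m : ℕ) (x : Params ρ) : LoopMat ρ :=
  (2 * Real.pi * Complex.I : ℂ)⁻¹ •
    (totalIntegral (LoopMat ρ) (volterra (LoopMat ρ) (gaugedPotential m x) * gaugedPotential m x) -
      (1 / 2 : ℂ) • (totalIntegral (LoopMat ρ) (gaugedPotential m x) *
        totalIntegral (LoopMat ρ) (gaugedPotential m x)))

/-- The t-dependent remainder has no first order dependence on x at t = 0, so the full derivative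
splits into this t-part and the derivative of x ↦ `logMonodromy m 0 x`. -/
theorem hasStrictFDerivAt_logMonodromy_sub (m : ℕ) (x : Params ρ) :
    ∃ D : ℝ × Params ρ →L[ℝ] LoopMat ρ,
      HasStrictFDerivAt
        (fun p : ℝ × Params ρ => logMonodromy m p.1 p.2 - logMonodromy m 0 p.2) D (0, x) ∧
      ∀ τ ξ, D (τ, ξ) = τ • logMonodromyDeriv m x := by
  obtain ⟨D, hD, hD'⟩ := hasStrictFDerivAt_logTransport_sub (gaugedPotential m x)
  have hB := ((contDiff_gaugedPotential (ρ := ρ) m).contDiffAt (x := x)).hasStrictFDerivAt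
    one_ne_zero
  have ht : HasStrictFDerivAt (fun p : ℝ × Params ρ => (p.1 : ℂ))
      (Complex.ofRealCLM.comp (ContinuousLinearMap.fst ℝ ℝ (Params ρ))) (0, x) :=
    (Complex.ofRealCLM.comp (ContinuousLinearMap.fst ℝ ℝ (Params ρ))).hasStrictFDerivAt
  have hp := ht.prodMk (hB.comp (0, x) (hasStrictFDerivAt_snd (𝕜 := ℝ) (p := ((0 : ℝ), x))))
  have hD0 : HasStrictFDerivAt (fun p : ℂ × Path (LoopMat ρ) => logTransport p.1 p.2 -
      totalIntegral (LoopMat ρ) p.2) (D.restrictScalars ℝ)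
      (((0 : ℝ) : ℂ), gaugedPotential m x) := by
    rw [Complex.ofReal_zero]
    exact hD.restrictScalars ℝ
  have h := (hD0.comp (0, x) hp).const_smul (2 * Real.pi * Complex.I : ℂ)⁻¹
  refine ⟨_, h.congr_of_eventuallyEq (Filter.Eventually.of_forall fun p => ?_), fun τ ξ => ?_⟩
  · simp only [logMonodromy, Pi.smul_apply, Complex.ofReal_zero,
      logTransport_zero_left, smul_sub]
  · change (2 * Real.pi * Complex.I : ℂ)⁻¹ • D ((τ : ℂ), _) = _
    rw [hD', smul_comm, logMonodromyDeriv, Complex.coe_smul]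

end Smooth

end LawsonDPW

namespace LawsonDPW

/-! ### Laurent coefficients in the Wiener algebra -/

namespace Wiener

variable {ρ : ℝ} [hρ : Fact (1 < ρ)]

/-- An operator in the algebra acts by multiplication on circle values, and these determine Laurent
coefficients. Identities of loops can thus be checked pointwise, as matrix identities over ℂ. -/
theorem ext_eval {S T : Wiener ρ} (h : ∀ l : Circle, eval l S = eval l T) : S = T := by
  refine Subtype.ext (ContinuousLinearMap.ext fun x => lp.ext (funext fun k => ?_))
  have h1 := congrFun (eq_of_hasSum (LawsonDPW.summable_coeff ρ (S.1 x))
    (LawsonDPW.summable_coeff ρ (T.1 x)) fun l => by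
      rw [← circleEval_apply, ← circleEval_apply, S.2 l x, T.2 l x]
      exact congrArg (· * circleEval ρ l x) (h l)) k
  have h2 : ((ρ ^ k.natAbs : ℝ) : ℂ) ≠ 0 := Complex.ofReal_ne_zero.2 (weight_pos ρ k).ne'
  exact (div_left_inj' h2).1 h1

theorem coeff_add (S T : Wiener ρ) (k : ℤ) : (S + T).coeff k = S.coeff k + T.coeff k := by
  rw [coeff, map_add, lp.coeFn_add, Pi.add_apply, add_div]
  rfl

theorem coeff_smul (c : ℂ) (T : Wiener ρ) (k : ℤ) : (c • T).coeff k = c * T.coeff k := by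
  rw [coeff, map_smul, lp.coeFn_smul, Pi.smul_apply, smul_eq_mul, mul_div_assoc]
  rfl

theorem coeff_sub (S T : Wiener ρ) (k : ℤ) : (S - T).coeff k = S.coeff k - T.coeff k :=
  eq_sub_of_add_eq (by rw [← coeff_add, sub_add_cancel])

theorem coeff_neg_one_mul (T : Wiener ρ) (k : ℤ) : (-1 * T).coeff k = -T.coeff k := by
  rw [show -1 * T = (-1 : ℂ) • T by rw [neg_one_mul, neg_one_smul], coeff_smul, neg_one_mul]

theorem coeff_shift {S T : Wiener ρ} {d : ℤ} (h : ∀ l : Circle, eval l S = (l : ℂ) ^ d * eval l T)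
    (k : ℤ) : S.coeff k = T.coeff (k - d) := by
  have h1 : Summable fun k => ‖T.coeff (k - d)‖ :=
    T.summable_coeff.comp_injective (sub_left_injective (b := d))
  refine congrFun (coeff_eq_of_eval h1 fun l => ?_) k
  rw [h, eval_eq_tsum, ← (Equiv.subRight d).tsum_eq, ← tsum_mul_left]
  refine tsum_congr fun k => ?_
  rw [Equiv.subRight_apply, zpow_sub₀ (Circle.coe_ne_zero l)]
  have := zpow_ne_zero d (Circle.coe_ne_zero l)
  field_simp

theorem coeff_lam_mul (T : Wiener ρ) (k : ℤ) : (lam * T).coeff k = T.coeff (k - 1) :=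
  coeff_shift (fun l => by rw [map_mul, eval_lam, zpow_one]) k

theorem coeff_lamInv_mul (T : Wiener ρ) (k : ℤ) : (lamInv * T).coeff k = T.coeff (k + 1) := by
  rw [← sub_neg_eq_add]
  exact coeff_shift (fun l => by rw [map_mul, eval_lamInv, zpow_neg_one]) k

theorem coeff_ofW (f : W ρ) (k : ℤ) :
    (ofW 0 f).coeff k = if 0 ≤ k then (f.coeff k.toNat : ℂ) else 0 := by
  have hinj : Function.Injective ((↑) : ℕ → ℤ) := Nat.cast_injective
  have hz : ∀ k : ℤ, k ∉ Set.range ((↑) : ℕ → ℤ) → ¬ 0 ≤ k := fun k hk h =>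
    hk ⟨k.toNat, Int.toNat_of_nonneg h⟩
  have hs : Summable fun k : ℕ => ‖(f.coeff k : ℂ)‖ := by
    refine Summable.of_nonneg_of_le (fun k => norm_nonneg _) (fun k => ?_) f.summable
    rw [Complex.norm_real, Real.norm_eq_abs]
    refine le_mul_of_one_le_right (abs_nonneg _) (one_le_pow₀ ?_)
    exact hρ.out.le.trans (le_abs_self ρ)
  refine congrFun (coeff_eq_of_eval (f := fun k : ℤ =>
    if 0 ≤ k then (f.coeff k.toNat : ℂ) else 0) ?_ fun l => ?_) k
  · refine (hinj.summable_iff fun k hk => ?_).1 ?_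
    · rw [if_neg (hz k hk), norm_zero]
    · simpa [Function.comp_def] using hs
  · rw [eval_ofW, W.eval, pow_zero, one_mul]
    rw [← hinj.tsum_eq (f := fun k : ℤ =>
      (if 0 ≤ k then (f.coeff k.toNat : ℂ) else 0) * (l : ℂ) ^ k)]
    · exact tsum_congr fun k => by simp
    · intro k hk
      by_contra h
      exact hk (by simp only [if_neg (hz k h), zero_mul])

theorem coeff_one (k : ℤ) : (1 : Wiener ρ).coeff k = if k = 0 then 1 else 0 := by
  refine congrFun (coeff_eq_of_eval (f := fun k : ℤ => if k = 0 then (1 : ℂ) else 0) ?_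
    fun l => ?_) k
  · exact summable_of_ne_finset_zero (s := {0}) fun k hk => by
      rw [Finset.mem_singleton] at hk
      rw [if_neg hk, norm_zero]
  · rw [map_one, tsum_eq_single 0]
    · simp
    · intro k hk
      rw [if_neg hk, zero_mul]

theorem coeff_lam (k : ℤ) : (lam : Wiener ρ).coeff k = if k = 1 then 1 else 0 := by
  rw [← mul_one lam, coeff_lam_mul, coeff_one]
  simp only [sub_eq_zero]

theorem coeff_lamInv (k : ℤ) : (lamInv : Wiener ρ).coeff k = if k = -1 then 1 else 0 := by
  rw [← mul_one lamInv, coeff_lamInv_mul, coeff_one]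
  simp only [add_eq_zero_iff_eq_neg]

end Wiener

theorem LoopMat.ext_eval {ρ : ℝ} [Fact (1 < ρ)] {A B : LoopMat ρ}
    (h : ∀ l : Circle, LoopMat.eval l A = LoopMat.eval l B) : A = B :=
  Matrix.ext fun i j => Wiener.ext_eval fun l => congrFun (congrFun (h l) i) j

/-! ### The defect of a matrix loop -/

section Defect

variable {ρ : ℝ} [hρ : Fact (1 < ρ)]

/-- The space of values of the equations of the monodromy problem. -/
abbrev Target (ρ : ℝ) := W ρ × W ρ × W ρ × ℝ × ℝ

/-- The part of nonnegative degree, with the real parts of the coefficients. -/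
def posPart : Wiener ρ →L[ℝ] W ρ := Wiener.part 1 rfl

/-- The part of nonpositive degree, with the real parts of the coefficients, as a series in
`λ⁻¹`. -/
def negPart : Wiener ρ →L[ℝ] W ρ := Wiener.part (-1) rfl

theorem coeff_posPart (T : Wiener ρ) (k : ℕ) : (posPart T).coeff k = (T.coeff k).re := by
  rw [posPart, Wiener.coeff_part, one_mul]

theorem coeff_negPart (T : Wiener ρ) (k : ℕ) : (negPart T).coeff k = (T.coeff (-k)).re := by
  rw [negPart, Wiener.coeff_part, neg_one_mul]

/-- The equations of the monodromy problem for a matrix loop `(u, v; w, *)` with real coefficients: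
the components are `u_{k+1} - u_{-k-1}`, `w_k - v_{-k}` and `w_{-k-1} - v_{k+1}` for `k ≥ 0`, and the
values `v(1)` and `v(-1)`. -/
def defect : LoopMat ρ →L[ℝ] Target ρ :=
  let u : LoopMat ρ →L[ℝ] Wiener ρ := (LoopMat.entry 0 0).restrictScalars ℝ
  let v : LoopMat ρ →L[ℝ] Wiener ρ := (LoopMat.entry 0 1).restrictScalars ℝ
  let w : LoopMat ρ →L[ℝ] Wiener ρ := (LoopMat.entry 1 0).restrictScalars ℝ
  let pos : Wiener ρ →L[ℝ] W ρ := posPart.comp (mulLeftR Wiener.lamInv)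
  let neg : Wiener ρ →L[ℝ] W ρ := negPart.comp (mulLeftR Wiener.lam)
  let ev (l : Circle) : Wiener ρ →L[ℝ] ℝ :=
    Complex.reCLM.comp ((Wiener.evalL l).restrictScalars ℝ)
  let opp : Wiener ρ →L[ℝ] Wiener ρ := mulLeftR (-1)
  (pos.comp u + neg.comp (opp.comp u)).prod <|
    (posPart.comp w + negPart.comp (opp.comp v)).prod <|
    (neg.comp w + pos.comp (opp.comp v)).prod <| ((ev 1).comp v).prod ((ev (-1)).comp v)

theorem coeff_defect_diag (A : LoopMat ρ) (k : ℕ) : (defect A).1.coeff k =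
    ((LoopMat.entry 0 0 A).coeff (k + 1)).re - ((LoopMat.entry 0 0 A).coeff (-(k + 1))).re := by
  change (posPart (Wiener.lamInv * LoopMat.entry 0 0 A) +
    negPart (Wiener.lam * (-1 * LoopMat.entry 0 0 A))).coeff k = _
  rw [W.coeff_add, coeff_posPart, coeff_negPart, Wiener.coeff_lamInv_mul, Wiener.coeff_lam_mul,
    Wiener.coeff_neg_one_mul, neg_add, ← sub_eq_add_neg (-(k : ℤ)), Complex.neg_re]
  ring

theorem coeff_defect_pos (A : LoopMat ρ) (k : ℕ) : (defect A).2.1.coeff k =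
    ((LoopMat.entry 1 0 A).coeff k).re - ((LoopMat.entry 0 1 A).coeff (-k)).re := by
  change (posPart (LoopMat.entry 1 0 A) + negPart (-1 * LoopMat.entry 0 1 A)).coeff k = _
  rw [W.coeff_add, coeff_posPart, coeff_negPart, Wiener.coeff_neg_one_mul, Complex.neg_re,
    sub_eq_add_neg]

theorem coeff_defect_neg (A : LoopMat ρ) (k : ℕ) : (defect A).2.2.1.coeff k =
    ((LoopMat.entry 1 0 A).coeff (-(k + 1))).re - ((LoopMat.entry 0 1 A).coeff (k + 1)).re := by
  change (negPart (Wiener.lam * LoopMat.entry 1 0 A) +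
    posPart (Wiener.lamInv * (-1 * LoopMat.entry 0 1 A))).coeff k = _
  rw [W.coeff_add, coeff_posPart, coeff_negPart, Wiener.coeff_lamInv_mul, Wiener.coeff_lam_mul,
    Wiener.coeff_neg_one_mul, neg_add, ← sub_eq_add_neg (-(k : ℤ)), Complex.neg_re]
  ring

theorem defect_eval_one (A : LoopMat ρ) :
    (defect A).2.2.2.1 = (Wiener.eval 1 (LoopMat.entry 0 1 A)).re := rfl

theorem defect_eval_neg_one (A : LoopMat ρ) :
    (defect A).2.2.2.2 = (Wiener.eval (-1) (LoopMat.entry 0 1 A)).re := rfl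

/-- The diagonal equation u_k = u_{-k} is symmetric in k and empty at k = 0. Only k ≥ 1 is kept in
`defect`; a redundant equation would destroy surjectivity of the linearisation. -/
theorem forall_int_symm_iff {P : ℤ → Prop} (h : ∀ k, P k ↔ P (-k)) (h0 : P 0) :
    (∀ k, P k) ↔ ∀ k : ℕ, P (k + 1) := by
  refine ⟨fun H k => H _, fun H k => ?_⟩
  rcases lt_trichotomy k 0 with hk | rfl | hk
  · rw [h]
    convert! H (-k - 1).toNat using 1
    omega
  · exact h0
  · convert! H (k - 1).toNat using 1
    omega

theorem forall_int_iff {P : ℤ → Prop} :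
    (∀ k, P k) ↔ (∀ k : ℕ, P k) ∧ ∀ k : ℕ, P (-(k + 1)) := by
  refine ⟨fun H => ⟨fun k => H _, fun k => H _⟩, fun ⟨H1, H2⟩ k => ?_⟩
  rcases le_or_gt 0 k with hk | hk
  · convert! H1 k.toNat using 1
    omega
  · convert! H2 (-k - 1).toNat using 1
    omega

/-- `defect` sees real parts only; nothing is lost because the coefficients, and the values at λ =
±1, are real. -/
theorem solvesMonodromyProblem_iff_defect {m : ℕ} (hm : 1 ≤ m) {t : ℝ} {x : Params ρ}
    (h : IsSmall m t x) :
    SolvesMonodromyProblem m t x ↔ defect (logMonodromy m t x) = 0 ∧ K x = 1 := by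
  have hre : ∀ i j k, ((LoopMat.entry i j (logMonodromy m t x)).coeff k).im = 0 := fun i j k =>
    Complex.conj_eq_iff_im.1 (conj_coeff_logMonodromy hm h i j k)
  have him : ∀ l : Circle, (l : ℂ).im = 0 →
      (Wiener.eval l (LoopMat.entry 0 1 (logMonodromy m t x))).im = 0 := by
    intro l hl
    have h1 := congrFun (congrFun (matConj_eval_logMonodromy hm h l) 0) 1
    have h2 : l⁻¹ = l := by
      refine Circle.ext ?_
      rw [Circle.coe_inv_eq_conj, Complex.conj_eq_iff_im.2 hl]
    rw [h2, matConj_apply, LoopMat.eval_apply] at h1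
    exact Complex.conj_eq_iff_im.1 h1
  have e : ∀ z w : ℂ, z.im = 0 → w.im = 0 → (z = w ↔ z.re - w.re = 0) := fun z w hz hw => by
    rw [Complex.ext_iff, hz, hw, sub_eq_zero]; simp
  have e0 : ∀ z : ℂ, z.im = 0 → (z = 0 ↔ z.re = 0) := fun z hz => by
    rw [Complex.ext_iff, hz]; simp
  rw [solvesMonodromyProblem_iff hm h, forall_int_symm_iff
    (P := fun k => (LoopMat.entry 0 0 (logMonodromy m t x)).coeff k =
      (LoopMat.entry 0 0 (logMonodromy m t x)).coeff (-k))
      (fun k => by rw [neg_neg, eq_comm]) rfl,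
    forall_int_iff (P := fun k => (LoopMat.entry 1 0 (logMonodromy m t x)).coeff k =
        (LoopMat.entry 0 1 (logMonodromy m t x)).coeff (-k))]
  rw [e0 _ (him 1 (by simp)), e0 _ (him (-1) (by simp)), ← defect_eval_one, ← defect_eval_neg_one]
  simp only [neg_neg, e _ _ (hre _ _ _) (hre _ _ _), ← coeff_defect_diag, ← coeff_defect_pos,
    ← coeff_defect_neg]
  simp only [Prod.ext_iff, W.ext_iff, Prod.fst_zero, Prod.snd_zero, W.coeff_zero]
  tauto

end Defect

end LawsonDPW

namespace LawsonDPW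

/-! ### The second order term at the initial value -/

theorem W.eval_ofPoly {ρ : ℝ} (p : ℝ[X]) (l : ℂ) :
    (W.ofPoly p : W ρ).eval l = Polynomial.aeval l p := by
  rw [Polynomial.aeval_eq_sum_range, W.eval, tsum_eq_sum (s := Finset.range (p.natDegree + 1))]
  · exact Finset.sum_congr rfl fun k _ => (Complex.real_smul).symm
  · intro k hk
    have : p.coeff k = 0 := Polynomial.coeff_eq_zero_of_natDegree_lt (by simpa using hk)
    change (p.coeff k : ℂ) * l ^ k = 0
    rw [this, Complex.ofReal_zero, zero_mul]

theorem puncture_pow_half (m j : ℕ) : puncture m j ^ (m + 1) = (-1) ^ j := by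
  rw [puncture, ← Complex.exp_nat_mul, ← Complex.exp_pi_mul_I, ← Complex.exp_nat_mul]
  congr 1
  have : (2 * m + 2 : ℂ) ≠ 0 := by exact_mod_cast (by omega : 2 * m + 2 ≠ 0)
  push_cast
  field_simp

section Initial

variable {ρ : ℝ} [hρ : Fact (1 < ρ)]

/-- The loop `ν = (λ - λ⁻¹) / 2`. -/
def nu : Wiener ρ := (1 / 2 : ℂ) • (Wiener.lam - Wiener.lamInv)

theorem eval_nu (l : Circle) : Wiener.eval l (nu : Wiener ρ) = 1 / 2 * (l - (l : ℂ)⁻¹) := by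
  rw [nu, map_smul, map_sub, Wiener.eval_lam, Wiener.eval_lamInv, smul_eq_mul]

/-- The matrix `diag (f, -f)`. -/
def diagLoop (f : Wiener ρ) : LoopMat ρ := LoopMat.single 0 0 f - LoopMat.single 1 1 f

theorem eval_diagLoop (l : Circle) (f : Wiener ρ) :
    LoopMat.eval l (diagLoop f) = !![Wiener.eval l f, 0; 0, -Wiener.eval l f] := by
  rw [diagLoop, map_sub, LoopMat.eval_single, LoopMat.eval_single]
  ext i j
  fin_cases i <;> fin_cases j <;> simp [Matrix.single]

theorem eval_single_zero_one (l : Circle) (f : Wiener ρ) :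
    LoopMat.eval l (LoopMat.single 0 1 f) = !![0, Wiener.eval l f; 0, 0] := by
  rw [LoopMat.eval_single]
  ext i j
  fin_cases i <;> fin_cases j <;> simp [Matrix.single]

theorem eval_single_one_zero (l : Circle) (f : Wiener ρ) :
    LoopMat.eval l (LoopMat.single 1 0 f) = !![0, 0; Wiener.eval l f, 0] := by
  rw [LoopMat.eval_single]
  ext i j
  fin_cases i <;> fin_cases j <;> simp [Matrix.single]

/-- Since (-1)ʲ = p_j^{m+1}, the signs and the factors p_j^{∓m} combine into the powers m + 1, 1 and
2m + 1 of p_j, the exponents that produce c_m, c₀ and c_{2m}. -/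
theorem matA_x₀ {ρ : ℝ} (m j : ℕ) {l : ℂ} (hl : l ≠ 0) : matA m (x₀ ρ) j l =
    !![puncture m j ^ (m + 1) * l, puncture m j ^ 1 * (1 / 2 * (l - l⁻¹));
      -(puncture m j ^ (2 * m + 1) * (2 * l)), -(puncture m j ^ (m + 1) * l)] := by
  have hp := puncture_ne_zero m j
  have hs : ((-1 : ℂ) ^ j) ^ 2 = 1 := by rw [← pow_mul, mul_comm, pow_mul]; simp
  have h1 : puncture m j ^ (2 * m + 1) = puncture m j ^ m * (-1) ^ j := by
    rw [← puncture_pow_half m j, ← pow_add]; congr 1; ring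
  have h2 : puncture m j = (puncture m j ^ m)⁻¹ * (-1) ^ j := by
    rw [← puncture_pow_half m j, pow_succ, inv_mul_cancel_left₀ (pow_ne_zero _ hp)]
  rw [matA_eq, h1, puncture_pow_half, pow_one]
  simp only [x₀, W.eval_ofPoly]
  ext i k
  fin_cases i <;> fin_cases k
  · simp
  · simp only [map_mul, map_sub, map_pow, aeval_X, map_one, aeval_C, Fin.zero_eta, Fin.mk_one,
      Matrix.of_apply, Matrix.cons_val', Matrix.cons_val_one, Matrix.cons_val_zero,
      Matrix.cons_val_fin_one, Complex.coe_algebraMap]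
    conv_rhs => rw [h2]
    rw [mul_pow, hs]
    push_cast
    field_simp
  · simp
    ring
  · simp

theorem residue_x₀ (m j : ℕ) : residue m j (x₀ ρ) =
    puncture m j ^ (m + 1) • diagLoop Wiener.lam + puncture m j ^ (0 + 1) • LoopMat.single 0 1 nu -
      puncture m j ^ (2 * m + 1) • LoopMat.single 1 0 ((2 : ℂ) • Wiener.lam) := by
  refine LoopMat.ext_eval fun l => ?_
  simp only [map_add, map_sub, map_smul (LoopMat.eval l), eval_residue,
    matA_x₀ m j (Circle.coe_ne_zero l), eval_diagLoop, eval_single_zero_one, eval_single_one_zero,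
    eval_nu, Wiener.eval_lam, map_smul (Wiener.eval l)]
  ext i k
  fin_cases i <;> fin_cases k <;> simp

theorem commutator_residue_x₀ (m j : ℕ) :
    nilp * residue m j (x₀ ρ) - residue m j (x₀ ρ) * nilp =
      puncture m j ^ (m + 1) • LoopMat.single 1 0 ((2 : ℂ) • Wiener.lam) -
        puncture m j ^ (0 + 1) • diagLoop nu := by
  refine LoopMat.ext_eval fun l => ?_
  simp only [map_sub, map_mul, map_smul (LoopMat.eval l), eval_residue, eval_nilp,
    matA_x₀ m j (Circle.coe_ne_zero l), eval_diagLoop, eval_single_one_zero,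
    eval_nu, Wiener.eval_lam, map_smul (Wiener.eval l)]
  ext i k
  fin_cases i <;> fin_cases k <;> simp
  ring

theorem nilp_residue_nilp_x₀ (m j : ℕ) :
    nilp * residue m j (x₀ ρ) * nilp = puncture m j ^ (0 + 1) • LoopMat.single 1 0 nu := by
  refine LoopMat.ext_eval fun l => ?_
  simp only [map_mul, map_smul (LoopMat.eval l), eval_residue, eval_nilp,
    matA_x₀ m j (Circle.coe_ne_zero l), eval_single_one_zero, eval_nu]
  ext i k
  fin_cases i <;> fin_cases k <;> simp

theorem sum_tensor_loopForm {m i : ℕ} (hi : i < 2 * m + 2) (k : ℕ) (E : LoopMat ρ) :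
    ∑ j ∈ Finset.range (2 * m + 2), Path.tensor (loopForm m j k) (puncture m j ^ (i + 1) • E) =
      Path.tensor (cyclotomicForm m (i + k)) E := by
  rw [Path.sum_smul_tensor, sum_puncture_pow_smul_loopForm hi]

/-- The lower left terms 2λ c_{2m} from the residues and from the commutator cancel. What remains
involves only ν = (λ - λ⁻¹)/2 and λ - ν = (λ + λ⁻¹)/2. -/
theorem gaugedPotential_x₀ (m : ℕ) : gaugedPotential m (x₀ ρ) =
    Path.tensor (cyclotomicForm m m) (diagLoop (Wiener.lam - nu)) +
      Path.tensor (cyclotomicForm m 0) (LoopMat.single 0 1 nu) -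
      Path.tensor (cyclotomicForm m (2 * m)) (LoopMat.single 1 0 nu) := by
  have hr : (((x₀ ρ).1 : ℝ) : ℂ) = 1 := Complex.ofReal_one
  simp only [gaugedPotential, hr, one_pow, one_smul, commutator_residue_x₀, nilp_residue_nilp_x₀]
  simp only [residue_x₀]
  simp only [map_add, map_sub, Finset.sum_add_distrib, Finset.sum_sub_distrib]
  rw [sum_tensor_loopForm (by omega), sum_tensor_loopForm (by omega),
    sum_tensor_loopForm (by omega), sum_tensor_loopForm (by omega),
    sum_tensor_loopForm (by omega), sum_tensor_loopForm (by omega)]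
  have hd : diagLoop (Wiener.lam - nu) = diagLoop Wiener.lam - diagLoop (nu : Wiener ρ) := by
    simp only [diagLoop, map_sub]
    abel
  have h2 : m + m = 2 * m := by ring
  simp only [hd, map_sub, add_zero, zero_add, h2]
  abel

theorem totalIntegral_volterra_tensor_mul (u v : Path ℂ) (E F : LoopMat ρ) :
    totalIntegral (LoopMat ρ) (Path.tensor (volterra ℂ u) E * Path.tensor v F) =
      iterInt u v • (E * F) := by
  rw [Path.tensor_mul, totalIntegral_tensor, iterInt]

/-- The diagonal is invariant under λ ↦ 1/λ, so its constants never matter. Off the diagonal, diag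
(f, -f) anticommutes with the off-diagonal matrices: the iterated integrals combine into
commutators, and the square of ∫B contributes nothing. -/
theorem exists_eval_logMonodromyDeriv_x₀ (m : ℕ) : ∃ α β δ : ℂ, ∀ l : Circle,
    LoopMat.eval l (logMonodromyDeriv m (x₀ ρ)) = (2 * Real.pi * Complex.I : ℂ)⁻¹ •
      !![α * (l + (l : ℂ)⁻¹) ^ 2 + β * (l - (l : ℂ)⁻¹) ^ 2,
        1 / 4 * ((l : ℂ) ^ 2 - (l : ℂ)⁻¹ ^ 2) *
          (iterInt (cyclotomicForm m m) (cyclotomicForm m 0) -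
            iterInt (cyclotomicForm m 0) (cyclotomicForm m m));
        1 / 4 * ((l : ℂ) ^ 2 - (l : ℂ)⁻¹ ^ 2) *
          (iterInt (cyclotomicForm m m) (cyclotomicForm m (2 * m)) -
            iterInt (cyclotomicForm m (2 * m)) (cyclotomicForm m m)),
        α * (l + (l : ℂ)⁻¹) ^ 2 + δ * (l - (l : ℂ)⁻¹) ^ 2] := by
  refine ⟨1 / 4 * (iterInt (cyclotomicForm m m) (cyclotomicForm m m) -
      1 / 2 * totalIntegral ℂ (cyclotomicForm m m) ^ 2),
    1 / 4 * (1 / 2 * (totalIntegral ℂ (cyclotomicForm m 0) *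
      totalIntegral ℂ (cyclotomicForm m (2 * m))) -
      iterInt (cyclotomicForm m 0) (cyclotomicForm m (2 * m))),
    1 / 4 * (1 / 2 * (totalIntegral ℂ (cyclotomicForm m 0) *
      totalIntegral ℂ (cyclotomicForm m (2 * m))) -
      iterInt (cyclotomicForm m (2 * m)) (cyclotomicForm m 0)), fun l => ?_⟩
  rw [logMonodromyDeriv, map_smul]
  congr 1
  rw [gaugedPotential_x₀]
  generalize cyclotomicForm m m = c₁
  generalize cyclotomicForm m 0 = c₀
  generalize cyclotomicForm m (2 * m) = c₂
  simp only [map_add (volterra (LoopMat ρ)), map_sub (volterra (LoopMat ρ)), volterra_tensor,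
    mul_add, mul_sub, add_mul, sub_mul, map_add (totalIntegral (LoopMat ρ)),
    map_sub (totalIntegral (LoopMat ρ)), totalIntegral_volterra_tensor_mul, totalIntegral_tensor,
    smul_mul_smul_comm]
  simp only [map_add (LoopMat.eval l), map_sub (LoopMat.eval l), map_smul (LoopMat.eval l),
    map_mul (LoopMat.eval l), eval_diagLoop, eval_single_zero_one, eval_single_one_zero,
    map_sub (Wiener.eval l), Wiener.eval_lam, eval_nu]
  generalize (l : ℂ)⁻¹ = l'
  ext i k
  fin_cases i <;> fin_cases k <;> simp <;> ring

/-- The derivative of the equations of the monodromy problem with respect to `t` at `x₀`. -/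
theorem defect_logMonodromyDeriv_x₀ {m : ℕ} (hm : 1 ≤ m) :
    defect (logMonodromyDeriv m (x₀ ρ)) =
      (0, W.ofPoly (C (kappa m) * X ^ 2), W.ofPoly (C (-kappa m) * X), 0, 0) := by
  obtain ⟨α, β, δ, h⟩ := exists_eval_logMonodromyDeriv_x₀ (ρ := ρ) m
  have hI := iterInt_cyclotomicForm hm
  generalize iterInt (cyclotomicForm m m) (cyclotomicForm m 0) -
    iterInt (cyclotomicForm m 0) (cyclotomicForm m m) = I₁ at h hI
  generalize iterInt (cyclotomicForm m m) (cyclotomicForm m (2 * m)) -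
    iterInt (cyclotomicForm m (2 * m)) (cyclotomicForm m m) = I₂ at h hI
  have hpi : (2 * Real.pi * Complex.I : ℂ) ≠ 0 := Complex.two_pi_I_ne_zero
  set J : ℂ := (2 * Real.pi * Complex.I : ℂ)⁻¹ with hJ
  have hIJ : J * I₂ + J * I₁ = 4 * kappa m := by
    rw [← mul_add, hI, hJ, inv_mul_eq_iff_eq_mul₀ hpi]
    ring
  set A := logMonodromyDeriv m (x₀ ρ) with hA
  let Θ : Wiener ρ := (1 / 4 : ℂ) • (Wiener.lam * Wiener.lam - Wiener.lamInv * Wiener.lamInv)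
  have hΘ : ∀ l : Circle, Wiener.eval l Θ = 1 / 4 * ((l : ℂ) ^ 2 - (l : ℂ)⁻¹ ^ 2) := by
    intro l
    simp only [Θ, map_smul, map_sub, map_mul, Wiener.eval_lam, Wiener.eval_lamInv, smul_eq_mul,
      pow_two]
  have hc : ∀ k, Θ.coeff k = 1 / 4 * ((if k = 2 then 1 else 0) - if k = -2 then 1 else 0) := by
    intro k
    rw [Wiener.coeff_smul, Wiener.coeff_sub, Wiener.coeff_lam_mul, Wiener.coeff_lamInv_mul,
      Wiener.coeff_lam, Wiener.coeff_lamInv]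
    congr 3 <;> exact propext (by omega)
  clear_value Θ
  have h00 : ∀ k, (LoopMat.entry 0 0 A).coeff k = (LoopMat.entry 0 0 A).coeff (-k) := by
    refine (Wiener.eval_eq_eval_inv_iff _ _).1 fun l => ?_
    rw [← LoopMat.eval_apply, ← LoopMat.eval_apply, h, h]
    simp only [Matrix.smul_apply, Matrix.of_apply, Matrix.cons_val', Matrix.cons_val_zero,
      Matrix.cons_val_fin_one, Circle.coe_inv, inv_inv]
    ring
  have h01 : LoopMat.entry 0 1 A = (J * I₁) • Θ := by
    refine Wiener.ext_eval fun l => ?_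
    rw [← LoopMat.eval_apply, h, map_smul, hΘ]
    simp
    ring
  have h10 : LoopMat.entry 1 0 A = (J * I₂) • Θ := by
    refine Wiener.ext_eval fun l => ?_
    rw [← LoopMat.eval_apply, h, map_smul, hΘ]
    simp
    ring
  -- Θ is odd under λ ↦ 1/λ, so the difference of the two entries produces the sum J I₂ + J I₁ =
  -- 4κ_m.
  have hsum : ∀ k, (LoopMat.entry 1 0 A).coeff k - (LoopMat.entry 0 1 A).coeff (-k) =
      ((kappa m * ((if k = 2 then 1 else 0) - if k = -2 then 1 else 0) : ℝ) : ℂ) := by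
    intro k
    rw [h01, h10, Wiener.coeff_smul, Wiener.coeff_smul, hc, hc]
    simp only [neg_inj, show (-k = 2) = (k = -2) from propext (by omega),
      Complex.ofReal_mul, Complex.ofReal_sub, apply_ite Complex.ofReal, Complex.ofReal_one,
      Complex.ofReal_zero]
    linear_combination (1 / 4 * ((if k = 2 then 1 else 0) - if k = -2 then 1 else 0)) * hIJ
  refine Prod.ext ?_ (Prod.ext ?_ (Prod.ext ?_ (Prod.ext ?_ ?_)))
  · refine W.ext fun k => ?_
    rw [coeff_defect_diag, h00, sub_self]
    rfl
  · refine W.ext fun k => ?_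
    rw [coeff_defect_pos, ← Complex.sub_re, hsum, Complex.ofReal_re]
    change _ = (C (kappa m) * X ^ 2).coeff k
    rw [coeff_C_mul, coeff_X_pow, if_neg (by omega : ¬ (k : ℤ) = -2), sub_zero]
    norm_cast
  · refine W.ext fun k => ?_
    have := hsum (-(k + 1))
    rw [neg_neg] at this
    rw [coeff_defect_neg, ← Complex.sub_re, this, Complex.ofReal_re]
    change _ = (C (-kappa m) * X).coeff k
    rw [coeff_C_mul, coeff_X, if_neg (by omega : ¬ (-((k : ℤ) + 1) = 2)), zero_sub]
    simp only [show (-((k : ℤ) + 1) = -2) = (1 = k) from propext (by omega)]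
    ring
  · rw [defect_eval_one, h01, map_smul, hΘ]
    simp
  · rw [defect_eval_neg_one, h01, map_smul, hΘ]
    simp

end Initial

end LawsonDPW

namespace LawsonDPW

/-! ### An implicit function theorem -/

section Implicit

variable {E F : Type*} [NormedAddCommGroup E] [NormedSpace ℝ E] [CompleteSpace E]
  [NormedAddCommGroup F] [NormedSpace ℝ F] [CompleteSpace F]

/-- The velocity is -(∂ₓf)⁻¹ ∂ₜf, so any solution of D(1, x') = 0 is the velocity. Bijectivity of
∂ₓf suffices, as the inverse is bounded by the open mapping theorem. -/
theorem exists_implicit_curve {f : ℝ × E → F} {x : E} {D : ℝ × E →L[ℝ] F}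
    (hf : HasStrictFDerivAt f D (0, x)) (hinj : ∀ ξ, D (0, ξ) = 0 → ξ = 0)
    (hsurj : ∀ y, ∃ ξ, D (0, ξ) = y) {x' : E} (hx' : D (1, x') = 0) :
    ∃ φ : ℝ → E, φ 0 = x ∧ HasDerivAt φ x' 0 ∧
      ∀ᶠ p in nhds ((0 : ℝ), x), f p = f (0, x) ↔ p.2 = φ p.1 := by
  have hker : (D ∘L .inr ℝ ℝ E).ker = ⊥ := by
    rw [LinearMap.ker_eq_bot']
    exact hinj
  have hrange : (D ∘L .inr ℝ ℝ E).range = ⊤ := by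
    rw [LinearMap.range_eq_top]
    exact hsurj
  have hinv : (D ∘L .inr ℝ ℝ E).IsInvertible :=
    ⟨ContinuousLinearEquiv.ofBijective _ hker hrange, ContinuousLinearEquiv.coe_ofBijective _ _ _⟩
  have hd := (hf.hasStrictFDerivAt_implicitFunctionOfProdDomain hinv).hasFDerivAt.hasDerivAt
  refine ⟨hf.implicitFunctionOfProdDomain hinv,
    eq_of_tendsto_nhds (hf.tendsto_implicitFunctionOfProdDomain hinv), ?_, ?_⟩
  · convert! hd using 1
    have h1 : D (1, 0) + D (0, x') = 0 := by rw [← map_add]; simpa using hx'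
    change x' = -((D ∘L .inr ℝ ℝ E).inverse (D (1, 0)))
    rw [eq_neg_of_add_eq_zero_left h1, map_neg, neg_neg]
    exact ((hinv.inverse_apply_eq).2 rfl).symm
  · filter_upwards [hf.eventually_apply_eq_iff_implicitFunctionOfProdDomain hinv] with p hp
    rw [hp, eq_comm]

theorem exists_uniform_neighbourhood {E : Type*} [NormedAddCommGroup E] {P : ℝ → E → Prop} {φ : ℝ → E}
    (hφ : ContinuousAt φ 0) (h : ∀ᶠ p in nhds ((0 : ℝ), φ 0), P p.1 p.2 ↔ p.2 = φ p.1) :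
    ∃ ε > 0, ∃ δ > 0, ∀ t : ℝ, |t| < ε → ‖φ t - φ 0‖ < δ ∧
      ∀ y : E, ‖y - φ 0‖ < δ → (P t y ↔ y = φ t) := by
  obtain ⟨δ, hδ, hP⟩ := Metric.eventually_nhds_iff_ball.1 h
  obtain ⟨ε, hε, hc⟩ := Metric.continuousAt_iff.1 hφ δ hδ
  refine ⟨min ε δ, lt_min hε hδ, δ, hδ, fun t ht => ⟨?_, fun y hy => hP (t, y) ?_⟩⟩
  · rw [← dist_eq_norm]
    exact hc (by rw [Real.dist_eq, sub_zero]; exact ht.trans_le (min_le_left _ _))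
  · rw [← ball_prod_same, Set.mem_prod, Metric.mem_ball, Metric.mem_ball, Real.dist_eq,
      sub_zero, dist_eq_norm]
    exact ⟨ht.trans_le (min_le_right _ _), hy⟩

end Implicit

/-! ### Linearisation at the initial value -/

section Linearisation

variable {ρ : ℝ} [hρ : Fact (1 < ρ)]

/-- Only p₀ = 1 is enclosed, so the integral of B over 2πi is g(1) A₀ g(1)⁻¹ with g(1) = 1 + r N. -/
theorem logMonodromy_zero {m : ℕ} (hm : 1 ≤ m) (x : Params ρ) : logMonodromy m 0 x =
    (1 + x.1 • nilp) * residue m 0 x * (1 + x.1 • -nilp) := by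
  refine LoopMat.ext_eval fun l => ?_
  rw [eval_logMonodromy_zero hm, ← Complex.coe_smul, ← Complex.coe_smul, map_mul, map_mul, map_add,
    map_add, map_smul, map_smul, map_neg, map_one, eval_nilp, eval_residue, matA, Matrix.one_fin_two]
  ext i k
  fin_cases i <;> fin_cases k <;> simp <;> ring

theorem hasStrictFDerivAt_logMonodromy_zero {m : ℕ} (hm : 1 ≤ m) (x : Params ρ) :
    ∃ D : Params ρ →L[ℝ] LoopMat ρ, HasStrictFDerivAt (logMonodromy m 0) D x ∧
      ∀ ξ, D ξ = (1 + x.1 • nilp) * residue m 0 x * (ξ.1 • -nilp) +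
        ((1 + x.1 • nilp) * residue m 0 ξ + (ξ.1 • nilp) * residue m 0 x) *
          (1 + x.1 • -nilp) := by
  have hA : HasStrictFDerivAt (fun x : Params ρ => residue m 0 x) (residue m 0) x :=
    (residue m 0).hasStrictFDerivAt
  have hr : ∀ n : LoopMat ρ, HasStrictFDerivAt (fun x : Params ρ => 1 + x.1 • n)
      ((ContinuousLinearMap.fst ℝ ℝ (W ρ × W ρ × W ρ)).smulRight n) x := fun n =>
    (((ContinuousLinearMap.fst ℝ ℝ (W ρ × W ρ × W ρ)).smulRight n).hasStrictFDerivAt).const_add 1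
  have h := ((hr nilp).mul' hA).mul' (hr (-nilp))
  refine ⟨_, h.congr_of_eventuallyEq (Filter.Eventually.of_forall fun y => ?_), fun ξ => rfl⟩
  exact (logMonodromy_zero hm y).symm

/-- `A` is the derivative of the logarithm of the monodromy at `t = 0`, `x₀` in the direction
`ξ`. -/
def IsLinearisation (ξ : Params ρ) (A : LoopMat ρ) : Prop :=
  LoopMat.entry 0 0 A = Wiener.ofW 0 ξ.2.1 - Wiener.lamInv * Wiener.ofW 0 ξ.2.2.1 -
    (ξ.1 : ℂ) • nu ∧
  LoopMat.entry 0 1 A = Wiener.lamInv * Wiener.ofW 0 ξ.2.2.1 ∧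
  LoopMat.entry 1 0 A = Wiener.lam * Wiener.ofW 0 ξ.2.2.2 +
    (2 : ℂ) • Wiener.ofW 0 ξ.2.1 - Wiener.lamInv * Wiener.ofW 0 ξ.2.2.1 +
    (ξ.1 : ℂ) • (Wiener.lam + Wiener.lamInv)

theorem exists_hasStrictFDerivAt_logMonodromy_x₀ {m : ℕ} (hm : 1 ≤ m) :
    ∃ D : Params ρ →L[ℝ] LoopMat ρ, HasStrictFDerivAt (logMonodromy m 0) D (x₀ ρ) ∧
      ∀ ξ, IsLinearisation ξ (D ξ) := by
  obtain ⟨D, hD, hD'⟩ := hasStrictFDerivAt_logMonodromy_zero hm (x₀ ρ)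
  refine ⟨D, hD, fun ξ => ?_⟩
  have h : ∀ l : Circle, LoopMat.eval l (D ξ) =
      !![ξ.2.1.eval l - (l : ℂ)⁻¹ * ξ.2.2.1.eval l - ξ.1 * (1 / 2 * (l - (l : ℂ)⁻¹)),
        (l : ℂ)⁻¹ * ξ.2.2.1.eval l;
        l * ξ.2.2.2.eval l + 2 * ξ.2.1.eval l - (l : ℂ)⁻¹ * ξ.2.2.1.eval l +
          ξ.1 * (l + (l : ℂ)⁻¹),
        -(ξ.2.1.eval l - (l : ℂ)⁻¹ * ξ.2.2.1.eval l - ξ.1 * (1 / 2 * (l - (l : ℂ)⁻¹)))] := by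
    intro l
    have hr : (x₀ ρ).1 = 1 := rfl
    rw [hD', hr, one_smul, one_smul, ← Complex.coe_smul, ← Complex.coe_smul]
    simp only [map_add, map_mul, map_smul (LoopMat.eval l), map_neg, map_one, eval_nilp,
      eval_residue, matA_x₀ m 0 (Circle.coe_ne_zero l), puncture_zero, one_pow, one_mul,
      Matrix.one_fin_two]
    simp only [matA]
    ext i k
    fin_cases i <;> fin_cases k <;> simp <;> ring
  refine ⟨?_, ?_, ?_⟩ <;> refine Wiener.ext_eval fun l => ?_ <;>
    rw [← LoopMat.eval_apply, h] <;>
    simp only [map_add, map_sub, map_mul, map_smul (Wiener.eval l), Wiener.eval_lam,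
      Wiener.eval_lamInv, Wiener.eval_ofW, eval_nu, pow_zero, one_mul, smul_eq_mul] <;> rfl

theorem coeff_ofW_natCast (f : W ρ) (n : ℕ) : (Wiener.ofW 0 f).coeff n = (f.coeff n : ℂ) := by
  rw [Wiener.coeff_ofW, if_pos (Int.natCast_nonneg n), Int.toNat_natCast]

theorem coeff_ofW_of_neg (f : W ρ) {k : ℤ} (hk : k < 0) : (Wiener.ofW 0 f).coeff k = 0 := by
  rw [Wiener.coeff_ofW, if_neg hk.not_ge]

theorem coeff_lamInv_ofW (f : W ρ) (n : ℕ) :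
    (Wiener.lamInv * Wiener.ofW 0 f).coeff n = (f.coeff (n + 1) : ℂ) := by
  rw [Wiener.coeff_lamInv_mul, ← Nat.cast_succ, coeff_ofW_natCast]

theorem coeff_lamInv_ofW_neg_one (f : W ρ) :
    (Wiener.lamInv * Wiener.ofW 0 f).coeff (-1) = (f.coeff 0 : ℂ) := by
  rw [Wiener.coeff_lamInv_mul, neg_add_cancel]
  exact coeff_ofW_natCast f 0

theorem coeff_lamInv_ofW_of_lt (f : W ρ) {k : ℤ} (hk : k < -1) :
    (Wiener.lamInv * Wiener.ofW 0 f).coeff k = 0 := by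
  rw [Wiener.coeff_lamInv_mul, coeff_ofW_of_neg f (by omega)]

theorem coeff_lam_ofW (f : W ρ) (n : ℕ) :
    (Wiener.lam * Wiener.ofW 0 f).coeff (n + 1) = (f.coeff n : ℂ) := by
  rw [Wiener.coeff_lam_mul, add_sub_cancel_right, coeff_ofW_natCast]

theorem coeff_lam_ofW_of_nonpos (f : W ρ) {k : ℤ} (hk : k ≤ 0) :
    (Wiener.lam * Wiener.ofW 0 f).coeff k = 0 := by
  rw [Wiener.coeff_lam_mul, coeff_ofW_of_neg f (by omega)]

/-- The division of `f - f₀` by `λ`. -/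
def W.divX (f : W ρ) : W ρ := posPart (Wiener.lamInv * Wiener.ofW 0 f)

@[simp] theorem W.coeff_divX (f : W ρ) (k : ℕ) : f.divX.coeff k = f.coeff (k + 1) := by
  rw [W.divX, coeff_posPart, coeff_lamInv_ofW, Complex.ofReal_re]

/-- The product of `f` with `λ`. -/
def W.mulX (f : W ρ) : W ρ := posPart (Wiener.lam * Wiener.ofW 0 f)

@[simp] theorem W.coeff_mulX_zero (f : W ρ) : f.mulX.coeff 0 = 0 := by
  rw [W.mulX, coeff_posPart, Nat.cast_zero, coeff_lam_ofW_of_nonpos f le_rfl, Complex.zero_re]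

@[simp] theorem W.coeff_mulX_succ (f : W ρ) (k : ℕ) : f.mulX.coeff (k + 1) = f.coeff k := by
  rw [W.mulX, coeff_posPart, Nat.cast_succ, coeff_lam_ofW, Complex.ofReal_re]

/-- The real part of the value at a point of the unit circle. -/
def W.evalRe (l : Circle) : W ρ →L[ℝ] ℝ :=
  Complex.reCLM.comp (((Wiener.evalL l).restrictScalars ℝ).comp (Wiener.ofW 0))

theorem W.evalRe_apply (l : Circle) (f : W ρ) :
    W.evalRe l f = (Wiener.eval l (Wiener.ofW 0 f)).re := rfl

theorem W.evalRe_one_ofPoly (p : ℝ[X]) : W.evalRe 1 (W.ofPoly p : W ρ) = p.eval 1 := by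
  rw [W.evalRe_apply, Wiener.eval_ofW, pow_zero, one_mul, W.eval_ofPoly, Circle.coe_one]
  have : ((1 : ℝ) : ℂ) = 1 := Complex.ofReal_one
  rw [← this, ← Complex.coe_algebraMap, Polynomial.aeval_algebraMap_apply_eq_algebraMap_eval,
    Complex.coe_algebraMap, Complex.ofReal_re]

theorem W.evalRe_neg_one_ofPoly (p : ℝ[X]) : W.evalRe (-1) (W.ofPoly p : W ρ) = p.eval (-1) := by
  rw [W.evalRe_apply, Wiener.eval_ofW, pow_zero, one_mul, W.eval_ofPoly, Circle.coe_neg,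
    Circle.coe_one]
  have : ((-1 : ℝ) : ℂ) = -1 := by simp
  rw [← this, ← Complex.coe_algebraMap, Polynomial.aeval_algebraMap_apply_eq_algebraMap_eval,
    Complex.coe_algebraMap, Complex.ofReal_re]

/-- The constant coefficient. -/
def W.constCoeff : W ρ →L[ℝ] ℝ :=
  LinearMap.mkContinuous ⟨⟨fun f => f.coeff 0, fun _ _ => rfl⟩, fun _ _ => rfl⟩ 1 fun f => by
    rw [one_mul, W.norm_def]
    have h := f.summable.le_tsum 0 fun k _ => by positivity
    rwa [pow_zero, mul_one] at h

theorem hasStrictFDerivAt_K_x₀ : ∃ D : Params ρ →L[ℝ] ℝ, HasStrictFDerivAt K D (x₀ ρ) ∧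
    ∀ ξ, D ξ = -2 * ξ.2.2.1.coeff 0 - 1 / 2 * ξ.2.2.2.coeff 0 := by
  let a : Params ρ →L[ℝ] ℝ := W.constCoeff.comp
    ((ContinuousLinearMap.fst ℝ _ _).comp (ContinuousLinearMap.snd ℝ _ _))
  let b : Params ρ →L[ℝ] ℝ := W.constCoeff.comp ((ContinuousLinearMap.fst ℝ _ _).comp
    ((ContinuousLinearMap.snd ℝ _ _).comp (ContinuousLinearMap.snd ℝ _ _)))
  let c : Params ρ →L[ℝ] ℝ := W.constCoeff.comp ((ContinuousLinearMap.snd ℝ _ _).comp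
    ((ContinuousLinearMap.snd ℝ _ _).comp (ContinuousLinearMap.snd ℝ _ _)))
  have h := (a.hasStrictFDerivAt.mul a.hasStrictFDerivAt (x := x₀ ρ)).add
    (b.hasStrictFDerivAt.mul c.hasStrictFDerivAt (x := x₀ ρ))
  refine ⟨_, h.congr_of_eventuallyEq (Filter.Eventually.of_forall fun y => ?_), fun ξ => ?_⟩
  · change a y * a y + b y * c y = a y ^ 2 + b y * c y
    rw [pow_two]
  · have ha : a (x₀ ρ) = 0 := by
      change (X : ℝ[X]).coeff 0 = 0
      simp
    have hb : b (x₀ ρ) = -1 / 2 := by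
      change (C (1 / 2) * (X ^ 2 - 1) : ℝ[X]).coeff 0 = _
      rw [coeff_C_mul, coeff_sub, coeff_X_pow, coeff_one]
      norm_num
    have hc : c (x₀ ρ) = -2 := by
      change (C (-2) : ℝ[X]).coeff 0 = _
      rw [coeff_C_zero]
    change a (x₀ ρ) * a ξ + a (x₀ ρ) * a ξ + (b (x₀ ρ) * c ξ + c (x₀ ρ) * b ξ) =
      -2 * b ξ - 1 / 2 * c ξ
    rw [ha, hb, hc]
    ring

theorem coeff_nu (k : ℤ) : (nu : Wiener ρ).coeff k =
    1 / 2 * ((if k = 1 then 1 else 0) - if k = -1 then 1 else 0) := by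
  rw [nu, Wiener.coeff_smul, Wiener.coeff_sub, Wiener.coeff_lam, Wiener.coeff_lamInv]

/-! ### The linearised equations, coefficient by coefficient. -/

namespace IsLinearisation

variable {ξ : Params ρ} {A : LoopMat ρ}

theorem coeff_diag_zero (h : IsLinearisation ξ A) : (defect A).1.coeff 0 =
    ξ.2.1.coeff 1 - ξ.1 - ξ.2.2.1.coeff 2 + ξ.2.2.1.coeff 0 := by
  have h1 := coeff_lamInv_ofW ξ.2.2.1 1
  have h2 := coeff_ofW_natCast ξ.2.1 1
  rw [Nat.cast_one] at h1 h2
  rw [coeff_defect_diag, h.1, Nat.cast_zero, zero_add]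
  simp only [Wiener.coeff_sub, Wiener.coeff_smul, coeff_nu, h1, h2, coeff_lamInv_ofW_neg_one,
    coeff_ofW_of_neg ξ.2.1 (show (-1 : ℤ) < 0 by norm_num)]
  norm_num
  ring

theorem coeff_diag_succ (h : IsLinearisation ξ A) (k : ℕ) : (defect A).1.coeff (k + 1) =
    ξ.2.1.coeff (k + 2) - ξ.2.2.1.coeff (k + 3) := by
  rw [coeff_defect_diag, h.1, ← Nat.cast_succ]
  simp only [Wiener.coeff_sub, Wiener.coeff_smul, coeff_nu, coeff_lamInv_ofW, coeff_ofW_natCast]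
  rw [coeff_ofW_of_neg _ (by omega), coeff_lamInv_ofW_of_lt _ (by omega), if_neg (by omega),
    if_neg (by omega), if_neg (by omega), if_neg (by omega)]
  simp

theorem coeff_pos_zero (h : IsLinearisation ξ A) : (defect A).2.1.coeff 0 =
    2 * ξ.2.1.coeff 0 - 2 * ξ.2.2.1.coeff 1 := by
  have h1 := coeff_lamInv_ofW ξ.2.2.1 0
  have h2 := coeff_ofW_natCast ξ.2.1 0
  rw [Nat.cast_zero] at h1 h2
  rw [coeff_defect_pos, h.2.1, h.2.2, Nat.cast_zero, neg_zero]
  simp only [Wiener.coeff_sub, Wiener.coeff_add, Wiener.coeff_smul, Wiener.coeff_lam,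
    Wiener.coeff_lamInv, h1, h2, coeff_lam_ofW_of_nonpos ξ.2.2.2 le_rfl]
  norm_num
  ring

theorem coeff_pos_one (h : IsLinearisation ξ A) : (defect A).2.1.coeff 1 =
    ξ.2.2.2.coeff 0 + 2 * ξ.2.1.coeff 1 + ξ.1 - ξ.2.2.1.coeff 2 - ξ.2.2.1.coeff 0 := by
  have h1 := coeff_lamInv_ofW ξ.2.2.1 1
  have h2 := coeff_ofW_natCast ξ.2.1 1
  have h3 := coeff_lam_ofW ξ.2.2.2 0
  rw [Nat.cast_one] at h1 h2
  rw [Nat.cast_zero, zero_add] at h3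
  rw [coeff_defect_pos, h.2.1, h.2.2, Nat.cast_one]
  simp only [Wiener.coeff_sub, Wiener.coeff_add, Wiener.coeff_smul, Wiener.coeff_lam,
    Wiener.coeff_lamInv, h1, h2, h3, coeff_lamInv_ofW_neg_one]
  norm_num
  ring

theorem coeff_pos_add_two (h : IsLinearisation ξ A) (k : ℕ) : (defect A).2.1.coeff (k + 2) =
    ξ.2.2.2.coeff (k + 1) + 2 * ξ.2.1.coeff (k + 2) - ξ.2.2.1.coeff (k + 3) := by
  have h3 := coeff_lam_ofW ξ.2.2.2 (k + 1)
  rw [← Nat.cast_succ] at h3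
  rw [coeff_defect_pos, h.2.1, h.2.2]
  simp only [Wiener.coeff_sub, Wiener.coeff_add, Wiener.coeff_smul, Wiener.coeff_lam,
    Wiener.coeff_lamInv, coeff_lamInv_ofW, coeff_ofW_natCast, h3]
  rw [coeff_lamInv_ofW_of_lt _ (by omega), if_neg (by omega), if_neg (by omega)]
  simp

theorem coeff_neg_zero (h : IsLinearisation ξ A) : (defect A).2.2.1.coeff 0 =
    ξ.1 - ξ.2.2.1.coeff 0 - ξ.2.2.1.coeff 2 := by
  have h1 := coeff_lamInv_ofW ξ.2.2.1 1
  rw [Nat.cast_one] at h1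
  rw [coeff_defect_neg, h.2.1, h.2.2, Nat.cast_zero, zero_add]
  simp only [Wiener.coeff_sub, Wiener.coeff_add, Wiener.coeff_smul, Wiener.coeff_lam,
    Wiener.coeff_lamInv, h1, coeff_lamInv_ofW_neg_one,
    coeff_ofW_of_neg ξ.2.1 (show (-1 : ℤ) < 0 by norm_num),
    coeff_lam_ofW_of_nonpos ξ.2.2.2 (show (-1 : ℤ) ≤ 0 by norm_num)]
  norm_num
  ring

theorem coeff_neg_succ (h : IsLinearisation ξ A) (k : ℕ) : (defect A).2.2.1.coeff (k + 1) =
    -ξ.2.2.1.coeff (k + 3) := by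
  rw [coeff_defect_neg, h.2.1, h.2.2, ← Nat.cast_succ]
  simp only [Wiener.coeff_sub, Wiener.coeff_add, Wiener.coeff_smul, Wiener.coeff_lam,
    Wiener.coeff_lamInv, coeff_lamInv_ofW]
  rw [coeff_ofW_of_neg _ (by omega), coeff_lamInv_ofW_of_lt _ (by omega),
    coeff_lam_ofW_of_nonpos _ (by omega), if_neg (by omega), if_neg (by omega)]
  simp

theorem eval_one (h : IsLinearisation ξ A) : (defect A).2.2.2.1 = W.evalRe 1 ξ.2.2.1 := by
  rw [defect_eval_one, h.2.1, map_mul, Wiener.eval_lamInv, W.evalRe_apply, Circle.coe_one, inv_one,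
    one_mul]

theorem eval_neg_one (h : IsLinearisation ξ A) :
    (defect A).2.2.2.2 = -W.evalRe (-1) ξ.2.2.1 := by
  rw [defect_eval_neg_one, h.2.1, map_mul, Wiener.eval_lamInv, W.evalRe_apply, Circle.coe_neg,
    Circle.coe_one, inv_neg, inv_one, neg_one_mul, Complex.neg_re]

/-- The equations of negative degree make b a polynomial of degree at most 2, and b(±1) = 0 reduces
it to b₀ (1 - λ²) and gives r = 0. Then a₁ = -2b₀, while 𝒦 gives c₀ = -4b₀; the equation c₀ + 2a₁ =
0 forces b₀ = 0, and the other coefficients follow. -/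
theorem eq_zero (h : IsLinearisation ξ A) (h0 : defect A = 0)
    (hK : -2 * ξ.2.2.1.coeff 0 - 1 / 2 * ξ.2.2.2.coeff 0 = 0) : ξ = 0 := by
  have d0 := h.coeff_diag_zero
  have d1 := h.coeff_diag_succ
  have p0 := h.coeff_pos_zero
  have p1 := h.coeff_pos_one
  have p2 := h.coeff_pos_add_two
  have n0 := h.coeff_neg_zero
  have n1 := h.coeff_neg_succ
  have e1 := h.eval_one
  have e2 := h.eval_neg_one
  simp only [h0, Prod.fst_zero, Prod.snd_zero, W.coeff_zero] at d0 d1 p0 p1 p2 n0 n1 e1 e2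
  have hb3 : ∀ k, ξ.2.2.1.coeff (k + 3) = 0 := fun k => by linarith [n1 k]
  have hbp : ξ.2.2.1 = W.ofPoly (C (ξ.2.2.1.coeff 0) + C (ξ.2.2.1.coeff 1) * X +
      C (ξ.2.2.1.coeff 2) * X ^ 2) := by
    refine W.ext fun k => ?_
    change _ = (C (ξ.2.2.1.coeff 0) + C (ξ.2.2.1.coeff 1) * X +
      C (ξ.2.2.1.coeff 2) * X ^ 2 : ℝ[X]).coeff k
    rw [coeff_add, coeff_add, coeff_C_mul, coeff_C_mul, coeff_C, coeff_X, coeff_X_pow]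
    match k with
    | 0 => simp
    | 1 => simp
    | 2 => simp
    | k + 3 => simp [hb3 k]
  rw [hbp, W.evalRe_one_ofPoly] at e1
  rw [hbp, W.evalRe_neg_one_ofPoly] at e2
  simp only [eval_add, eval_mul, eval_C, eval_X, eval_pow] at e1 e2
  have hb0 : ξ.2.2.1.coeff 0 = 0 := by linarith
  have hb1 : ξ.2.2.1.coeff 1 = 0 := by linarith
  have hb2 : ξ.2.2.1.coeff 2 = 0 := by linarith
  refine Prod.ext ?_ (Prod.ext ?_ (Prod.ext ?_ ?_))
  · change ξ.1 = 0
    linarith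
  · refine W.ext fun k => ?_
    change ξ.2.1.coeff k = 0
    match k with
    | 0 => linarith
    | 1 => linarith
    | k + 2 => linarith [d1 k, hb3 k]
  · refine W.ext fun k => ?_
    change ξ.2.2.1.coeff k = 0
    match k with
    | 0 => exact hb0
    | 1 => exact hb1
    | 2 => exact hb2
    | k + 3 => exact hb3 k
  · refine W.ext fun k => ?_
    change ξ.2.2.2.coeff k = 0
    match k with
    | 0 => linarith
    | k + 1 => linarith [d1 k, hb3 k, p2 k]

end IsLinearisation

/-- The linear system is triangular apart from finitely many coefficients: the negative degrees fix
b beyond degree 2, then the diagonal equations fix a, and the positive degrees fix c. -/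
theorem exists_linearisation_eq (y : Target ρ) (κ : ℝ) : ∃ ξ : Params ρ,
    (∀ A, IsLinearisation ξ A → defect A = y) ∧
      -2 * ξ.2.2.1.coeff 0 - 1 / 2 * ξ.2.2.2.coeff 0 = κ := by
  obtain ⟨φ, p, g, y₁, y₂⟩ := y
  let b' : W ρ := (-1 : ℝ) • g.mulX.mulX
  let e₁ : ℝ := W.evalRe 1 b'
  let e₂ : ℝ := W.evalRe (-1) b'
  -- The values of b at ±1 determine s, the sum of the even coefficients of P, and the odd
  -- coefficient β₁. The equation of degree -1 then forces r = s, and β₀ is the value that makes the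
  -- equation for 𝒦 hold.
  let s : ℝ := (y₁ - y₂ - e₁ - e₂) / 2
  let β₀ : ℝ := (4 * s + 2 * φ.coeff 0 - p.coeff 1 - g.coeff 0 - 2 * κ) / 8
  let β₁ : ℝ := (y₁ + y₂ - e₁ + e₂) / 2
  let P : ℝ[X] := C β₀ + C β₁ * X + C (s - β₀) * X ^ 2
  let b : W ρ := b' + W.ofPoly P
  let a : W ρ := b.divX + φ.mulX + W.ofPoly (C (p.coeff 0 / 2) + C (s - β₀) * X)
  let c : W ρ := p.divX + (-2 : ℝ) • a.divX + b.divX.divX + W.ofPoly (C (β₀ - s))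
  have hP : ∀ k, (W.ofPoly P : W ρ).coeff k = (if k = 0 then β₀ else 0) +
      β₁ * (if 1 = k then 1 else 0) + (s - β₀) * if k = 2 then 1 else 0 := by
    intro k
    change (C β₀ + C β₁ * X + C (s - β₀) * X ^ 2 : ℝ[X]).coeff k = _
    rw [coeff_add, coeff_add, coeff_C_mul, coeff_C_mul, coeff_C, coeff_X, coeff_X_pow]
  have hQ : ∀ k, (W.ofPoly (C (p.coeff 0 / 2) + C (s - β₀) * X) : W ρ).coeff k =
      (if k = 0 then p.coeff 0 / 2 else 0) + (s - β₀) * if 1 = k then 1 else 0 := by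
    intro k
    change (C (p.coeff 0 / 2) + C (s - β₀) * X : ℝ[X]).coeff k = _
    rw [coeff_add, coeff_C_mul, coeff_C, coeff_X]
  have hR : ∀ k, (W.ofPoly (C (β₀ - s)) : W ρ).coeff k = if k = 0 then β₀ - s else 0 := fun k =>
    coeff_C
  have hb : ∀ k, b.coeff k = -1 * g.mulX.mulX.coeff k + ((if k = 0 then β₀ else 0) +
      β₁ * (if 1 = k then 1 else 0) + (s - β₀) * if k = 2 then 1 else 0) := fun k => by
    rw [← hP]; rfl
  have ha : ∀ k, a.coeff k = b.coeff (k + 1) + φ.mulX.coeff k +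
      ((if k = 0 then p.coeff 0 / 2 else 0) + (s - β₀) * if 1 = k then 1 else 0) := fun k => by
    rw [← hQ, ← W.coeff_divX]; rfl
  have hc : ∀ k, c.coeff k = p.coeff (k + 1) + -2 * a.coeff (k + 1) + b.coeff (k + 2) +
      if k = 0 then β₀ - s else 0 := fun k => by
    rw [← hR, ← W.coeff_divX, ← W.coeff_divX, ← W.coeff_divX, ← W.coeff_divX]; rfl
  have hb0 : b.coeff 0 = β₀ := by simp [hb]
  have hb1 : b.coeff 1 = β₁ := by simp [hb]
  have hb2 : b.coeff 2 = -g.coeff 0 + (s - β₀) := by simp [hb]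
  have hb3 : ∀ k, b.coeff (k + 3) = -g.coeff (k + 1) := fun k => by simp [hb]
  have ha0 : a.coeff 0 = b.coeff 1 + p.coeff 0 / 2 := by rw [ha]; simp
  have ha1 : a.coeff 1 = b.coeff 2 + φ.coeff 0 + (s - β₀) := by rw [ha]; simp
  have ha2 : ∀ k, a.coeff (k + 2) = b.coeff (k + 3) + φ.coeff (k + 1) := fun k => by
    rw [ha]; simp
  have hc0 : c.coeff 0 = p.coeff 1 - 2 * a.coeff 1 + b.coeff 2 + (β₀ - s) := by
    rw [hc, if_pos rfl]; ring
  have hc1 : ∀ k, c.coeff (k + 1) = p.coeff (k + 2) - 2 * a.coeff (k + 2) + b.coeff (k + 3) :=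
    fun k => by rw [hc, if_neg (by omega)]; ring
  have he1 : W.evalRe 1 b = e₁ + (β₀ + β₁ + (s - β₀)) := by
    simp only [b, map_add, W.evalRe_one_ofPoly, P]
    simp [e₁]
  have he2 : W.evalRe (-1) b = e₂ + (β₀ - β₁ + (s - β₀)) := by
    simp only [b, map_add, W.evalRe_neg_one_ofPoly, P]
    simp [e₂]
    ring
  refine ⟨(s, a, b, c), fun A hA => ?_, ?_⟩
  · refine Prod.ext ?_ (Prod.ext ?_ (Prod.ext ?_ (Prod.ext ?_ ?_)))
    · refine W.ext fun k => ?_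
      match k with
      | 0 => rw [hA.coeff_diag_zero]; linarith
      | k + 1 => rw [hA.coeff_diag_succ]; linarith [ha2 k]
    · refine W.ext fun k => ?_
      match k with
      | 0 => rw [hA.coeff_pos_zero]; linarith
      | 1 => rw [hA.coeff_pos_one]; linarith
      | k + 2 => rw [hA.coeff_pos_add_two]; linarith [hc1 k]
    · refine W.ext fun k => ?_
      match k with
      | 0 => rw [hA.coeff_neg_zero]; linarith
      | k + 1 => rw [hA.coeff_neg_succ]; linarith [hb3 k]
    · rw [hA.eval_one, he1]
      simp only [s, β₁]
      ring
    · rw [hA.eval_neg_one, he2]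
      simp only [s, β₁]
      ring
  · change -2 * b.coeff 0 - 1 / 2 * c.coeff 0 = κ
    rw [hc0, ha1, hb2, hb0]
    simp only [β₀]
    ring

end Linearisation

end LawsonDPW

namespace LawsonDPW

/-! ### Solution of the monodromy problem -/

section Solution

variable {ρ : ℝ} [hρ : Fact (1 < ρ)]

theorem W.coeff_ofPoly {ρ : ℝ} (p : ℝ[X]) (k : ℕ) : (W.ofPoly p : W ρ).coeff k = p.coeff k := rfl

/-- For fixed r the value at t = 0 is linear in (a, b, c). With r = 1 it is therefore given by the
linearised formulas in the direction (0, a, b, c). -/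
theorem defect_logMonodromy_x₀ {m : ℕ} (hm : 1 ≤ m) : defect (logMonodromy m 0 (x₀ ρ)) = 0 := by
  have h : IsLinearisation (0, (x₀ ρ).2) (logMonodromy m 0 (x₀ ρ)) := by
    refine ⟨?_, ?_, ?_⟩ <;> refine Wiener.ext_eval fun l => ?_ <;>
      rw [← LoopMat.eval_apply, eval_logMonodromy_zero hm] <;>
      simp only [map_add, map_sub, map_mul, map_smul (Wiener.eval l), Wiener.eval_lam,
        Wiener.eval_lamInv, Wiener.eval_ofW, pow_zero, one_mul, smul_eq_mul, Complex.ofReal_zero,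
        zero_mul] <;> simp [x₀]
  have h₁ : (X ^ 2 - 1 : ℝ[X]).eval 1 = 0 := by simp
  have h₂ : (X ^ 2 - 1 : ℝ[X]).eval (-1) = 0 := by simp
  refine Prod.ext ?_ (Prod.ext ?_ (Prod.ext ?_ (Prod.ext ?_ ?_)))
  · refine W.ext fun k => ?_
    match k with
    | 0 =>
      rw [h.coeff_diag_zero]
      simp only [x₀, W.coeff_ofPoly, coeff_C_mul, coeff_sub, coeff_X_pow, coeff_one, coeff_X]
      norm_num
    | k + 1 =>
      rw [h.coeff_diag_succ]
      simp [x₀, W.coeff_ofPoly, coeff_X, coeff_X_pow, coeff_one]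
  · refine W.ext fun k => ?_
    match k with
    | 0 =>
      rw [h.coeff_pos_zero]
      simp only [x₀, W.coeff_ofPoly, coeff_C_mul, coeff_sub, coeff_X_pow, coeff_one, coeff_X]
      norm_num
    | 1 =>
      rw [h.coeff_pos_one]
      simp only [x₀, W.coeff_ofPoly, coeff_C_mul, coeff_sub, coeff_X_pow, coeff_one, coeff_X,
        coeff_C]
      norm_num
    | k + 2 =>
      rw [h.coeff_pos_add_two]
      simp only [x₀, W.coeff_ofPoly, coeff_C_mul, coeff_sub, coeff_X_pow, coeff_one, coeff_X,
        coeff_C]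
      simp
  · refine W.ext fun k => ?_
    match k with
    | 0 =>
      rw [h.coeff_neg_zero]
      simp only [x₀, W.coeff_ofPoly, coeff_C_mul, coeff_sub, coeff_X_pow, coeff_one]
      norm_num
    | k + 1 =>
      rw [h.coeff_neg_succ]
      simp only [x₀, W.coeff_ofPoly, coeff_C_mul, coeff_sub, coeff_X_pow, coeff_one]
      simp
  · rw [h.eval_one]
    change W.evalRe 1 (W.ofPoly (C (1 / 2) * (X ^ 2 - 1))) = 0
    rw [W.evalRe_one_ofPoly, eval_mul, h₁, mul_zero]
  · rw [h.eval_neg_one]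
    change -W.evalRe (-1) (W.ofPoly (C (1 / 2) * (X ^ 2 - 1))) = 0
    rw [W.evalRe_neg_one_ofPoly, eval_mul, h₂, mul_zero, neg_zero]

theorem K_x₀ {ρ : ℝ} : K (x₀ ρ) = 1 := by
  simp only [K, x₀, W.coeff_ofPoly, coeff_C_mul, coeff_sub, coeff_X_pow, coeff_one, coeff_X_zero,
    coeff_C_zero]
  norm_num

/-- The derivative of the solution at `t = 0`. -/
def initialVelocity (m : ℕ) (ρ : ℝ) : Params ρ :=
  (0, W.ofPoly (C (kappa m) * (1 - X ^ 2)), W.ofPoly (C (kappa m) * (X - X ^ 3)), 0)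

/-- Here b = λ a and r = c = 0, so the diagonal entry of the linearisation vanishes and both
off-diagonal entries equal κ_m (1 - λ²). The outcome is the negative of the t-derivative in
`defect_logMonodromyDeriv_x₀`. -/
theorem defect_linearisation_initialVelocity {m : ℕ} {A : LoopMat ρ}
    (h : IsLinearisation (initialVelocity m ρ) A) :
    defect A = (0, W.ofPoly (C (-kappa m) * X ^ 2), W.ofPoly (C (kappa m) * X), 0, 0) := by
  refine Prod.ext ?_ (Prod.ext ?_ (Prod.ext ?_ (Prod.ext ?_ ?_)))
  · refine W.ext fun k => ?_
    match k with
    | 0 =>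
      rw [h.coeff_diag_zero]
      simp only [initialVelocity, W.coeff_ofPoly, coeff_C_mul, coeff_sub, coeff_X_pow, coeff_one,
        coeff_X]
      norm_num
    | k + 1 =>
      rw [h.coeff_diag_succ]
      simp only [initialVelocity, W.coeff_ofPoly, coeff_C_mul, coeff_sub, coeff_X_pow, coeff_one,
        coeff_X]
      simp
  · refine W.ext fun k => ?_
    match k with
    | 0 =>
      rw [h.coeff_pos_zero]
      simp only [initialVelocity, W.coeff_ofPoly, coeff_C_mul, coeff_sub, coeff_X_pow, coeff_one,
        coeff_X]
      norm_num
    | 1 =>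
      rw [h.coeff_pos_one]
      simp only [initialVelocity, W.coeff_ofPoly, coeff_C_mul, coeff_sub, coeff_X_pow, coeff_one,
        coeff_X, W.coeff_zero]
      norm_num
    | k + 2 =>
      rw [h.coeff_pos_add_two]
      simp only [initialVelocity, W.coeff_ofPoly, coeff_C_mul, coeff_sub, coeff_X_pow, coeff_one,
        coeff_X, W.coeff_zero]
      simp
      split_ifs <;> ring
  · refine W.ext fun k => ?_
    match k with
    | 0 =>
      rw [h.coeff_neg_zero]
      simp only [initialVelocity, W.coeff_ofPoly, coeff_C_mul, coeff_sub, coeff_X_pow, coeff_X]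
      norm_num
    | k + 1 =>
      rw [h.coeff_neg_succ]
      simp only [initialVelocity, W.coeff_ofPoly, coeff_C_mul, coeff_sub, coeff_X_pow, coeff_X]
      simp [eq_comm]
  · rw [h.eval_one]
    change W.evalRe 1 (W.ofPoly (C (kappa m) * (X - X ^ 3))) = 0
    rw [W.evalRe_one_ofPoly]
    simp
  · rw [h.eval_neg_one]
    change -W.evalRe (-1) (W.ofPoly (C (kappa m) * (X - X ^ 3))) = 0
    rw [W.evalRe_neg_one_ofPoly]
    norm_num

/-- The equations of the monodromy problem. -/
def equations (m : ℕ) (p : ℝ × Params ρ) : Target ρ × ℝ :=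
  (defect (logMonodromy m p.1 p.2), K p.2)

theorem exists_hasStrictFDerivAt_equations {m : ℕ} (hm : 1 ≤ m) :
    ∃ D : ℝ × Params ρ →L[ℝ] Target ρ × ℝ, HasStrictFDerivAt (equations m) D (0, x₀ ρ) ∧
      ∀ τ ξ, ∃ A, IsLinearisation ξ A ∧
        D (τ, ξ) = (τ • defect (logMonodromyDeriv m (x₀ ρ)) + defect A,
          -2 * ξ.2.2.1.coeff 0 - 1 / 2 * ξ.2.2.2.coeff 0) := by
  obtain ⟨D₁, h₁, h₁'⟩ := hasStrictFDerivAt_logMonodromy_sub m (x₀ ρ)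
  obtain ⟨D₂, h₂, h₂'⟩ := exists_hasStrictFDerivAt_logMonodromy_x₀ (ρ := ρ) hm
  obtain ⟨D₃, h₃, h₃'⟩ := hasStrictFDerivAt_K_x₀ (ρ := ρ)
  have hs : HasStrictFDerivAt (fun p : ℝ × Params ρ => p.2)
    (ContinuousLinearMap.snd ℝ ℝ (Params ρ)) (0, x₀ ρ) := hasStrictFDerivAt_snd
  have h := (defect.hasStrictFDerivAt.comp (0, x₀ ρ) (h₁.add (h₂.comp (0, x₀ ρ) hs))).prodMk
    (h₃.comp (0, x₀ ρ) hs)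
  refine ⟨_, h.congr_of_eventuallyEq (Filter.Eventually.of_forall fun p => ?_), fun τ ξ =>
    ⟨D₂ ξ, h₂' ξ, ?_⟩⟩
  · change (defect (logMonodromy m p.1 p.2 - logMonodromy m 0 p.2 + logMonodromy m 0 p.2), K p.2) =
      equations m p
    rw [sub_add_cancel, equations]
  · change (defect (D₁ (τ, ξ) + D₂ ξ), D₃ ξ) = _
    rw [map_add, h₁', map_smul, h₃']

theorem exists_solution_curve {m : ℕ} (hm : 1 ≤ m) : ∃ φ : ℝ → Params ρ, φ 0 = x₀ ρ ∧
    HasDerivAt φ (initialVelocity m ρ) 0 ∧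
    ∀ᶠ p in nhds ((0 : ℝ), x₀ ρ), SolvesMonodromyProblem m p.1 p.2 ↔ p.2 = φ p.1 := by
  obtain ⟨D, hD, hD'⟩ := exists_hasStrictFDerivAt_equations (ρ := ρ) hm
  have hinj : ∀ ξ, D (0, ξ) = 0 → ξ = 0 := by
    intro ξ h0
    obtain ⟨A, hA, e⟩ := hD' 0 ξ
    rw [e, zero_smul, zero_add, Prod.mk_eq_zero] at h0
    exact hA.eq_zero h0.1 h0.2
  have hsurj : ∀ y, ∃ ξ, D (0, ξ) = y := by
    rintro ⟨y, κ⟩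
    obtain ⟨ξ, h1, h2⟩ := exists_linearisation_eq y κ
    obtain ⟨A, hA, e⟩ := hD' 0 ξ
    refine ⟨ξ, ?_⟩
    rw [e, zero_smul, zero_add, h1 A hA, h2]
  have hv : D (1, initialVelocity m ρ) = 0 := by
    obtain ⟨A, hA, e⟩ := hD' 1 (initialVelocity m ρ)
    rw [e, one_smul, defect_logMonodromyDeriv_x₀ hm, defect_linearisation_initialVelocity hA]
    refine Prod.ext (Prod.ext ?_ (Prod.ext ?_ (Prod.ext ?_ (Prod.ext ?_ ?_)))) ?_
    · exact add_zero _
    · refine W.ext fun k => ?_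
      change (C (kappa m) * X ^ 2 : ℝ[X]).coeff k + (C (-kappa m) * X ^ 2 : ℝ[X]).coeff k = 0
      rw [coeff_C_mul, coeff_C_mul]
      ring
    · refine W.ext fun k => ?_
      change (C (-kappa m) * X : ℝ[X]).coeff k + (C (kappa m) * X : ℝ[X]).coeff k = 0
      rw [coeff_C_mul, coeff_C_mul]
      ring
    · exact add_zero _
    · exact add_zero _
    · change -2 * (C (kappa m) * (X - X ^ 3) : ℝ[X]).coeff 0 - 1 / 2 * 0 = (0 : ℝ)
      simp
  obtain ⟨φ, h0, hd, hev⟩ := exists_implicit_curve hD hinj hsurj hv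
  refine ⟨φ, h0, hd, ?_⟩
  -- Near (0, x₀) the series converge, so the monodromy problem is the level set of `equations`
  -- through (0, x₀), whose value there is (0, 1).
  filter_upwards [hev, eventually_isSmall m (x₀ ρ)] with p hp hs
  rw [solvesMonodromyProblem_iff_defect hm hs, ← hp, equations, equations,
    defect_logMonodromy_x₀ hm, K_x₀]
  exact Prod.mk_inj.symm

end Solution

end LawsonDPW

end

open Polynomial LawsonDPW in
/-- For all small `t` the monodromy problem has exactly one solution `x(t) = (r, a, b, c)(t)` near
`x₀`, and `r'(0) = 0`, `a'(0) = (1 - λ²) κ_m`, `b'(0) = (λ - λ³) κ_m`, `c'(0) = 0`. -/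
theorem mainTheorem5 (m : ℕ) (hm : 1 ≤ m) (ρ : ℝ) [Fact (1 < ρ)] :
    ∃ ε > 0, ∃ δ > 0, ∃ x : ℝ → Params ρ,
      (∀ t : ℝ, |t| < ε → ‖x t - x₀ ρ‖ < δ ∧
        ∀ y : Params ρ, ‖y - x₀ ρ‖ < δ → (SolvesMonodromyProblem m t y ↔ y = x t)) ∧
      x 0 = x₀ ρ ∧
      HasDerivAt (fun t => (x t).2.1) (W.ofPoly (C (kappa m) * (1 - X ^ 2))) 0 ∧
      HasDerivAt (fun t => (x t).2.2.1) (W.ofPoly (C (kappa m) * (X - X ^ 3))) 0 ∧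
      HasDerivAt (fun t => (x t).2.2.2) 0 0 ∧
      HasDerivAt (fun t => (x t).1) 0 0 := by
  obtain ⟨φ, h0, hd, hev⟩ := exists_solution_curve (ρ := ρ) hm
  rw [← h0] at hev
  obtain ⟨ε, hε, δ, hδ, h⟩ := exists_uniform_neighbourhood hd.continuousAt hev
  rw [h0] at h
  have h2 := hd.snd
  have h22 := h2.snd
  exact ⟨ε, hε, δ, hδ, φ, h, h0, h2.fst, h22.fst, h22.snd, hd.fst⟩
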